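/- Let $\mathbb F\in\{\mathbb R,\mathbb C,\mathbb H\}$, $d=\dim_{\mathbb R}\mathbb F$, let $q\ge 1$ and $p\ge 2q$ be integers, and let $\mathcal G_{p,q}(\mathbb F)=G/K$ be the non-compact Grassmannian with $G=SO_0(q,p),\,SU(q,p),\,Sp(q,p)$ and $K=SO(q)\times SO(p),\,S(U(q)\times U(p)),\,Sp(q)\times Sp(p)$, respectively. For $t\in\mathbb R^q$ let $\underline t=\mathrm{diag}(t_1,\dots,t_q)$ and, in $(q,q,p-q)$-block form, \[ H_t=\begin{pmatrix}0&\underline t&0\\ \underline t&0&0\\ 0&0&0\end{pmatrix},\qquad a_t=\exp(H_t). \] Let $\mathfrak g$ be the Lie algebra of $G$, $\mathfrak a=\{H_t: t\in\mathbb R^q\}$, $A=\exp\mathfrak a$, $f_i(H_t)=t_i$, and let $N=\exp\mathfrak n$, where $\mathfrak n$ is the sum of the root spaces $\mathfrak g_\alpha=\{X\in\mathfrak g: [H,X]=\alpha(H)X\ \forall H\in\mathfrak a\}$ of the positive roots $f_i,\,2f_i$ $(1\le i\le q)$ and $f_i\pm f_j$ $(1\le i<j\le q)$. For $g\in G$ let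 $H(g)$ be the unique element of $\mathfrak a\cong\mathbb R^q$ with $g\in K\exp(H(g))N$ (Iwasawa decomposition $G=KAN$). Identify $\mathfrak a_{\mathbb C}^*$ with $\mathbb C^q$ via $\lambda(H_t)=\sum_r\lambda_r t_r$, and put $\rho^{BC}=\bigl(\tfrac d2(p+q+2-2i)-1\bigr)_{i=1,\dots,q}$. The spherical functions of $\mathcal G_{p,q}(\mathbb F)$ are given by \[ \varphi_\lambda^p(g)=\int_K e^{(i\lambda-\rho^{BC})(H(gk))}\,dk,\qquad \lambda\in\mathbb C^q, \] with the normalized Haar measure $dk$ on $K$. For a square matrix $x$ let $\Delta_r(x)$ be the determinant of its upper left $r\times r$ block, where for $\mathbb F=\mathbb H$ one takes $\det=(\det_{\mathbb C})^{1/2}$. For hermitian positive definite $x\in M_q(\mathbb F)$ put $\Delta(x)=\Delta_q(x)$ and \[ \Delta_\mu(x)=\Delta_1(x)^{\mu_1-\mu_2}\cdots\Delta_{q-1}(x)^{\mu_{q-1}-\mu_q}\,\Delta_q(x)^{\mu_q}\qquad(\mu\in\mathbb C^q). \] Let $U_0(q,\mathbb F)$ be the identity component of $U(q,\mathbb F)$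 with normalized Haar measure $du$, let $B_q=\{w\in M_q(\mathbb F): w^*w<I\}$, and let $m_p$ be the probability measure \[ dm_p(w)=\kappa^{-1}\,\Delta(I-w^*w)^{pd/2-\gamma}\,dw \quad\text{on } B_q,\qquad \gamma=d\bigl(q-\tfrac12\bigr)+1,\qquad \kappa=\int_{B_q}\Delta(I-w^*w)^{pd/2-\gamma}\,dw, \] where $dw$ is Lebesgue measure. Then for all $\lambda\in\mathbb C^q$ and $t\in\mathbb R^q$ \[ \varphi_\lambda^p(a_t)=\int_{U_0(q,\mathbb F)\times B_q}\Delta_{(i\lambda-\rho^{BC})/2}\bigl(g_t(u,w)\bigr)\,dm_p(w)\,du, \] \[ g_t(u,w)=u^{-1}(\cosh\underline t+\sinh\underline t\,w)^*(\cosh\underline t+\sinh\underline t\,w)\,u, \] and the same formula holds with $g_t(u,w)$ replaced by \[ \widetilde g_t(u,w)=u^{-1}(\cosh\underline t+\sinh\underline t\,w)(\cosh\underline t+\sinh\underline t\,w)^*u. \] All integrals converge absolutely. -/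

import Mathlib

open MeasureTheory Matrix
open scoped Quaternion

noncomputable section

namespace Grassmann

/-! ### Matrices as measurable spaces -/

instance instMeasurableSpaceMatrix {m n F : Type} [MeasurableSpace F] :
    MeasurableSpace (Matrix m n F) :=
  inferInstanceAs (MeasurableSpace (m → n → F))

instance instBorelSpaceMatrix {m n F : Type} [Fintype m] [Fintype n] [TopologicalSpace F]
    [SecondCountableTopology F] [MeasurableSpace F] [BorelSpace F] :
    BorelSpace (Matrix m n F) :=
  inferInstanceAs (BorelSpace (m → n → F))

instance instSecondCountableMatrix {m n F : Type} [Fintype m] [Fintype n] [TopologicalSpace F]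
    [SecondCountableTopology F] : SecondCountableTopology (Matrix m n F) :=
  inferInstanceAs (SecondCountableTopology (m → n → F))

instance instMeasurableSpaceQuaternion : MeasurableSpace ℍ[ℝ] := borel _

instance instBorelSpaceQuaternion : BorelSpace ℍ[ℝ] := ⟨rfl⟩

/-! ### The scalar fields `ℝ`, `ℂ`, `ℍ` -/

/-- The group `U(n, F)` of matrices `X` with `X^* X = X X^* = I`. -/
abbrev U (F : Type) [NormedDivisionRing F] [StarRing F] (n : ℕ) :=
  unitary (Matrix (Fin n) (Fin n) F)

/-- The data that are specific to each of `ℝ`, `ℂ`, `ℍ`: the determinant and the maximal compact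
subgroup. The only instances are the three below. -/
class Scalars (F : Type) [NormedDivisionRing F] [NormedAlgebra ℝ F] [StarRing F] where
  /-- The determinant of a square matrix (for `ℍ`, in the sense of Dieudonné). -/
  det : {n : Type} → [Fintype n] → [DecidableEq n] → Matrix n n F → ℂ
  /-- The maximal compact subgroup `K`, as a group of pairs `(u, v)` standing for the block
  diagonal matrices with blocks `u ∈ U(q, F)` and `v ∈ U(p, F)`. -/
  K : (p q : ℕ) → Subgroup (U F q × U F p)
  isClosed_K : ∀ p q, IsClosed (K p q : Set (U F q × U F p))
  star_mul_self_eq : ∀ x : F, star x * x = algebraMap ℝ F (‖x‖ ^ 2)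

/-- `K = SO(q) × SO(p)`. -/
instance : Scalars ℝ where
  det A := ((Matrix.det A : ℝ) : ℂ)
  K p q :=
    { carrier := {k | (k.1 : Matrix (Fin q) (Fin q) ℝ).det = 1 ∧
        (k.2 : Matrix (Fin p) (Fin p) ℝ).det = 1}
      mul_mem' := by
        rintro a b ⟨h1, h2⟩ ⟨h3, h4⟩
        simp [h1, h2, h3, h4]
      one_mem' := by simp
      inv_mem' := by
        rintro a ⟨h1, h2⟩
        simp [← Unitary.star_eq_inv, Matrix.star_eq_conjTranspose, h1, h2] }
  isClosed_K p q := by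
    refine IsClosed.inter (isClosed_eq ?_ continuous_const) (isClosed_eq ?_ continuous_const)
    · exact (continuous_subtype_val.comp continuous_fst).matrix_det
    · exact (continuous_subtype_val.comp continuous_snd).matrix_det
  star_mul_self_eq x := by simp [sq]

/-- `K = S(U(q) × U(p))`. -/
instance : Scalars ℂ where
  det A := Matrix.det A
  K p q :=
    { carrier := {k | (k.1 : Matrix (Fin q) (Fin q) ℂ).det *
        (k.2 : Matrix (Fin p) (Fin p) ℂ).det = 1}
      mul_mem' := by
        intro a b h1 h2
        simp only [Set.mem_ofPred_eq] at h1 h2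
        simp only [Set.mem_ofPred_eq, Prod.fst_mul, Prod.snd_mul, Submonoid.coe_mul,
          Matrix.det_mul]
        rw [mul_mul_mul_comm, h1, h2, one_mul]
      one_mem' := by simp
      inv_mem' := by
        intro a h1
        simp only [Set.mem_ofPred_eq] at h1
        simp only [Set.mem_ofPred_eq, ← Unitary.star_eq_inv, Prod.fst_inv, Prod.snd_inv,
          Unitary.coe_star, Matrix.star_eq_conjTranspose, Matrix.det_conjTranspose]
        rw [← star_mul', h1, star_one] }
  isClosed_K p q := by
    refine isClosed_eq (Continuous.mul ?_ ?_) continuous_const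
    · exact (continuous_subtype_val.comp continuous_fst).matrix_det
    · exact (continuous_subtype_val.comp continuous_snd).matrix_det
  star_mul_self_eq x := by
    have := Complex.conj_mul' x
    simpa using this

/-- A quaternionic `n × n` matrix `Z + W j`, with complex matrices `Z` and `W`, regarded as the
complex `2n × 2n` matrix with blocks `Z`, `W`, `-conj W`, `conj Z`. -/
def toComplexMatrix {n : Type} (A : Matrix n n ℍ[ℝ]) : Matrix (n ⊕ n) (n ⊕ n) ℂ :=
  Matrix.fromBlocks
    (Matrix.of fun i j => ⟨(A i j).re, (A i j).imI⟩)
    (Matrix.of fun i j => ⟨(A i j).imJ, (A i j).imK⟩)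
    (Matrix.of fun i j => ⟨-(A i j).imJ, (A i j).imK⟩)
    (Matrix.of fun i j => ⟨(A i j).re, -(A i j).imI⟩)

/-- `K = Sp(q) × Sp(p)`; the Dieudonné determinant is `(det_ℂ A)^{1/2}`. -/
instance : Scalars ℍ[ℝ] where
  det A := (toComplexMatrix A).det ^ (1 / 2 : ℂ)
  K _ _ := ⊤
  isClosed_K _ _ := isClosed_univ
  star_mul_self_eq x := by
    rw [Quaternion.star_mul_self, Quaternion.normSq_eq_norm_mul_self, sq]
    rfl

/-! ### Definitions that are uniform in the scalar field -/

section Defs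

variable (F : Type) [NormedDivisionRing F] [NormedAlgebra ℝ F] [StarRing F] [CStarRing F]
  [FiniteDimensional ℝ F] [MeasureSpace F] [BorelSpace F] [Scalars F]

instance instCompactSpaceU (n : ℕ) : CompactSpace (U F n) := by
  have : ProperSpace F := FiniteDimensional.proper_real F
  refine isCompact_iff_compactSpace.mp ?_
  have hc : IsCompact (Set.pi Set.univ fun _ : Fin n => Set.pi Set.univ fun _ : Fin n =>
      Metric.closedBall (0 : F) 1) :=
    isCompact_univ_pi fun _ => isCompact_univ_pi fun _ => isCompact_closedBall _ _
  refine IsCompact.of_isClosed_subset (X := Matrix (Fin n) (Fin n) F) hc isClosed_unitary ?_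
  intro (A : Matrix (Fin n) (Fin n) F) hA i _ j _
  rw [mem_closedBall_zero_iff]
  have h1 : (star A * A) j j = 1 := by rw [(Unitary.mem_iff.mp hA).1]; simp
  have h2 : algebraMap ℝ F (∑ k, ‖A k j‖ ^ 2) = algebraMap ℝ F 1 := by
    rw [map_one, ← h1, map_sum, Matrix.mul_apply]
    exact Finset.sum_congr rfl fun k _ => (Scalars.star_mul_self_eq (A k j)).symm
  have h3 := (algebraMap ℝ F).injective h2
  have h4 : ‖A i j‖ ^ 2 ≤ ∑ k, ‖A k j‖ ^ 2 :=
    Finset.single_le_sum (f := fun k => ‖A k j‖ ^ 2) (fun k _ => sq_nonneg _) (Finset.mem_univ i)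
  rw [h3] at h4
  nlinarith [norm_nonneg (A i j)]

/-- `d = dim_ℝ F`. -/
def d : ℕ := Module.finrank ℝ F

/-- The identity component `U_0(q, F)` of `U(q, F)`. -/
abbrev U₀ (q : ℕ) : Subgroup (U F q) := Subgroup.connectedComponentOfOne (U F q)

instance instCompactSpaceU₀ (q : ℕ) : CompactSpace (U₀ F q) :=
  isCompact_iff_compactSpace.mp (isClosed_connectedComponent.isCompact)

instance instCompactSpaceK (p q : ℕ) : CompactSpace (Scalars.K (F := F) p q) :=
  isCompact_iff_compactSpace.mp ((Scalars.isClosed_K p q).isCompact)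

instance instBorelSpaceK (p q : ℕ) : BorelSpace (Scalars.K (F := F) p q) := by
  have : ProperSpace F := FiniteDimensional.proper_real F
  have (n : ℕ) : SecondCountableTopology (U F n) :=
    TopologicalSpace.Subtype.secondCountableTopology
      (unitary (Matrix (Fin n) (Fin n) F) : Set (Matrix (Fin n) (Fin n) F))
  have : BorelSpace (U F q × U F p) := inferInstance
  infer_instance

/-- The normalized Haar measure of `U_0(q, F)`. -/
def haarU₀ (q : ℕ) : Measure (U₀ F q) := Measure.haarMeasure ⊤

/-- The normalized Haar measure of `K`. -/
def haarK (p q : ℕ) : Measure (Scalars.K (F := F) p q) := Measure.haarMeasure ⊤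

/-! ### Iwasawa decomposition and spherical functions -/

/-- Matrices of size `q + p` over `F`, in block form. -/
abbrev BigMat (p q : ℕ) := Matrix (Fin q ⊕ Fin p) (Fin q ⊕ Fin p) F

/-- The block diagonal matrix of an element `(u, v)` of `K`. -/
def blockK {p q : ℕ} (k : Scalars.K (F := F) p q) : BigMat F p q :=
  Matrix.fromBlocks (k.1.1 : Matrix (Fin q) (Fin q) F) 0 0 (k.1.2 : Matrix (Fin p) (Fin p) F)

/-- The `q × p` matrix whose first `q` columns are `diag(t)` and whose other columns vanish. -/
def rectDiag (p : ℕ) {q : ℕ} (t : Fin q → ℝ) : Matrix (Fin q) (Fin p) F :=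
  Matrix.of fun i j => if (i : ℕ) = (j : ℕ) then algebraMap ℝ F (t i) else 0

/-- The matrices `H_t`, which make up the maximal abelian subspace `𝔞` of `𝔭`. -/
def Hmat (p : ℕ) {q : ℕ} (t : Fin q → ℝ) : BigMat F p q :=
  Matrix.fromBlocks 0 (rectDiag F p t) (rectDiag F p t)ᴴ 0

/-- `a_t = exp(H_t)`. -/
def aMat (p : ℕ) {q : ℕ} (t : Fin q → ℝ) : BigMat F p q := NormedSpace.exp (Hmat F p t)

/-- The Lie algebra `𝔤` of `G`: block matrices `(A, B; B^*, D)` with `A^* = -A`, `D^* = -D` and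
reduced trace zero. The last condition says that the trace is a sum of commutators of scalars: it is
`tr A + tr D = 0` over `ℝ` and `ℂ`, and holds automatically over `ℍ`. -/
def lieG (p q : ℕ) : Submodule ℝ (BigMat F p q) where
  carrier := {X | X.toBlocks₁₁ᴴ = -X.toBlocks₁₁ ∧ X.toBlocks₂₂ᴴ = -X.toBlocks₂₂ ∧
    X.toBlocks₂₁ = X.toBlocks₁₂ᴴ ∧
    X.trace ∈ Submodule.span ℝ {z : F | ∃ x y : F, z = x * y - y * x}}
  zero_mem' := by
    refine ⟨?_, ?_, ?_, ?_⟩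
    · ext i j; simp [Matrix.toBlocks₁₁]
    · ext i j; simp [Matrix.toBlocks₂₂]
    · ext i j; simp [Matrix.toBlocks₁₂, Matrix.toBlocks₂₁]
    · simp
  add_mem' := by
    rintro X Y ⟨h1, h2, h3, h4⟩ ⟨g1, g2, g3, g4⟩
    refine ⟨?_, ?_, ?_, ?_⟩
    · have : (X + Y).toBlocks₁₁ = X.toBlocks₁₁ + Y.toBlocks₁₁ := rfl
      rw [this, Matrix.conjTranspose_add, h1, g1, neg_add]
    · have : (X + Y).toBlocks₂₂ = X.toBlocks₂₂ + Y.toBlocks₂₂ := rfl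
      rw [this, Matrix.conjTranspose_add, h2, g2, neg_add]
    · have e1 : (X + Y).toBlocks₂₁ = X.toBlocks₂₁ + Y.toBlocks₂₁ := rfl
      have e2 : (X + Y).toBlocks₁₂ = X.toBlocks₁₂ + Y.toBlocks₁₂ := rfl
      rw [e1, e2, Matrix.conjTranspose_add, h3, g3]
    · rw [Matrix.trace_add]; exact Submodule.add_mem _ h4 g4
  smul_mem' := by
    rintro c X ⟨h1, h2, h3, h4⟩
    have hs : ∀ x : F, star (c • x) = c • star x := by
      have hc : star (algebraMap ℝ F c) = algebraMap ℝ F c := by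
        by_cases h0 : c = 0
        · simp [h0]
        · have hne : algebraMap ℝ F c ≠ 0 := by simpa using h0
          have := Scalars.star_mul_self_eq (algebraMap ℝ F c)
          rw [norm_algebraMap', Real.norm_eq_abs, sq_abs, sq, map_mul] at this
          exact mul_right_cancel₀ hne this
      intro x
      rw [Algebra.smul_def, star_mul, hc, Algebra.smul_def, Algebra.commutes]
    have key : ∀ (m n : Type) (M : Matrix m n F), (c • M)ᴴ = c • Mᴴ := by
      intro m n M
      ext i j
      exact hs _
    refine ⟨?_, ?_, ?_, ?_⟩
    · have : (c • X).toBlocks₁₁ = c • X.toBlocks₁₁ := rfl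
      rw [this, key, h1, smul_neg]
    · have : (c • X).toBlocks₂₂ = c • X.toBlocks₂₂ := rfl
      rw [this, key, h2, smul_neg]
    · have e1 : (c • X).toBlocks₂₁ = c • X.toBlocks₂₁ := rfl
      have e2 : (c • X).toBlocks₁₂ = c • X.toBlocks₁₂ := rfl
      rw [e1, e2, key, h3]
    · rw [Matrix.trace_smul]; exact Submodule.smul_mem _ _ h4

/-- The space `𝔤_α` of all `X ∈ 𝔤` with `[H_t, X] = α(H_t) X` for all `t`, where
`α(H_t) = ∑ i, α i * t i`. -/
def rootSpace (p q : ℕ) (α : Fin q → ℝ) : Submodule ℝ (BigMat F p q) where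
  carrier := {X | X ∈ lieG F p q ∧ ∀ t : Fin q → ℝ,
    Hmat F p t * X - X * Hmat F p t = (∑ i, α i * t i) • X}
  zero_mem' := ⟨Submodule.zero_mem _, fun t => by simp⟩
  add_mem' := by
    rintro X Y ⟨h1, h2⟩ ⟨g1, g2⟩
    refine ⟨Submodule.add_mem _ h1 g1, fun t => ?_⟩
    rw [smul_add, ← h2, ← g2, mul_add, add_mul]
    abel
  smul_mem' := by
    rintro c X ⟨h1, h2⟩
    refine ⟨Submodule.smul_mem _ _ h1, fun t => ?_⟩
    rw [smul_comm, ← h2, smul_sub, mul_smul_comm, smul_mul_assoc]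

/-- The positive roots `f_i`, `2 f_i` (all `i`) and `f_i - f_j`, `f_i + f_j` (`i < j`). -/
def positiveRoots (q : ℕ) : Set (Fin q → ℝ) :=
  {α | (∃ i, α = Pi.single i 1) ∨ (∃ i, α = Pi.single i 2) ∨
    ∃ i j, i < j ∧ (α = Pi.single i 1 - Pi.single j 1 ∨ α = Pi.single i 1 + Pi.single j 1)}

/-- `N = exp(𝔫)`, where `𝔫` is the sum of the root spaces of the positive roots. -/
def groupN (p q : ℕ) : Set (BigMat F p q) :=
  NormedSpace.exp '' ((⨆ α ∈ positiveRoots q, rootSpace F p q α : Submodule ℝ (BigMat F p q)) :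
    Set (BigMat F p q))

/-- `g ∈ K exp(H_s) N`. -/
def IsAbelianPart {p q : ℕ} (g : BigMat F p q) (s : Fin q → ℝ) : Prop :=
  ∃ k : Scalars.K (F := F) p q, ∃ n ∈ groupN F p q, g = blockK F k * aMat F p s * n

/-- The (unique) `s ∈ ℝ^q ≅ 𝔞` with `g ∈ K exp(H_s) N`, for `g ∈ G = K A N`. -/
def abelianPart {p q : ℕ} (g : BigMat F p q) : Fin q → ℝ :=
  Classical.epsilon (IsAbelianPart F g)

/-- `ρ^{BC}_i = (d/2)(p + q + 2 - 2i) - 1` for `i = 1, …, q`; the index `i` below starts at `0`. -/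
def rhoBC (p q : ℕ) (i : Fin q) : ℝ :=
  (d F : ℝ) / 2 * (p + q + 2 - 2 * ((i : ℕ) + 1)) - 1

/-- The linear functional `iλ - ρ^{BC}` as a vector of `ℂ^q`. -/
def spectral (p : ℕ) {q : ℕ} (lam : Fin q → ℂ) (i : Fin q) : ℂ :=
  Complex.I * lam i - (rhoBC F p q i : ℂ)

/-- The integrand `k ↦ exp((iλ - ρ)(H(g k)))` of the Harish-Chandra integral. -/
def harishChandraIntegrand {p q : ℕ} (lam : Fin q → ℂ) (g : BigMat F p q)
    (k : Scalars.K (F := F) p q) : ℂ :=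
  Complex.exp (∑ i, spectral F p lam i * (abelianPart F (g * blockK F k) i : ℂ))

/-- The spherical function `φ_λ^p(g) = ∫_K exp((iλ - ρ)(H(g k))) dk` of `G / K`, `g ∈ G`. -/
def sphericalFunction {p q : ℕ} (lam : Fin q → ℂ) (g : BigMat F p q) : ℂ :=
  ∫ k, harishChandraIntegrand F lam g k ∂(haarK F p q)

/-! ### Power functions, the matrix ball and the measures `m_p` -/

variable {F}

/-- The principal minor of `A` on the rows and columns `0, …, r` (that is, `Δ_{r+1}(A)`). -/
def minor {q : ℕ} (r : Fin q) (A : Matrix (Fin q) (Fin q) F) : ℂ :=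
  Scalars.det (A.submatrix (Subtype.val : {i : Fin q // i ≤ r} → Fin q)
    (Subtype.val : {i : Fin q // i ≤ r} → Fin q))

/-- The power function
`Δ_λ = Δ_1^{λ_1 - λ_2} ⋯ Δ_{q-1}^{λ_{q-1} - λ_q} Δ_q^{λ_q}`, used for positive definite matrices. -/
def powerFunction {q : ℕ} (lam : Fin q → ℂ) (x : Matrix (Fin q) (Fin q) F) : ℂ :=
  ∏ r : Fin q, minor r x ^ (lam r - if h : (r : ℕ) + 1 < q then lam ⟨(r : ℕ) + 1, h⟩ else 0)

/-- `A` is hermitian and `x^* A x` is a positive real number for each nonzero `x ∈ F^q`. -/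
def IsPosDef {q : ℕ} (A : Matrix (Fin q) (Fin q) F) : Prop :=
  Aᴴ = A ∧ ∀ x : Fin q → F, x ≠ 0 → ∃ r : ℝ, 0 < r ∧ star x ⬝ᵥ (A *ᵥ x) = algebraMap ℝ F r

variable (F)

/-- The ball `B_q` of all `w ∈ M_q(F)` with `w^* w < I`. -/
def ball (q : ℕ) : Set (Matrix (Fin q) (Fin q) F) := {w | IsPosDef (1 - wᴴ * w)}

/-- Lebesgue measure on `M_q(F)`. -/
def lebesgue (q : ℕ) : Measure (Matrix (Fin q) (Fin q) F) :=
  Measure.pi fun _ : Fin q => Measure.pi fun _ : Fin q => (volume : Measure F)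

/-- `γ = d (q - 1/2) + 1`. -/
def gam (q : ℕ) : ℝ := (d F : ℝ) * (q - 1 / 2) + 1

/-- The density `Δ(I - w^* w)^{p d / 2 - γ}`. -/
def ballDensity (p q : ℕ) (w : Matrix (Fin q) (Fin q) F) : ENNReal :=
  ENNReal.ofReal ((Scalars.det (1 - wᴴ * w)).re ^ ((p : ℝ) * d F / 2 - gam F q))

/-- `κ_{pd/2}`, the integral of the density over the ball. -/
def kappa (p q : ℕ) : ENNReal := ∫⁻ w in ball F q, ballDensity F p q w ∂(lebesgue F q)

/-- The measure `m_p` on the ball, `dm_p(w) = κ⁻¹ Δ(I - w^* w)^{p d / 2 - γ} dw`. -/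
def ballMeasure (p q : ℕ) : Measure (Matrix (Fin q) (Fin q) F) :=
  (kappa F p q)⁻¹ • ((lebesgue F q).restrict (ball F q)).withDensity (ballDensity F p q)

variable {F}

/-- `cosh t + sinh t w` with the diagonal matrices `cosh t`, `sinh t`. -/
def coshSinh {q : ℕ} (t : Fin q → ℝ) (w : Matrix (Fin q) (Fin q) F) :
    Matrix (Fin q) (Fin q) F :=
  Matrix.diagonal (fun i => algebraMap ℝ F (Real.cosh (t i))) +
    Matrix.diagonal (fun i => algebraMap ℝ F (Real.sinh (t i))) * w

/-- `g_t(u, w) = u⁻¹ (cosh t + sinh t w)^* (cosh t + sinh t w) u`. -/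
def gMat {q : ℕ} (t : Fin q → ℝ) (u : U₀ F q) (w : Matrix (Fin q) (Fin q) F) :
    Matrix (Fin q) (Fin q) F :=
  ((u.1⁻¹ : U F q) : Matrix (Fin q) (Fin q) F) * (coshSinh t w)ᴴ * coshSinh t w *
    ((u.1 : U F q) : Matrix (Fin q) (Fin q) F)

/-- `g̃_t(u, w) = u⁻¹ (cosh t + sinh t w) (cosh t + sinh t w)^* u`. -/
def gMatTilde {q : ℕ} (t : Fin q → ℝ) (u : U₀ F q) (w : Matrix (Fin q) (Fin q) F) :
    Matrix (Fin q) (Fin q) F :=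
  ((u.1⁻¹ : U F q) : Matrix (Fin q) (Fin q) F) * coshSinh t w * (coshSinh t w)ᴴ *
    ((u.1 : U F q) : Matrix (Fin q) (Fin q) F)

variable (F)

/-- The integral representations of `φ_λ^p(a_t)` over `U_0(q, F) × B_q`, with the arguments `g_t`
and `g̃_t`. The first four parts say that the objects in the two equations are well defined:
the abelian part `H(a_t k)` exists and is unique, and all integrals converge absolutely. -/
def IntegralRepresentation (p : ℕ) {q : ℕ} (lam : Fin q → ℂ) (t : Fin q → ℝ) : Prop :=
  (∀ k : Scalars.K (F := F) p q, ∃! s, IsAbelianPart F (aMat F p t * blockK F k) s) ∧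
  Integrable (harishChandraIntegrand F lam (aMat F p t)) (haarK F p q) ∧
  Integrable (fun x : U₀ F q × Matrix (Fin q) (Fin q) F =>
    powerFunction (fun i => spectral F p lam i / 2) (gMat t x.1 x.2))
    ((haarU₀ F q).prod (ballMeasure F p q)) ∧
  Integrable (fun x : U₀ F q × Matrix (Fin q) (Fin q) F =>
    powerFunction (fun i => spectral F p lam i / 2) (gMatTilde t x.1 x.2))
    ((haarU₀ F q).prod (ballMeasure F p q)) ∧
  sphericalFunction F lam (aMat F p t) =
    ∫ x : U₀ F q × Matrix (Fin q) (Fin q) F,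
      powerFunction (fun i => spectral F p lam i / 2) (gMat t x.1 x.2)
        ∂((haarU₀ F q).prod (ballMeasure F p q)) ∧
  sphericalFunction F lam (aMat F p t) =
    ∫ x : U₀ F q × Matrix (Fin q) (Fin q) F,
      powerFunction (fun i => spectral F p lam i / 2) (gMatTilde t x.1 x.2)
        ∂((haarU₀ F q).prod (ballMeasure F p q))

end Defs

end Grassmann

end

noncomputable section

namespace Grassmann

set_option linter.unusedSectionVars false

/-! ### Scalars and Gram matrices -/

section Algebra

variable {F : Type} [NormedDivisionRing F] [NormedAlgebra ℝ F] [StarRing F] [CStarRing F]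
  [FiniteDimensional ℝ F] [MeasureSpace F] [BorelSpace F] [Scalars F]

/-! The integrand. Let E₊ (`ePlus`) have as columns the weight vectors of 𝔞 in F^(q+p) for the
weights f_1, …, f_q. On E₊ the group N acts by right multiplication with unipotent upper triangular
matrices, a_s acts by diag(e^{s_i}), and K acts through its blocks. If a_t k = k' a_s n with k = (u,
v), then the upper q rows X of a_t k E₊ are a unitary matrix times an upper triangular one with
diagonal moduli e^{s_i}. On the other hand X = cosh t · u + sinh t · v₁₁ (`topRows`), where v₁₁ is
the q × q corner of v. The leading minors of X^*X are exp(2(s_1 + ⋯ + s_r)), so s is unique and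
Δ_{(iλ-ρ)/2}(X^*X) = e^{(iλ-ρ)(s)} (`powerFunction_gram`, `harishChandraIntegrand_eq`).

Averaging. This function of (u, v) is continuous on U(q) × U(p) and invariant under right
multiplication by pairs (D, w), where D is diagonal unitary and w restricts to D on the first q
coordinates. Since q < p, both K and U_0(q) × U(p) meet every coset of these pairs, so they give the
same average as U(q) × U(p) (`integral_comp_eq_of_exists_mul`). For fixed u, the translation v ↦ v w
with w extending u turns X into (cosh t + sinh t · v₁₁) u, whose Gram matrix is g_t(u, v₁₁). For the
second formula, Y Y^* and Y^* Y are unitarily conjugate (`exists_unitary_gram_eq`, from a polar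
decomposition), and the average over u absorbs the conjugation.

The corner. It remains to see that v₁₁ has law m_p when v is Haar distributed (`map_corner_haarU`).
The first row r of the block has density proportional to (1 - |r|²)^{power}, by comparison with
Lebesgue measure on row vectors (`exists_row_law`). Given r, the other rows are w C, where C^*C = I
- r^*r and w is a corner of a Haar matrix one size smaller. Both Δ(I - w^*w) and the Jacobian of w ↦
w C scale by powers of 1 - |r|², and all these powers cancel against the density of r. Induction on
the number of rows gives `corner_law`.

Existence of H. Since N is defined literally as exp 𝔫, the decomposition needs an argument. The QR
factorization of X gives the K- and A-parts on E₊. The remaining factor preserves the form J and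
acts unipotently on E₊; after removing a unitary part on the zero weight space, which commutes with
A, it raises the height of weights. Such a matrix is the exponential of an element of 𝔫 by
successive approximation in a nilpotent filtration (`exists_exp_eq`, `exists_unipotent`,
`exists_iwasawa`). That the unitary factor lies in K is a determinant computation over ℝ and ℂ, and
is void over ℍ. -/

theorem star_algebraMap_real (r : ℝ) : star (algebraMap ℝ F r) = algebraMap ℝ F r := by
  by_cases h0 : r = 0
  · simp [h0]
  · have hne : algebraMap ℝ F r ≠ 0 := by simpa using h0
    have := Scalars.star_mul_self_eq (algebraMap ℝ F r)
    rw [norm_algebraMap', Real.norm_eq_abs, sq_abs, sq, map_mul] at this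
    exact mul_right_cancel₀ hne this

instance (priority := 50) instStarModuleReal : StarModule ℝ F where
  star_smul r x := by
    rw [Algebra.smul_def, star_mul, star_algebraMap_real, Algebra.smul_def, star_trivial r,
      Algebra.commutes]

theorem mul_star_self_eq (x : F) : x * star x = algebraMap ℝ F (‖x‖ ^ 2) := by
  have := Scalars.star_mul_self_eq (star x)
  rwa [star_star, norm_star] at this

/-- The real part, characterized by `star x + x = 2 re x`. -/
def re (x : F) : ℝ := (‖1 + x‖ ^ 2 - ‖x‖ ^ 2 - 1) / 2

/-- Polarization of `star y * y = ‖y‖ ^ 2` at y = 1 + x: this single law makes traces of scalars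
real, uniformly in F. -/
theorem star_add_self_eq (x : F) : star x + x = algebraMap ℝ F (2 * re x) := by
  have h := Scalars.star_mul_self_eq (1 + x)
  have h1 := Scalars.star_mul_self_eq x
  have e : star (1 + x) * (1 + x) = 1 + (star x + x) + star x * x := by
    rw [star_add, star_one]; noncomm_ring
  rw [e, h1] at h
  have : star x + x = algebraMap ℝ F (‖1 + x‖ ^ 2) - 1 - algebraMap ℝ F (‖x‖ ^ 2) := by
    rw [← h]; abel
  have e2 : 2 * re x = ‖1 + x‖ ^ 2 - 1 - ‖x‖ ^ 2 := by
    unfold re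
    ring
  rw [this, e2, map_sub, map_sub, map_one]

theorem re_eq_iff (x : F) (r : ℝ) : re x = r ↔ star x + x = algebraMap ℝ F (2 * r) := by
  rw [star_add_self_eq]
  constructor
  · rintro rfl; rfl
  · intro h
    have := (algebraMap ℝ F).injective h
    linarith

theorem re_add (x y : F) : re (x + y) = re x + re y := by
  rw [re_eq_iff, star_add, mul_add, map_add, ← star_add_self_eq, ← star_add_self_eq]
  abel

theorem re_smul (r : ℝ) (x : F) : re (r • x) = r * re x := by
  rw [re_eq_iff, star_smul, star_trivial, ← smul_add, star_add_self_eq, Algebra.smul_def,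
    ← map_mul]
  congr 1
  ring

theorem re_star (x : F) : re (star x) = re x := by
  rw [re_eq_iff, star_star, add_comm, star_add_self_eq]

theorem re_algebraMap (r : ℝ) : re (algebraMap ℝ F r) = r := by
  rw [re_eq_iff, star_algebraMap_real, ← map_add, two_mul]

theorem norm_add_sq_eq (x y : F) : ‖x + y‖ ^ 2 = ‖x‖ ^ 2 + 2 * re (star x * y) + ‖y‖ ^ 2 := by
  apply (algebraMap ℝ F).injective
  rw [← Scalars.star_mul_self_eq, map_add, map_add, ← Scalars.star_mul_self_eq,
    ← Scalars.star_mul_self_eq, ← star_add_self_eq, star_mul, star_star, star_add]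
  noncomm_ring

/-- Substitute for commutativity over ℍ. Expand the equal norms of `star x + y` and `x + star y` and
compare the cross terms. -/
theorem re_mul_comm (x y : F) : re (x * y) = re (y * x) := by
  have h1 := norm_add_sq_eq (star x) y
  have h2 := norm_add_sq_eq x (star y)
  rw [star_star, norm_star] at h1
  rw [norm_star, ← re_star, star_mul, star_star, star_star] at h2
  have h3 : ‖star x + y‖ = ‖x + star y‖ := by rw [← norm_star, star_add, star_star]
  rw [h3] at h1
  linarith

theorem re_sum {ι : Type*} (s : Finset ι) (f : ι → F) : re (∑ i ∈ s, f i) = ∑ i ∈ s, re (f i) := by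
  classical
  induction s using Finset.induction_on with
  | empty => simpa using re_algebraMap (F := F) 0
  | insert a s ha ih => rw [Finset.sum_insert ha, Finset.sum_insert ha, re_add, ih]

theorem continuous_re : Continuous (re : F → ℝ) := by
  unfold re
  fun_prop

theorem star_dotProduct_self {n : Type} [Fintype n] (x : n → F) :
    star x ⬝ᵥ x = algebraMap ℝ F (∑ i, ‖x i‖ ^ 2) := by
  rw [map_sum]
  exact Finset.sum_congr rfl fun i _ => Scalars.star_mul_self_eq (x i)

theorem gram_apply_self {m n : Type} [Fintype m] (A : Matrix m n F) (j : n) :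
    (Aᴴ * A) j j = algebraMap ℝ F (∑ i, ‖A i j‖ ^ 2) := by
  rw [map_sum]
  exact Finset.sum_congr rfl fun i _ => Scalars.star_mul_self_eq (A i j)

theorem star_dotProduct_gram {m n : Type} [Fintype m] [Fintype n] (A : Matrix m n F) (x : n → F) :
    star x ⬝ᵥ ((Aᴴ * A) *ᵥ x) = algebraMap ℝ F (∑ i, ‖(A *ᵥ x) i‖ ^ 2) := by
  rw [← star_dotProduct_self, ← mulVec_mulVec, dotProduct_mulVec, star_mulVec]

theorem sum_norm_sq_eq_zero {n : Type} [Fintype n] {x : n → F} :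
    ∑ i, ‖x i‖ ^ 2 = 0 ↔ x = 0 := by
  rw [Finset.sum_eq_zero_iff_of_nonneg fun i _ => sq_nonneg _]
  simp [funext_iff]

theorem sum_norm_sq_pos {n : Type} [Fintype n] {x : n → F} (hx : x ≠ 0) :
    0 < ∑ i, ‖x i‖ ^ 2 :=
  lt_of_le_of_ne (Finset.sum_nonneg fun _ _ => sq_nonneg _)
    fun h => hx (sum_norm_sq_eq_zero.mp h.symm)

theorem sum_norm_sq_mulVec_of_gram_eq {l m n : Type} [Fintype l] [Fintype m] [Fintype n]
    {A : Matrix l n F} {B : Matrix m n F} (h : Aᴴ * A = Bᴴ * B) (x : n → F) :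
    ∑ i, ‖(A *ᵥ x) i‖ ^ 2 = ∑ i, ‖(B *ᵥ x) i‖ ^ 2 := by
  apply (algebraMap ℝ F).injective
  rw [← star_dotProduct_gram, ← star_dotProduct_gram, h]

theorem unitary_conjTranspose_mul {n : ℕ} (g : U F n) :
    (g : Matrix (Fin n) (Fin n) F)ᴴ * (g : Matrix (Fin n) (Fin n) F) = 1 :=
  (Unitary.mem_iff.mp g.2).1

theorem unitary_mul_conjTranspose {n : ℕ} (g : U F n) :
    (g : Matrix (Fin n) (Fin n) F) * (g : Matrix (Fin n) (Fin n) F)ᴴ = 1 :=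
  (Unitary.mem_iff.mp g.2).2

theorem coe_unitary_inv {n : ℕ} (g : U F n) :
    ((g⁻¹ : U F n) : Matrix (Fin n) (Fin n) F) = (g : Matrix (Fin n) (Fin n) F)ᴴ := rfl

/-- A square matrix whose columns are orthonormal, as an element of the unitary group. -/
def unitaryOf {n : ℕ} (A : Matrix (Fin n) (Fin n) F) (h : Aᴴ * A = 1) : U F n :=
  ⟨A, Unitary.mem_iff.mpr ⟨h, mul_eq_one_comm.mp h⟩⟩

@[simp] theorem coe_unitaryOf {n : ℕ} (A : Matrix (Fin n) (Fin n) F) (h : Aᴴ * A = 1) :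
    (unitaryOf A h : Matrix (Fin n) (Fin n) F) = A := rfl

/-! ### Triangular form under the identity component of the unitary group -/

/-- The rotation by `θ` in the plane of the orthonormal columns `A`, `B`. -/
def planeRotation {n : ℕ} (A B : Matrix (Fin n) (Fin 1) F) (θ : ℝ) : Matrix (Fin n) (Fin n) F :=
  1 + (Real.cos θ - 1) • (A * Aᴴ + B * Bᴴ) + Real.sin θ • (B * Aᴴ - A * Bᴴ)

/-- With P the projection onto the plane and K the skew generator, P² = P, PK = KP = K and K² = -P,
so the matrix behaves like e^{θK} and unitarity reduces to cos² + sin² = 1. -/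
theorem planeRotation_gram {n : ℕ} {A B : Matrix (Fin n) (Fin 1) F} (hA : Aᴴ * A = 1)
    (hB : Bᴴ * B = 1) (hAB : Aᴴ * B = 0) (θ : ℝ) :
    (planeRotation A B θ)ᴴ * planeRotation A B θ = 1 := by
  have hBA : Bᴴ * A = 0 := by
    have := congrArg conjTranspose hAB
    simpa using this
  have e1 : ∀ C : Matrix (Fin 1) (Fin n) F, Aᴴ * (A * C) = C := fun C => by
    rw [← Matrix.mul_assoc, hA, Matrix.one_mul]
  have e2 : ∀ C : Matrix (Fin 1) (Fin n) F, Bᴴ * (B * C) = C := fun C => by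
    rw [← Matrix.mul_assoc, hB, Matrix.one_mul]
  have e3 : ∀ C : Matrix (Fin 1) (Fin n) F, Aᴴ * (B * C) = 0 := fun C => by
    rw [← Matrix.mul_assoc, hAB, Matrix.zero_mul]
  have e4 : ∀ C : Matrix (Fin 1) (Fin n) F, Bᴴ * (A * C) = 0 := fun C => by
    rw [← Matrix.mul_assoc, hBA, Matrix.zero_mul]
  have hcs := Real.cos_sq_add_sin_sq θ
  set P := A * Aᴴ + B * Bᴴ with hP
  set K := B * Aᴴ - A * Bᴴ with hK
  have hPs : Pᴴ = P := by simp [hP]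
  have hKs : Kᴴ = -K := by simp [hK]
  have hPP : P * P = P := by
    simp [hP, Matrix.mul_add, Matrix.add_mul, Matrix.mul_assoc, e1, e2, e3, e4]
  have hPK : P * K = K := by
    simp only [hP, hK, Matrix.mul_sub, Matrix.add_mul, Matrix.mul_assoc, e1, e2, e3, e4,
      Matrix.mul_zero]
    abel
  have hKP : K * P = K := by
    simp only [hP, hK, Matrix.mul_add, Matrix.sub_mul, Matrix.mul_assoc, e1, e2, e3, e4,
      Matrix.mul_zero]
    abel
  have hKK : K * K = -P := by
    simp only [hP, hK, Matrix.mul_sub, Matrix.sub_mul, Matrix.mul_assoc, e1, e2, e3, e4,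
      Matrix.mul_zero]
    abel
  have h1 : (planeRotation A B θ)ᴴ = 1 + (Real.cos θ - 1) • P - Real.sin θ • K := by
    rw [planeRotation, conjTranspose_add, conjTranspose_add, conjTranspose_smul,
      conjTranspose_smul, ← hP, ← hK, hPs, hKs]
    simp [sub_eq_add_neg]
  rw [h1, planeRotation, ← hP, ← hK]
  simp only [add_mul, sub_mul, mul_add, smul_mul_assoc, mul_smul_comm, hPP, hPK, hKP, hKK,
    one_mul, mul_one]
  have h0 : (Real.cos θ ^ 2 + Real.sin θ ^ 2 - 1) • P = 0 := by rw [hcs]; simp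
  calc _ = 1 + (Real.cos θ ^ 2 + Real.sin θ ^ 2 - 1) • P := by module
    _ = 1 := by rw [h0, add_zero]

/-- The angle runs back to 0 along a path of unitary matrices ending at the identity. -/
theorem planeRotation_mem {n : ℕ} {A B : Matrix (Fin n) (Fin 1) F} (hA : Aᴴ * A = 1)
    (hB : Bᴴ * B = 1) (hAB : Aᴴ * B = 0) (θ : ℝ) :
    unitaryOf _ (planeRotation_gram hA hB hAB θ) ∈ U₀ F n := by
  let f : ℝ → U F n := fun s => unitaryOf _ (planeRotation_gram hA hB hAB s)
  have hf : Continuous f := by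
    refine Continuous.subtype_mk ?_ _
    unfold planeRotation
    fun_prop
  have hp : IsPreconnected (Set.range f) := isPreconnected_range hf
  have h0 : f 0 = 1 := by
    apply Subtype.ext
    simp [f, planeRotation]
  have := hp.subset_connectedComponent (x := 1) ⟨0, h0⟩
  exact this ⟨θ, rfl⟩

/-- The tail y of x below the index k is rotated into the direction of the k-th basis vector. A
rotation is used, not a reflection, in order to stay in the identity component; it fixes the first k
basis vectors, so entries eliminated earlier are not disturbed. -/
theorem exists_unitary_eliminate {n : ℕ} (x : Fin n → F) (k : Fin n) :
    ∃ g ∈ U₀ F n, (∀ i j, j < k → (g : Matrix (Fin n) (Fin n) F) i j = (1 : Matrix _ _ F) i j) ∧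
      ∀ i, k < i → ((g : Matrix (Fin n) (Fin n) F) *ᵥ x) i = 0 := by
  set y : Fin n → F := fun i => if k < i then x i else 0 with hy
  by_cases hy0 : y = 0
  · refine ⟨1, one_mem _, fun i j _ => rfl, fun i hi => ?_⟩
    have := congrFun hy0 i
    simp only [hy, hi, if_true] at this
    simpa using this
  set β := √(∑ i, ‖y i‖ ^ 2) with hβ
  have hpos := sum_norm_sq_pos hy0
  have hβpos : 0 < β := Real.sqrt_pos.mpr hpos
  have hβsq : β ^ 2 = ∑ i, ‖y i‖ ^ 2 := Real.sq_sqrt hpos.le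
  -- A common unit scalar α on the right is split off both coordinates: in the plane of A and B the
  -- vector is then (‖x k‖, β) times α, and a real rotation suffices even over ℍ.
  obtain ⟨α, hα, hαx⟩ : ∃ α : F, ‖α‖ = 1 ∧ x k = ‖x k‖ • α := by
    by_cases h : x k = 0
    · exact ⟨1, by simp, by simp [h]⟩
    · refine ⟨‖x k‖⁻¹ • x k, ?_, ?_⟩
      · rw [norm_smul, norm_inv, norm_norm, inv_mul_cancel₀ (norm_ne_zero_iff.mpr h)]
      · rw [smul_smul, mul_inv_cancel₀ (norm_ne_zero_iff.mpr h), one_smul]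
  have hα0 : α ≠ 0 := by
    intro h
    simp [h] at hα
  let A : Matrix (Fin n) (Fin 1) F := Matrix.of fun i _ => if i = k then 1 else 0
  let B : Matrix (Fin n) (Fin 1) F := Matrix.of fun i _ => β⁻¹ • (y i * α⁻¹)
  have hyB : ∀ i, y i = B i 0 * (β • α) := by
    intro i
    simp only [B, of_apply, smul_mul_smul_comm, inv_mul_cancel_right₀ hα0,
      inv_mul_cancel₀ hβpos.ne', one_smul]
  have hA : Aᴴ * A = 1 := by
    ext i j
    fin_cases i; fin_cases j
    simp [A, Matrix.mul_apply]
  have hB : Bᴴ * B = 1 := by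
    ext i j
    fin_cases i; fin_cases j
    simp only [Fin.zero_eta, one_apply_eq]
    rw [gram_apply_self]
    have : ∑ i, ‖B i 0‖ ^ 2 = 1 := by
      simp only [B, of_apply, norm_smul, norm_mul, norm_inv, hα, inv_one, mul_one, mul_pow,
        Real.norm_of_nonneg hβpos.le]
      rw [← Finset.mul_sum, ← hβsq]
      field_simp
    rw [this, map_one]
  have hBk : ∀ i, ¬ k < i → B i 0 = 0 := by
    intro i hi
    simp [B, hy, hi]
  have hAB : Aᴴ * B = 0 := by
    ext i j
    fin_cases i; fin_cases j
    have := hBk k (lt_irrefl _)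
    simp [A, Matrix.mul_apply, apply_ite (star : F → F), this]
  -- The angle that turns (‖x k‖, β) onto the first axis is the argument of ‖x k‖ - iβ.
  let z : ℂ := ⟨‖x k‖, -β⟩
  have hz : z ≠ 0 := by
    intro h
    have := congrArg Complex.im h
    simp [z] at this
    exact hβpos.ne' this
  set θ := z.arg
  have hc : Real.cos θ = ‖x k‖ / ‖z‖ := Complex.cos_arg hz
  have hs : Real.sin θ = -β / ‖z‖ := Complex.sin_arg z
  refine ⟨_, planeRotation_mem hA hB hAB θ, ?_, ?_⟩
  · intro i j hj
    have hAj : A j 0 = 0 := by simp [A, hj.ne]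
    have hBj : B j 0 = 0 := hBk j hj.not_gt
    simp [planeRotation, Matrix.mul_apply, hAj, hBj]
  · intro i hi
    have hAi : A i 0 = 0 := by simp [A, hi.ne']
    have hAx : (Aᴴ *ᵥ x) 0 = ‖x k‖ • α := by
      rw [← hαx]
      simp [A, mulVec, dotProduct, apply_ite (star : F → F)]
    have hBx : (Bᴴ *ᵥ x) 0 = β • α := by
      have : (Bᴴ *ᵥ x) 0 = (Bᴴ * B) 0 0 * (β • α) := by
        simp only [mulVec, dotProduct, Matrix.mul_apply, Finset.sum_mul, conjTranspose_apply]
        refine Finset.sum_congr rfl fun j _ => ?_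
        rw [mul_assoc, ← hyB]
        by_cases hj : k < j
        · simp [hy, hj]
        · simp [hBk j hj]
      rw [this, hB]
      simp
    have hx : x i = B i 0 * (β • α) := by
      rw [← hyB]
      simp [hy, hi]
    have e : (planeRotation A B θ *ᵥ x) i =
        x i + (Real.cos θ - 1) • (B i 0 * (Bᴴ *ᵥ x) 0) + Real.sin θ • (B i 0 * (Aᴴ *ᵥ x) 0) := by
      simp only [planeRotation, add_mulVec, sub_mulVec, one_mulVec, smul_mulVec, ← mulVec_mulVec,
        Pi.add_apply, Pi.smul_apply, Pi.sub_apply]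
      have hm : ∀ (C : Matrix (Fin n) (Fin 1) F) (v : Fin 1 → F), (C *ᵥ v) i = C i 0 * v 0 := by
        intro C v
        simp [mulVec, dotProduct]
      simp [hm, hAi]
    rw [coe_unitaryOf, e, hAx, hBx, hx]
    simp only [mul_smul_comm, smul_smul, ← add_smul]
    have : β + (Real.cos θ - 1) * β + Real.sin θ * ‖x k‖ = 0 := by
      rw [hc, hs]
      ring
    rw [this, zero_smul]

/-- QR factorization by eliminating one column after another, with the unitary factor in the
identity component. -/
theorem exists_unitary_mul_triangular {m n : ℕ} (M : Matrix (Fin m) (Fin n) F) :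
    ∃ g ∈ U₀ F m, ∀ (i : Fin m) (j : Fin n),
      (j : ℕ) < (i : ℕ) → ((g : Matrix (Fin m) (Fin m) F) * M) i j = 0 := by
  suffices H : ∀ k : ℕ, ∃ g ∈ U₀ F m, ∀ (i : Fin m) (j : Fin n), (j : ℕ) < k → (j : ℕ) < (i : ℕ) →
      ((g : Matrix (Fin m) (Fin m) F) * M) i j = 0 by
    obtain ⟨g, hg, h⟩ := H n
    exact ⟨g, hg, fun i j => h i j j.2⟩
  intro k
  induction k with
  | zero => exact ⟨1, one_mem _, fun i j h => absurd h (Nat.not_lt_zero _)⟩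
  | succ k ih =>
    obtain ⟨g, hg, h⟩ := ih
    by_cases hk : k < m ∧ k < n
    · set N := (g : Matrix (Fin m) (Fin m) F) * M with hN
      obtain ⟨g', hg', h1, h2⟩ :=
        exists_unitary_eliminate (fun i => N i ⟨k, hk.2⟩) (⟨k, hk.1⟩ : Fin m)
      refine ⟨g' * g, mul_mem hg' hg, fun i j hj hij => ?_⟩
      have e : ((g' * g : U F m) : Matrix (Fin m) (Fin m) F) * M =
          (g' : Matrix (Fin m) (Fin m) F) * N := by
        rw [hN, ← Matrix.mul_assoc]; rfl
      rw [e]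
      rcases Nat.lt_succ_iff_lt_or_eq.mp hj with hj' | hj'
      -- An earlier column is unchanged: it vanishes in the rows from k on, and the new rotation
      -- fixes the first k basis vectors.
      · rw [Matrix.mul_apply, ← h i j hj' hij]
        rw [Finset.sum_eq_single i]
        · rcases lt_or_ge (i : ℕ) k with hik | hik
          · rw [h1 i i (by exact hik)]; simp
          · rw [h i j hj' hij]; simp
        · intro l _ hl
          rcases lt_or_ge (l : ℕ) k with hlk | hlk
          · rw [h1 i l (by exact hlk)]; simp [hl.symm]
          · rw [h l j hj' (by omega)]; simp
        · simp
      · have : j = ⟨k, hk.2⟩ := Fin.ext hj'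
        subst this
        exact h2 i (by exact hij)
    · refine ⟨g, hg, fun i j hj hij => h i j ?_ hij⟩
      have := i.2
      have := j.2
      omega

end Algebra

/-! ### Orthonormal frames and the QR factorization with positive diagonal -/

section Triangular

variable {F : Type} [NormedDivisionRing F] [NormedAlgebra ℝ F] [StarRing F] [CStarRing F]
  [FiniteDimensional ℝ F] [MeasureSpace F] [BorelSpace F] [Scalars F]

/-- The `m × n` matrix with ones on the main diagonal and zeros elsewhere. -/
def inclusion (F : Type) [NormedDivisionRing F] (m n : ℕ) : Matrix (Fin m) (Fin n) F :=
  Matrix.of fun i j => if (i : ℕ) = (j : ℕ) then 1 else 0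

theorem inclusion_apply (m n : ℕ) (i : Fin m) (j : Fin n) :
    inclusion F m n i j = if (i : ℕ) = (j : ℕ) then 1 else 0 := rfl

theorem inclusion_self (n : ℕ) : inclusion F n n = 1 := by
  ext i j
  simp [inclusion_apply, Matrix.one_apply, Fin.ext_iff]

theorem inclusion_conjTranspose (m n : ℕ) : (inclusion F m n)ᴴ = inclusion F n m := by
  ext i j
  simp only [conjTranspose_apply, inclusion_apply, eq_comm (a := (j : ℕ))]
  split <;> simp

theorem inclusion_mul_apply {m n : ℕ} {l : Type} (hnm : n ≤ m) (A : Matrix (Fin m) l F) (i : Fin n)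
    (j : l) : (inclusion F n m * A) i j = A (Fin.castLE hnm i) j := by
  rw [Matrix.mul_apply, Finset.sum_eq_single (Fin.castLE hnm i)]
  · simp [inclusion_apply]
  · intro k _ hk
    have : (i : ℕ) ≠ k := fun h => hk (Fin.ext h.symm)
    simp [inclusion_apply, this]
  · simp

theorem mul_inclusion_apply {m n : ℕ} {l : Type} (hnm : n ≤ m) (A : Matrix l (Fin m) F) (i : l)
    (j : Fin n) : (A * inclusion F m n) i j = A i (Fin.castLE hnm j) := by
  rw [Matrix.mul_apply, Finset.sum_eq_single (Fin.castLE hnm j)]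
  · simp [inclusion_apply]
  · intro k _ hk
    have : (k : ℕ) ≠ j := fun h => hk (Fin.ext h)
    simp [inclusion_apply, this]
  · simp

theorem inclusion_gram {m n : ℕ} (hnm : n ≤ m) : (inclusion F m n)ᴴ * inclusion F m n = 1 := by
  ext i j
  rw [inclusion_conjTranspose, inclusion_mul_apply hnm]
  simp [inclusion_apply, Matrix.one_apply, Fin.ext_iff]

theorem inclusion_mul_of_rows_zero {m n : ℕ} {l : Type} (hnm : n ≤ m) (A : Matrix (Fin m) l F)
    (hA : ∀ (i : Fin m) j, n ≤ (i : ℕ) → A i j = 0) : inclusion F m n * (inclusion F n m * A) = A := by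
  ext i j
  rw [Matrix.mul_apply]
  by_cases hi : (i : ℕ) < n
  · rw [Finset.sum_eq_single ⟨i, hi⟩]
    · rw [inclusion_mul_apply hnm]
      simp [inclusion_apply]
    · intro k _ hk
      have : (i : ℕ) ≠ k := fun h => hk (Fin.ext h.symm)
      simp [inclusion_apply, this]
    · simp
  · rw [hA i j (not_lt.mp hi)]
    refine Finset.sum_eq_zero fun k _ => ?_
    have : (i : ℕ) ≠ k := fun h => hi (h ▸ k.2)
    simp [inclusion_apply, this]

/-- Row by row: if the rows above are already diagonal, column i meets only row i, so its norm
forces a unit entry there, and its orthogonality to the other columns kills the rest of the row. -/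
theorem isometry_triangular_diagonal {m n : ℕ} {T : Matrix (Fin m) (Fin n) F}
    (hT : ∀ (i : Fin m) (j : Fin n), (j : ℕ) < (i : ℕ) → T i j = 0) (hi : Tᴴ * T = 1) (k : ℕ) :
    ∀ (i : Fin m) (j : Fin n), (i : ℕ) = k →
      ((i : ℕ) = j → ‖T i j‖ = 1) ∧ ((i : ℕ) ≠ j → T i j = 0) := by
  induction k using Nat.strong_induction_on with
  | _ k ih =>
    intro i j hik
    have key : ∀ (a b : Fin n), (a : ℕ) = i → (Tᴴ * T) a b = star (T i a) * T i b := by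
      intro a b ha
      rw [Matrix.mul_apply, Finset.sum_eq_single i]
      · rfl
      · intro l _ hl
        rw [conjTranspose_apply]
        rcases lt_trichotomy (l : ℕ) (i : ℕ) with h | h | h
        · rw [(ih l (by omega) l a rfl).2 (by omega)]; simp
        · exact absurd (Fin.ext h) hl
        · rw [hT l a (by omega)]; simp
      · simp
    have hdiag : ∀ a : Fin n, (a : ℕ) = i → ‖T i a‖ = 1 := by
      intro a ha
      have h1 := key a a ha
      rw [hi, Scalars.star_mul_self_eq, Matrix.one_apply_eq, ← map_one (algebraMap ℝ F)] at h1
      have h2 := (algebraMap ℝ F).injective h1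
      nlinarith [norm_nonneg (T i a)]
    refine ⟨fun h => hdiag j h.symm, fun h => ?_⟩
    rcases lt_or_gt_of_ne h with h' | h'
    · let a : Fin n := ⟨i, h'.trans j.2⟩
      have h1 := key a j rfl
      rw [hi, Matrix.one_apply_ne (by simpa [Fin.ext_iff, a] using h)] at h1
      have h2 := hdiag a rfl
      rcases mul_eq_zero.mp h1.symm with h3 | h3
      · rw [star_eq_zero] at h3
        rw [h3] at h2
        simp at h2
      · exact h3
    · exact hT i j h'

/-- The triangular form of a frame is an isometry, hence diagonal. Thus the identity component moves
the standard frame to every frame, up to phases of the columns. -/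
theorem exists_isometry_eq {m n : ℕ} (hnm : n ≤ m) {V : Matrix (Fin m) (Fin n) F}
    (hV : Vᴴ * V = 1) :
    ∃ g ∈ U₀ F m, ∃ d : Fin n → F, (∀ i, ‖d i‖ = 1) ∧
      V = (g : Matrix (Fin m) (Fin m) F) * inclusion F m n * diagonal d := by
  obtain ⟨g, hg, hT⟩ := exists_unitary_mul_triangular V
  set T := (g : Matrix (Fin m) (Fin m) F) * V with hTdef
  have hTT : Tᴴ * T = 1 := by
    rw [hTdef, conjTranspose_mul, Matrix.mul_assoc, ← Matrix.mul_assoc _ _ V,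
      unitary_conjTranspose_mul, Matrix.one_mul, hV]
  have hd := isometry_triangular_diagonal hT hTT
  refine ⟨g⁻¹, inv_mem hg, fun j => T (Fin.castLE hnm j) j, fun j => (hd _ _ j rfl).1 rfl, ?_⟩
  have : inclusion F m n * diagonal (fun j => T (Fin.castLE hnm j) j) = T := by
    ext i j
    rw [mul_diagonal, inclusion_apply]
    by_cases h : (i : ℕ) = j
    · have : Fin.castLE hnm j = i := Fin.ext h.symm
      simp [h, this]
    · rw [(hd _ i j rfl).2 h]; simp [h]
  rw [Matrix.mul_assoc, this, hTdef, coe_unitary_inv, ← Matrix.mul_assoc,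
    unitary_conjTranspose_mul, Matrix.one_mul]

theorem diagonal_gram {n : Type} [Fintype n] [DecidableEq n] (d : n → F) :
    (diagonal d)ᴴ * diagonal d = diagonal fun i => algebraMap ℝ F (‖d i‖ ^ 2) := by
  rw [diagonal_conjTranspose, diagonal_mul_diagonal]
  congr 1
  ext i
  exact Scalars.star_mul_self_eq _

/-- The diagonal unitary matrix with unit entries `d`. -/
def unitaryDiagonal {n : ℕ} (d : Fin n → F) (hd : ∀ i, ‖d i‖ = 1) : U F n :=
  unitaryOf (diagonal d) (by rw [diagonal_gram]; simp [hd])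

@[simp] theorem coe_unitaryDiagonal {n : ℕ} (d : Fin n → F) (hd : ∀ i, ‖d i‖ = 1) :
    (unitaryDiagonal d hd : Matrix (Fin n) (Fin n) F) = diagonal d := rfl

theorem exists_connected_mul_diagonal {n : ℕ} (u : U F n) :
    ∃ g ∈ U₀ F n, ∃ (d : Fin n → F) (hd : ∀ i, ‖d i‖ = 1), u = g * unitaryDiagonal d hd := by
  obtain ⟨g, hg, d, hd, h⟩ := exists_isometry_eq le_rfl (unitary_conjTranspose_mul u)
  refine ⟨g, hg, d, hd, Subtype.ext ?_⟩
  rw [h, inclusion_self, Matrix.mul_one]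
  rfl

/-- The phases of the columns, extended by ones, are absorbed in the unitary factor; the price is
that this factor need no longer lie in the identity component. -/
theorem exists_unitary_mul_inclusion {m n : ℕ} (hnm : n ≤ m) {V : Matrix (Fin m) (Fin n) F}
    (hV : Vᴴ * V = 1) :
    ∃ h : U F m, V = (h : Matrix (Fin m) (Fin m) F) * inclusion F m n := by
  obtain ⟨g, -, d, hd, h⟩ := exists_isometry_eq hnm hV
  let d' : Fin m → F := fun i => if hi : (i : ℕ) < n then d ⟨i, hi⟩ else 1
  have hd' : ∀ i, ‖d' i‖ = 1 := by
    intro i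
    by_cases hi : (i : ℕ) < n
    · simp [d', hi, hd]
    · simp [d', hi]
  refine ⟨g * unitaryDiagonal d' hd', ?_⟩
  have : inclusion F m n * diagonal d = diagonal d' * inclusion F m n := by
    ext i j
    rw [mul_diagonal, diagonal_mul, inclusion_apply]
    by_cases hij : (i : ℕ) = j
    · simp [hij, d']
    · simp [hij]
  rw [h, Matrix.mul_assoc, this, ← Matrix.mul_assoc]
  rfl

theorem exists_unitary_row {n : ℕ} (x : Fin (n + 1) → F) (hx : ∑ i, ‖x i‖ ^ 2 = 1) :
    ∃ h : U F (n + 1), ∀ j, x j = (h : Matrix (Fin (n + 1)) (Fin (n + 1)) F) 0 j := by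
  let V : Matrix (Fin (n + 1)) (Fin 1) F := Matrix.of fun i _ => star (x i)
  have hV : Vᴴ * V = 1 := by
    ext i j
    fin_cases i; fin_cases j
    simp only [Fin.zero_eta, one_apply_eq]
    rw [gram_apply_self]
    simp [V, hx]
  obtain ⟨h, hh⟩ := exists_unitary_mul_inclusion (by omega) hV
  refine ⟨h⁻¹, fun j => ?_⟩
  have := congrFun (congrFun hh j) 0
  rw [mul_inclusion_apply (by omega)] at this
  simp only [V, of_apply] at this
  rw [coe_unitary_inv, conjTranspose_apply, ← star_star (x j), this]
  rfl

/-- Multiplication of column vectors by X is real linear, so injectivity gives surjectivity by a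
dimension count; no determinant over F is involved. -/
theorem exists_right_inverse {n : ℕ} {X : Matrix (Fin n) (Fin n) F}
    (hX : ∀ x : Fin n → F, X *ᵥ x = 0 → x = 0) :
    ∃ Y : Matrix (Fin n) (Fin n) F, X * Y = 1 ∧ Y * X = 1 := by
  let f : (Fin n → F) →ₗ[ℝ] (Fin n → F) :=
    { toFun := fun x => X *ᵥ x
      map_add' := fun x y => mulVec_add _ _ _
      map_smul' := fun c x => mulVec_smul _ _ _ }
  have hf : Function.Injective f := by
    rw [← LinearMap.ker_eq_bot, LinearMap.ker_eq_bot']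
    exact hX
  have hs := LinearMap.injective_iff_surjective.mp hf
  choose y hy using fun j : Fin n => hs (Pi.single j 1)
  have h : X * Matrix.of (fun i j => y j i) = 1 := by
    ext i j
    have := congrFun (hy j) i
    simp only [Matrix.one_apply]
    rw [Pi.single_apply] at this
    exact this
  exact ⟨_, h, mul_eq_one_comm.mp h⟩

/-- Back substitution, starting from the last row. -/
theorem blockTriangular_inverse {n : ℕ} {R S : Matrix (Fin n) (Fin n) F} (hR : R.BlockTriangular id)
    (h : R * S = 1) : (∀ i, R i i ≠ 0) ∧ S.BlockTriangular id := by
  suffices H : ∀ k : ℕ, ∀ i : Fin n, n - 1 - i = k → R i i ≠ 0 ∧ ∀ j, j < i → S i j = 0 from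
    ⟨fun i => (H _ i rfl).1, fun i j hij => (H _ i rfl).2 j hij⟩
  intro k
  induction k using Nat.strong_induction_on with
  | _ k ih =>
    intro i hi
    have key : ∀ j ≤ i, R i i * S i j = (1 : Matrix (Fin n) (Fin n) F) i j := by
      intro j hj
      rw [← h, Matrix.mul_apply, Finset.sum_eq_single i]
      · intro l _ hl
        rcases lt_or_gt_of_ne hl with hl' | hl'
        · rw [hR (by exact hl')]; simp
        · rw [(ih (n - 1 - l) (by omega) l rfl).2 j (by omega)]; simp
      · simp
    have h1 : R i i ≠ 0 := by
      intro h0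
      have := key i le_rfl
      simp [h0] at this
    refine ⟨h1, fun j hj => ?_⟩
    have := key j hj.le
    rw [Matrix.one_apply_ne hj.ne'] at this
    exact (mul_eq_zero.mp this).resolve_left h1

/-- The phases of the diagonal entries of the QR factor are moved into the unitary factor. -/
theorem exists_unitary_mul_positive_triangular {n : ℕ} {X : Matrix (Fin n) (Fin n) F}
    (hX : ∀ x : Fin n → F, X *ᵥ x = 0 → x = 0) :
    ∃ (k : U F n) (T : Matrix (Fin n) (Fin n) F) (s : Fin n → ℝ), T.BlockTriangular id ∧
      (∀ i, T i i = algebraMap ℝ F (Real.exp (s i))) ∧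
      X = (k : Matrix (Fin n) (Fin n) F) * T := by
  obtain ⟨Y, hXY, -⟩ := exists_right_inverse hX
  obtain ⟨g, -, hR⟩ := exists_unitary_mul_triangular X
  set R := (g : Matrix (Fin n) (Fin n) F) * X with hRdef
  have hRT : R.BlockTriangular id := fun i j hij => hR i j hij
  have hRS : R * (Y * (g : Matrix (Fin n) (Fin n) F)ᴴ) = 1 := by
    rw [hRdef, Matrix.mul_assoc, ← Matrix.mul_assoc X, hXY, Matrix.one_mul,
      unitary_mul_conjTranspose]
  have hR0 := (blockTriangular_inverse hRT hRS).1
  let d : Fin n → F := fun i => ‖R i i‖⁻¹ • R i i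
  have hd : ∀ i, ‖d i‖ = 1 := fun i => by
    rw [norm_smul, norm_inv, norm_norm, inv_mul_cancel₀ (norm_ne_zero_iff.mpr (hR0 i))]
  refine ⟨g⁻¹ * unitaryDiagonal d hd,
    ((unitaryDiagonal d hd : U F n) : Matrix (Fin n) (Fin n) F)ᴴ * R,
    fun i => Real.log ‖R i i‖, ?_, ?_, ?_⟩
  · intro i j hij
    rw [coe_unitaryDiagonal, diagonal_conjTranspose, diagonal_mul, hRT hij, mul_zero]
  · intro i
    rw [coe_unitaryDiagonal, diagonal_conjTranspose, diagonal_mul,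
      Real.exp_log (norm_pos_iff.mpr (hR0 i))]
    simp only [Pi.star_apply, d, star_smul, star_trivial, smul_mul_assoc, Scalars.star_mul_self_eq]
    rw [Algebra.smul_def, ← map_mul]
    congr 1
    have := norm_ne_zero_iff.mpr (hR0 i)
    field_simp
  · have : ((g⁻¹ * unitaryDiagonal d hd : U F n) : Matrix (Fin n) (Fin n) F) =
      (g : Matrix (Fin n) (Fin n) F)ᴴ * ((unitaryDiagonal d hd : U F n) : Matrix _ _ F) := rfl
    rw [this, Matrix.mul_assoc, ← Matrix.mul_assoc _ _ R, unitary_mul_conjTranspose,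
      Matrix.one_mul, hRdef, ← Matrix.mul_assoc, unitary_conjTranspose_mul, Matrix.one_mul]

/-! ### Polar decomposition -/

theorem re_trace_planeRotation_mul {n : ℕ} (A B : Matrix (Fin n) (Fin 1) F)
    (Y : Matrix (Fin n) (Fin n) F) (θ : ℝ) :
    re (planeRotation A B θ * Y).trace = re Y.trace +
      (Real.cos θ - 1) * re ((A * Aᴴ + B * Bᴴ) * Y).trace +
      Real.sin θ * re ((B * Aᴴ - A * Bᴴ) * Y).trace := by
  rw [planeRotation, Matrix.add_mul, Matrix.add_mul, Matrix.one_mul, trace_add, trace_add, re_add,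
    re_add, smul_mul_assoc, smul_mul_assoc, trace_smul, trace_smul, re_smul, re_smul]

/-- The left side is maximal at θ = 0, where its derivative is b. -/
theorem eq_zero_of_cos_sin_le {a b : ℝ}
    (h : ∀ θ : ℝ, (Real.cos θ - 1) * a + Real.sin θ * b ≤ 0) : b = 0 := by
  have h1 : IsLocalMax (fun θ : ℝ => (Real.cos θ - 1) * a + Real.sin θ * b) 0 := by
    refine Filter.Eventually.of_forall fun θ => ?_
    simpa using h θ
  have h2 : HasDerivAt (fun θ : ℝ => (Real.cos θ - 1) * a + Real.sin θ * b)
      (-Real.sin 0 * a + Real.cos 0 * b) 0 :=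
    (((Real.hasDerivAt_cos 0).sub_const 1).mul_const a).add ((Real.hasDerivAt_sin 0).mul_const b)
  simpa using h1.hasDerivAt_eq_zero h2

/-- Variational polar decomposition: let k maximize Re tr(kX) on the compact unitary group. Varying
k by diagonal phases makes the diagonal of kX real, and varying it by plane rotations makes the
off-diagonal part hermitian. Positivity is not needed. -/
theorem exists_unitary_mul_isHermitian {n : ℕ} (X : Matrix (Fin n) (Fin n) F) :
    ∃ k : U F n, ((k : Matrix (Fin n) (Fin n) F) * X)ᴴ = (k : Matrix (Fin n) (Fin n) F) * X := by
  have hc : Continuous fun k : U F n => re ((k : Matrix (Fin n) (Fin n) F) * X).trace :=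
    continuous_re.comp ((continuous_subtype_val.matrix_mul continuous_const).matrix_trace)
  obtain ⟨k, -, hk⟩ := isCompact_univ.exists_isMaxOn ⟨1, Set.mem_univ _⟩ hc.continuousOn
  refine ⟨k, ?_⟩
  set Y := (k : Matrix (Fin n) (Fin n) F) * X with hY
  have hmax : ∀ g : U F n, re ((g : Matrix (Fin n) (Fin n) F) * Y).trace ≤ re Y.trace := by
    intro g
    have := hk (Set.mem_univ (g * k))
    simpa [hY, Matrix.mul_assoc] using this
  ext i j
  rw [conjTranspose_apply]
  by_cases hij : i = j
  · subst hij
    by_cases h0 : Y i i = 0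
    · simp [h0]
    have hn := norm_ne_zero_iff.mpr h0
    -- The competitor rotates the i-th diagonal entry to its absolute value, so maximality gives ‖Y
    -- i i‖ ≤ Re Y i i.
    let d : Fin n → F := fun l => if l = i then ‖Y i i‖⁻¹ • star (Y i i) else 1
    have hd : ∀ l, ‖d l‖ = 1 := by
      intro l
      by_cases hl : l = i
      · simp [d, hl, norm_smul, hn]
      · simp [d, hl]
    have h1 := hmax (unitaryDiagonal d hd)
    simp only [coe_unitaryDiagonal, trace, diag_apply, diagonal_mul, re_sum] at h1
    rw [← Finset.add_sum_erase _ _ (Finset.mem_univ i),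
      ← Finset.add_sum_erase _ _ (Finset.mem_univ i)] at h1
    have h2 : ∑ l ∈ Finset.univ.erase i, re (d l * Y l l) =
        ∑ l ∈ Finset.univ.erase i, re (Y l l) := by
      refine Finset.sum_congr rfl fun l hl => ?_
      simp [d, Finset.ne_of_mem_erase hl]
    have h3 : re (d i * Y i i) = ‖Y i i‖ := by
      simp only [d, if_true, smul_mul_assoc, re_smul, Scalars.star_mul_self_eq, re_algebraMap]
      field_simp
    rw [h2, h3] at h1
    -- Equality in Re y ≤ ‖y‖ forces y = ‖y‖, because the squared distance between the two is
    -- 2‖y‖(‖y‖ - Re y).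
    have h4 := norm_add_sq_eq (-algebraMap ℝ F ‖Y i i‖) (Y i i)
    rw [star_neg, star_algebraMap_real, norm_neg, norm_algebraMap', norm_norm, neg_mul,
      ← Algebra.smul_def, ← neg_smul, re_smul] at h4
    have h5 : ‖-algebraMap ℝ F ‖Y i i‖ + Y i i‖ ^ 2 ≤ 0 := by
      rw [h4]
      nlinarith [norm_nonneg (Y i i)]
    have h6 : -algebraMap ℝ F ‖Y i i‖ + Y i i = 0 := by
      rw [← norm_eq_zero]
      exact pow_eq_zero_iff two_ne_zero |>.mp (le_antisymm h5 (sq_nonneg _))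
    have h7 : Y i i = algebraMap ℝ F ‖Y i i‖ := by
      rw [← sub_eq_zero, sub_eq_add_neg, add_comm, h6]
    rw [h7, star_algebraMap_real]
  · by_contra hne
    set D := Y i j - star (Y j i) with hD
    have hD0 : D ≠ 0 := fun h => hne (sub_eq_zero.mp h).symm
    have hn := norm_ne_zero_iff.mpr hD0
    -- The phase is chosen so that Re(αD) = ‖D‖, whereas stationarity under the rotation in the
    -- plane of A and B gives Re(αD) = 0.
    set α : F := ‖D‖⁻¹ • star D with hα
    have hα1 : ‖α‖ = 1 := by simp [hα, norm_smul, hn]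
    let A : Matrix (Fin n) (Fin 1) F := Matrix.of fun l _ => if l = i then 1 else 0
    let B : Matrix (Fin n) (Fin 1) F := Matrix.of fun l _ => if l = j then α else 0
    have hA : Aᴴ * A = 1 := by
      ext a b
      fin_cases a; fin_cases b
      simp [A, Matrix.mul_apply]
    have hB : Bᴴ * B = 1 := by
      ext a b
      fin_cases a; fin_cases b
      simp [B, Matrix.mul_apply, Scalars.star_mul_self_eq, hα1]
    have hAB : Aᴴ * B = 0 := by
      ext a b
      fin_cases a; fin_cases b
      simp [A, B, Matrix.mul_apply, Ne.symm hij]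
    have h1 : re ((B * Aᴴ - A * Bᴴ) * Y).trace = 0 := by
      refine eq_zero_of_cos_sin_le (a := re ((A * Aᴴ + B * Bᴴ) * Y).trace) fun θ => ?_
      have := hmax (unitaryOf _ (planeRotation_gram hA hB hAB θ))
      rw [coe_unitaryOf, re_trace_planeRotation_mul] at this
      linarith
    have h2 : (B * Aᴴ * Y).trace = α * Y i j := by
      simp only [A, B, trace, diag_apply, Matrix.mul_apply, conjTranspose_apply, of_apply,
        Finset.univ_unique, Finset.sum_singleton, apply_ite (star : F → F), star_one, star_zero,
        mul_ite, mul_one, mul_zero, ite_mul, zero_mul, Finset.sum_ite_eq', Finset.mem_univ, if_true]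
    have h3 : (A * Bᴴ * Y).trace = star α * Y j i := by
      simp only [A, B, trace, diag_apply, Matrix.mul_apply, conjTranspose_apply, of_apply,
        Finset.univ_unique, Finset.sum_singleton, apply_ite (star : F → F), star_zero,
        mul_ite, mul_zero, ite_mul, zero_mul, one_mul, Finset.sum_ite_eq', Finset.mem_univ, if_true]
    have h4 : re (α * Y i j) = re (α * star (Y j i)) := by
      rw [Matrix.sub_mul, trace_sub, h2, h3, sub_eq_add_neg, re_add, ← neg_one_smul ℝ, re_smul] at h1
      rw [re_mul_comm α (star _), ← re_star (star _ * _), star_mul, star_star]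
      linarith
    have h5 : re (α * D) = ‖D‖ := by
      rw [hα, smul_mul_assoc, Scalars.star_mul_self_eq, re_smul, re_algebraMap]
      field_simp
    have h6 : re (α * D) = 0 := by
      rw [hD, mul_sub, sub_eq_add_neg, re_add, ← neg_one_smul ℝ, re_smul, h4]
      ring
    exact hn (h5.symm.trans h6)

/-- With H = kX hermitian, X = k^*H and X^* = Hk, so X^*X = H² and XX^* = k^*H²k. -/
theorem exists_unitary_gram_eq {n : ℕ} (X : Matrix (Fin n) (Fin n) F) :
    ∃ k : U F n, X * Xᴴ =
      (k : Matrix (Fin n) (Fin n) F)ᴴ * (Xᴴ * X) * (k : Matrix (Fin n) (Fin n) F) := by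
  obtain ⟨k, hk⟩ := exists_unitary_mul_isHermitian X
  refine ⟨k, ?_⟩
  set K := (k : Matrix (Fin n) (Fin n) F)
  have h1 : K * Kᴴ = 1 := unitary_mul_conjTranspose k
  have h2 : Kᴴ * K = 1 := unitary_conjTranspose_mul k
  rw [conjTranspose_mul] at hk
  have hX : X = Kᴴ * (K * X) := by rw [← Matrix.mul_assoc, h2, Matrix.one_mul]
  have hXs : Xᴴ = K * X * K := by
    rw [← hk, Matrix.mul_assoc, h2, Matrix.mul_one]
  have e : Kᴴ * (Xᴴ * X) * K = Kᴴ * (Xᴴ * (X * K)) := by simp only [Matrix.mul_assoc]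
  have e2 : Kᴴ * Xᴴ = X * K := by
    rw [hXs, ← Matrix.mul_assoc, ← Matrix.mul_assoc, h2, Matrix.one_mul]
  have e3 : X * K = Kᴴ * Xᴴ := e2.symm
  calc X * Xᴴ = X * (K * X * K) := by rw [hXs]
    _ = (X * K) * (X * K) := by simp only [Matrix.mul_assoc]
    _ = (Kᴴ * Xᴴ) * (X * K) := by rw [e2]
    _ = _ := by simp only [Matrix.mul_assoc]

end Triangular

/-! ### Laws of the determinant -/

/-- The properties of the determinant and of Lebesgue measure on which the integral formulas
depend. -/
class ScalarsLaws (F : Type) [NormedDivisionRing F] [NormedAlgebra ℝ F] [StarRing F]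
    [MeasureSpace F] [BorelSpace F] [Scalars F] : Prop where
  isAddHaar : (volume : Measure F).IsAddHaarMeasure
  det_gram_triangular : ∀ {n : Type} [Fintype n] [DecidableEq n] [LinearOrder n]
    (T : Matrix n n F), T.BlockTriangular id →
      Scalars.det (Tᴴ * T) = ((∏ i, ‖T i i‖ ^ 2 : ℝ) : ℂ)
  continuousAt_det : ∀ {n : Type} [Fintype n] [DecidableEq n] [LinearOrder n]
    (T : Matrix n n F), T.BlockTriangular id → (∀ i, T i i ≠ 0) →
      ContinuousAt (Scalars.det : Matrix n n F → ℂ) (Tᴴ * T)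
  measurable_det : ∀ {n : Type} [Fintype n] [DecidableEq n],
    Measurable (Scalars.det : Matrix n n F → ℂ)
  det_congr : ∀ {n : Type} [Fintype n] [DecidableEq n] (C X : Matrix n n F),
    Scalars.det (Cᴴ * X * C) = Scalars.det (Cᴴ * C) * Scalars.det X

/-! ### Power functions of Gram matrices -/

section PowerFunctions

variable {F : Type} [NormedDivisionRing F] [NormedAlgebra ℝ F] [StarRing F] [CStarRing F]
  [FiniteDimensional ℝ F] [MeasureSpace F] [BorelSpace F] [Scalars F]

theorem gram_unitary_mul {m n : ℕ} (k : U F m) (T : Matrix (Fin m) (Fin n) F) :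
    ((k : Matrix (Fin m) (Fin m) F) * T)ᴴ * ((k : Matrix (Fin m) (Fin m) F) * T) = Tᴴ * T := by
  rw [conjTranspose_mul, Matrix.mul_assoc, ← Matrix.mul_assoc _ _ T, unitary_conjTranspose_mul,
    Matrix.one_mul]

/-- The first r columns of an upper triangular matrix vanish below row r, so a leading block of the
Gram matrix is the Gram matrix of the leading block. -/
theorem gram_submatrix_of_triangular {q : ℕ} {T : Matrix (Fin q) (Fin q) F}
    (hT : T.BlockTriangular id) (r : Fin q) :
    (Tᴴ * T).submatrix (Subtype.val : {i : Fin q // i ≤ r} → Fin q)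
      (Subtype.val : {i : Fin q // i ≤ r} → Fin q) =
    (T.submatrix (Subtype.val : {i : Fin q // i ≤ r} → Fin q) Subtype.val)ᴴ *
      T.submatrix (Subtype.val : {i : Fin q // i ≤ r} → Fin q) Subtype.val := by
  ext i j
  simp only [submatrix_apply, Matrix.mul_apply, conjTranspose_apply]
  have e : ∑ l : {i : Fin q // i ≤ r}, star (T l i) * T l j =
      ∑ l ∈ Finset.univ.filter fun l => l ≤ r, star (T l i) * T l j :=
    (Finset.sum_subtype (Finset.univ.filter fun l => l ≤ r) (by simp)
      fun l => star (T l i) * T l j).symm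
  refine Eq.trans ?_ e.symm
  symm
  refine Finset.sum_subset (Finset.subset_univ _) fun l _ hl => ?_
  have : (i : Fin q) < l := lt_of_le_of_lt i.2 (by simpa using hl)
  rw [hT this]
  simp

theorem submatrix_blockTriangular {q : ℕ} {T : Matrix (Fin q) (Fin q) F}
    (hT : T.BlockTriangular id) (r : Fin q) :
    (T.submatrix (Subtype.val : {i : Fin q // i ≤ r} → Fin q) Subtype.val).BlockTriangular id :=
  fun i j hij => hT (show (j : Fin q) < i from hij)

theorem sum_telescope (f : ℕ → ℂ) (i : ℕ) {n : ℕ} (h : i ≤ n) :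
    ∑ r ∈ Finset.range n, (if i ≤ r then f r - f (r + 1) else 0) = f i - f n := by
  induction n, h using Nat.le_induction with
  | base =>
    rw [sub_self]
    refine Finset.sum_eq_zero fun r hr => ?_
    rw [if_neg (by simpa using hr)]
  | succ n hn ih =>
    rw [Finset.sum_range_succ, ih, if_pos hn]
    ring

/-- Abel summation. It converts the exponents μ_r - μ_{r+1} of the minors, with μ_{q+1} = 0, into a
pairing of s with μ. -/
theorem sum_by_parts {q : ℕ} (s mu : Fin q → ℂ) :
    ∑ r : Fin q, (∑ i : {i : Fin q // i ≤ r}, s i) *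
      (mu r - if h : (r : ℕ) + 1 < q then mu ⟨(r : ℕ) + 1, h⟩ else 0) = ∑ i, s i * mu i := by
  let f : ℕ → ℂ := fun k => if h : k < q then mu ⟨k, h⟩ else 0
  have h1 : ∀ r : Fin q, (∑ i : {i : Fin q // i ≤ r}, s i) *
      (mu r - if h : (r : ℕ) + 1 < q then mu ⟨(r : ℕ) + 1, h⟩ else 0) =
      ∑ i : Fin q, s i * (if (i : ℕ) ≤ r then f r - f (r + 1) else 0) := by
    intro r
    have : (∑ i : {i : Fin q // i ≤ r}, s i) = ∑ i : Fin q, if i ≤ r then s i else 0 := by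
      rw [← Finset.sum_filter]
      exact (Finset.sum_subtype (Finset.univ.filter fun i => i ≤ r) (by simp) s).symm
    rw [this, Finset.sum_mul]
    refine Finset.sum_congr rfl fun i _ => ?_
    by_cases hir : i ≤ r
    · simp [f, hir]
    · simp [hir]
  rw [Finset.sum_congr rfl fun r _ => h1 r, Finset.sum_comm]
  refine Finset.sum_congr rfl fun i _ => ?_
  rw [← Finset.mul_sum, Fin.sum_univ_eq_sum_range (fun r => if (i : ℕ) ≤ r then f r - f (r + 1)
    else 0), sum_telescope f i i.2.le]
  simp [f]

variable [ScalarsLaws F]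

theorem minor_gram {q : ℕ} {X T : Matrix (Fin q) (Fin q) F} {k : U F q} {s : Fin q → ℝ}
    (hX : X = (k : Matrix (Fin q) (Fin q) F) * T) (hT : T.BlockTriangular id)
    (hs : ∀ i, ‖T i i‖ = Real.exp (s i)) (r : Fin q) :
    minor r (Xᴴ * X) = ((Real.exp (2 * ∑ i : {i : Fin q // i ≤ r}, s i) : ℝ) : ℂ) := by
  rw [minor, hX, gram_unitary_mul, gram_submatrix_of_triangular hT,
    ScalarsLaws.det_gram_triangular _ (submatrix_blockTriangular hT r), Finset.mul_sum,
    Real.exp_sum]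
  congr 1
  refine Finset.prod_congr rfl fun i _ => ?_
  rw [submatrix_apply, hs, ← Real.exp_nat_mul]
  norm_num

/-- The minors are exponentials of the real numbers 2(s_1 + ⋯ + s_r), so their principal logarithms
are known exactly. For μ = (iλ - ρ)/2 the right side is the Harish-Chandra integrand at s. -/
theorem powerFunction_gram {q : ℕ} {X T : Matrix (Fin q) (Fin q) F} {k : U F q} {s : Fin q → ℝ}
    (hX : X = (k : Matrix (Fin q) (Fin q) F) * T) (hT : T.BlockTriangular id)
    (hs : ∀ i, ‖T i i‖ = Real.exp (s i)) (mu : Fin q → ℂ) :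
    powerFunction mu (Xᴴ * X) = Complex.exp (∑ i, 2 * (s i : ℂ) * mu i) := by
  rw [← sum_by_parts, Complex.exp_sum, powerFunction]
  refine Finset.prod_congr rfl fun r _ => ?_
  rw [minor_gram hX hT hs, Complex.cpow_def_of_ne_zero (by simp), ← Complex.ofReal_log
    (Real.exp_pos _).le, Real.log_exp]
  push_cast
  rw [Finset.mul_sum]

/-- For injective X the minors of the Gram matrix are positive, hence away from the branch cut of
the complex power. -/
theorem continuousAt_powerFunction_gram {q : ℕ} {X : Matrix (Fin q) (Fin q) F}
    (hX : ∀ x : Fin q → F, X *ᵥ x = 0 → x = 0) (mu : Fin q → ℂ) :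
    ContinuousAt (powerFunction mu) (Xᴴ * X) := by
  obtain ⟨k, T, s, hT, hs, hk⟩ := exists_unitary_mul_positive_triangular hX
  have hs' : ∀ i, ‖T i i‖ = Real.exp (s i) := fun i => by
    rw [hs, norm_algebraMap', Real.norm_of_nonneg (Real.exp_pos _).le]
  unfold powerFunction
  refine tendsto_finsetProd _ fun r _ => ?_
  have h1 : ContinuousAt (minor r) (Xᴴ * X) := by
    have h2 : (Xᴴ * X).submatrix (Subtype.val : {i : Fin q // i ≤ r} → Fin q)
        (Subtype.val : {i : Fin q // i ≤ r} → Fin q) =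
        (T.submatrix (Subtype.val : {i : Fin q // i ≤ r} → Fin q) Subtype.val)ᴴ *
      T.submatrix (Subtype.val : {i : Fin q // i ≤ r} → Fin q) Subtype.val := by
      rw [hk, gram_unitary_mul, gram_submatrix_of_triangular hT]
    have h3 := ScalarsLaws.continuousAt_det _ (submatrix_blockTriangular hT r) (fun i => by
      rw [submatrix_apply, ← norm_ne_zero_iff, hs']; positivity)
    rw [← h2] at h3
    exact ContinuousAt.comp (f := fun A : Matrix (Fin q) (Fin q) F => A.submatrix
      (Subtype.val : {i : Fin q // i ≤ r} → Fin q) Subtype.val) h3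
      (Continuous.continuousAt (by fun_prop))
  refine ContinuousAt.cpow h1 continuousAt_const ?_
  rw [minor_gram hk hT hs']
  exact Complex.ofReal_mem_slitPlane.mpr (Real.exp_pos _)

theorem measurable_powerFunction {q : ℕ} (mu : Fin q → ℂ) :
    Measurable (powerFunction mu : Matrix (Fin q) (Fin q) F → ℂ) := by
  unfold powerFunction
  refine Finset.measurable_prod _ fun r _ => ?_
  refine Measurable.pow_const ?_ _
  have : ProperSpace F := FiniteDimensional.proper_real F
  exact ScalarsLaws.measurable_det.comp (Continuous.measurable (by fun_prop))

end PowerFunctions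

/-! ### Matrix exponentials -/

section Exponential

variable {F : Type} [NormedDivisionRing F] [NormedAlgebra ℝ F] [StarRing F] [CStarRing F]
  [FiniteDimensional ℝ F] [MeasureSpace F] [BorelSpace F] [Scalars F]

section

variable {n : Type} [Fintype n] [DecidableEq n]

attribute [local instance] Matrix.linftyOpNormedRing Matrix.linftyOpNormedAlgebra

theorem hasSum_matrix_exp (X : Matrix n n F) :
    HasSum (fun k : ℕ => ((k.factorial : ℝ)⁻¹) • X ^ k) (NormedSpace.exp X) := by
  have : CompleteSpace F := FiniteDimensional.complete ℝ F
  exact NormedSpace.exp_series_hasSum_exp' (𝕂 := ℝ) X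

theorem matrix_exp_add {X Y : Matrix n n F} (h : Commute X Y) :
    NormedSpace.exp (X + Y) = NormedSpace.exp X * NormedSpace.exp Y := by
  have : CompleteSpace F := FiniteDimensional.complete ℝ F
  let : NormedAlgebra ℚ F := .restrictScalars ℚ ℝ F
  exact Matrix.exp_add_of_commute X Y h

end

variable {n : Type} [Fintype n] [DecidableEq n]

theorem matrix_exp_neg_mul (X : Matrix n n F) :
    NormedSpace.exp (-X) * NormedSpace.exp X = 1 := by
  rw [← matrix_exp_add ((Commute.refl X).neg_left), neg_add_cancel, NormedSpace.exp_zero]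

/-- Applied termwise to the exponential series. Rectangular M is allowed so that exponentials can be
evaluated on the columns of E₊ and E₋. -/
theorem matrix_exp_intertwine {m : Type} [Fintype m] [DecidableEq m] {X : Matrix n n F}
    {Y : Matrix m m F} {M : Matrix n m F} (h : X * M = M * Y) :
    NormedSpace.exp X * M = M * NormedSpace.exp Y := by
  have hp : ∀ k : ℕ, X ^ k * M = M * Y ^ k := by
    intro k
    induction k with
    | zero => simp
    | succ k ih =>
      rw [pow_succ, Matrix.mul_assoc, h, ← Matrix.mul_assoc, ih, Matrix.mul_assoc, pow_succ]
  have h1 := (hasSum_matrix_exp X).map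
    (⟨⟨fun A => A * M, Matrix.zero_mul M⟩, fun A B => Matrix.add_mul A B M⟩ :
      Matrix n n F →+ Matrix n m F) (continuous_id.matrix_mul continuous_const)
  have h2 := (hasSum_matrix_exp Y).map
    (⟨⟨fun A => M * A, Matrix.mul_zero M⟩, fun A B => Matrix.mul_add M A B⟩ :
      Matrix m m F →+ Matrix n m F) (continuous_const.matrix_mul continuous_id)
  have e : (fun k : ℕ => ((k.factorial : ℝ)⁻¹ • X ^ k) * M) =
      fun k : ℕ => M * ((k.factorial : ℝ)⁻¹ • Y ^ k) := by
    ext1 k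
    rw [Matrix.smul_mul, Matrix.mul_smul, hp]
  have h1' : HasSum (fun k : ℕ => ((k.factorial : ℝ)⁻¹ • X ^ k) * M) (NormedSpace.exp X * M) := h1
  rw [e] at h1'
  exact h1'.unique h2

/-- The diagonal matrix with real entries `t`. -/
def realDiag (F : Type) [NormedDivisionRing F] [NormedAlgebra ℝ F] {q : ℕ} (t : Fin q → ℝ) :
    Matrix (Fin q) (Fin q) F :=
  diagonal fun i => algebraMap ℝ F (t i)

theorem realDiag_mul_apply {q : ℕ} {l : Type} (t : Fin q → ℝ) (A : Matrix (Fin q) l F) (i : Fin q)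
    (j : l) : (realDiag F t * A) i j = t i • A i j := by
  rw [realDiag, diagonal_mul, Algebra.smul_def]

theorem mul_realDiag_apply {q : ℕ} {l : Type} (t : Fin q → ℝ) (A : Matrix l (Fin q) F) (i : l)
    (j : Fin q) : (A * realDiag F t) i j = t j • A i j := by
  rw [realDiag, mul_diagonal, Algebra.smul_def, Algebra.commutes]

theorem realDiag_conjTranspose {q : ℕ} (t : Fin q → ℝ) : (realDiag F t)ᴴ = realDiag F t := by
  rw [realDiag, diagonal_conjTranspose]
  congr 1
  ext i
  exact star_algebraMap_real _

theorem realDiag_mul_realDiag {q : ℕ} (s t : Fin q → ℝ) :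
    realDiag F s * realDiag F t = realDiag F (s * t) := by
  simp [realDiag, diagonal_mul_diagonal]

theorem realDiag_one {q : ℕ} : realDiag F (1 : Fin q → ℝ) = 1 := by
  simp [realDiag]

theorem realDiag_add {q : ℕ} (s t : Fin q → ℝ) :
    realDiag F s + realDiag F t = realDiag F (s + t) := by
  simp [realDiag]

theorem realDiag_neg {q : ℕ} (t : Fin q → ℝ) : realDiag F (-t) = -realDiag F t := by
  simp [realDiag, diagonal_neg]

theorem exp_realDiag {q : ℕ} (t : Fin q → ℝ) :
    NormedSpace.exp (realDiag F t) = realDiag F fun i => Real.exp (t i) := by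
  have : CompleteSpace F := FiniteDimensional.complete ℝ F
  let : NormedAlgebra ℚ F := .restrictScalars ℚ ℝ F
  rw [realDiag, realDiag, Matrix.exp_diagonal]
  congr 1
  ext i
  rw [Pi.coe_exp, Real.exp_eq_exp_ℝ, NormedSpace.algebraMap_exp_comm (𝕂 := ℝ)]

/-- Strictly upper triangular matrices. -/
def IsStrictUpper {q : ℕ} (A : Matrix (Fin q) (Fin q) F) : Prop := ∀ i j, j ≤ i → A i j = 0

theorem IsStrictUpper.pow_succ {q : ℕ} {A : Matrix (Fin q) (Fin q) F} (hA : IsStrictUpper A)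
    (k : ℕ) : IsStrictUpper (A ^ (k + 1)) := by
  induction k with
  | zero => simpa using hA
  | succ k ih =>
    intro i j hij
    rw [_root_.pow_succ, Matrix.mul_apply]
    refine Finset.sum_eq_zero fun l _ => ?_
    rcases le_or_gt l i with h | h
    · rw [ih i l h, zero_mul]
    · rw [hA l j (hij.trans h.le), mul_zero]

theorem IsStrictUpper.exp_apply {q : ℕ} {A : Matrix (Fin q) (Fin q) F} (hA : IsStrictUpper A)
    {i j : Fin q} (hij : j ≤ i) : NormedSpace.exp A i j = (1 : Matrix (Fin q) (Fin q) F) i j := by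
  have h1 : HasSum (fun k : ℕ => (((k.factorial : ℝ)⁻¹) • A ^ k) i j) (NormedSpace.exp A i j) :=
    (hasSum_matrix_exp A).map
      (⟨⟨fun B => B i j, rfl⟩, fun _ _ => rfl⟩ : Matrix (Fin q) (Fin q) F →+ F)
      (continuous_id.matrix_elem i j)
  refine h1.unique ?_
  convert hasSum_single 0 (f := fun k : ℕ => (((k.factorial : ℝ)⁻¹) • A ^ k) i j) ?_ using 1
  · simp
  · intro k hk
    obtain ⟨l, rfl⟩ := Nat.exists_eq_succ_of_ne_zero hk
    rw [Matrix.smul_apply, hA.pow_succ l i j hij, smul_zero]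

end Exponential

/-! ### The elements `a_t` and the weight vectors -/

section Weights

variable {F : Type} [NormedDivisionRing F] [NormedAlgebra ℝ F] [StarRing F] [CStarRing F]
  [FiniteDimensional ℝ F] [MeasureSpace F] [BorelSpace F] [Scalars F]

/-- The weight vectors for `t_1, …, t_q`, as columns. -/
def ePlus (F : Type) [NormedDivisionRing F] (p q : ℕ) : Matrix (Fin q ⊕ Fin p) (Fin q) F :=
  fromRows 1 (inclusion F p q)

/-- The weight vectors for `-t_1, …, -t_q`, as columns. -/
def eMinus (F : Type) [NormedDivisionRing F] (p q : ℕ) : Matrix (Fin q ⊕ Fin p) (Fin q) F :=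
  fromRows 1 (-inclusion F p q)

/-- The matrix `diag(1, …, 1, -1, …, -1)` of the invariant hermitian form. -/
def formJ (F : Type) [NormedDivisionRing F] (p q : ℕ) : BigMat F p q := fromBlocks 1 0 0 (-1)

/-- The block diagonal matrix with unitary blocks `u`, `v`. -/
def blockU {p q : ℕ} (u : U F q) (v : U F p) : BigMat F p q :=
  fromBlocks (u : Matrix (Fin q) (Fin q) F) 0 0 (v : Matrix (Fin p) (Fin p) F)

/-- The upper left `q × q` block of a `p × p` matrix. -/
def corner (q : ℕ) {p : ℕ} (v : Matrix (Fin p) (Fin p) F) : Matrix (Fin q) (Fin q) F :=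
  inclusion F q p * v * inclusion F p q

theorem fromRows_conjTranspose {m n l : Type} (A : Matrix m l F) (B : Matrix n l F) :
    (fromRows A B)ᴴ = fromCols Aᴴ Bᴴ := by
  ext i (j | j) <;> rfl

variable {p q : ℕ}

theorem rectDiag_eq (t : Fin q → ℝ) : rectDiag F p t = realDiag F t * inclusion F q p := by
  ext i j
  rw [realDiag_mul_apply, inclusion_apply, rectDiag, of_apply]
  split
  · rw [Algebra.smul_def, mul_one]
  · rw [smul_zero]

theorem formJ_mul_formJ : formJ F p q * formJ F p q = 1 := by
  simp [formJ, fromBlocks_multiply]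

theorem formJ_conjTranspose : (formJ F p q)ᴴ = formJ F p q := by
  simp [formJ, fromBlocks_conjTranspose]

theorem formJ_mul_ePlus : formJ F p q * ePlus F p q = eMinus F p q := by
  simp [formJ, ePlus, eMinus, fromBlocks_mul_fromRows]

theorem formJ_mul_eMinus : formJ F p q * eMinus F p q = ePlus F p q := by
  rw [← formJ_mul_ePlus, ← Matrix.mul_assoc, formJ_mul_formJ, Matrix.one_mul]

theorem Hmat_conjTranspose (t : Fin q → ℝ) : (Hmat F p t)ᴴ = Hmat F p t := by
  simp [Hmat, fromBlocks_conjTranspose]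

theorem Hmat_mul_formJ (t : Fin q → ℝ) : Hmat F p t * formJ F p q = formJ F p q * -Hmat F p t := by
  simp [Hmat, formJ, fromBlocks_multiply, fromBlocks_neg]

theorem Hmat_mul_ePlus (hqp : q ≤ p) (t : Fin q → ℝ) :
    Hmat F p t * ePlus F p q = ePlus F p q * realDiag F t := by
  have h := inclusion_gram (F := F) hqp
  rw [inclusion_conjTranspose] at h
  rw [Hmat, ePlus, fromBlocks_mul_fromRows, fromRows_mul, rectDiag_eq, conjTranspose_mul,
    inclusion_conjTranspose, realDiag_conjTranspose, Matrix.mul_assoc, h]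
  simp

theorem Hmat_mul_eMinus (hqp : q ≤ p) (t : Fin q → ℝ) :
    Hmat F p t * eMinus F p q = eMinus F p q * realDiag F (-t) := by
  rw [← formJ_mul_ePlus, ← Matrix.mul_assoc, Hmat_mul_formJ, Matrix.mul_neg, Matrix.neg_mul,
    Matrix.mul_assoc, Hmat_mul_ePlus hqp, realDiag_neg, Matrix.mul_neg, Matrix.mul_assoc]

theorem aMat_conjTranspose (t : Fin q → ℝ) : (aMat F p t)ᴴ = aMat F p t := by
  rw [aMat, ← Matrix.exp_conjTranspose, Hmat_conjTranspose]

theorem aMat_mul_ePlus (hqp : q ≤ p) (t : Fin q → ℝ) :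
    aMat F p t * ePlus F p q = ePlus F p q * realDiag F fun i => Real.exp (t i) := by
  rw [aMat, matrix_exp_intertwine (Hmat_mul_ePlus hqp t), exp_realDiag]

theorem aMat_mul_eMinus (hqp : q ≤ p) (t : Fin q → ℝ) :
    aMat F p t * eMinus F p q = eMinus F p q * realDiag F fun i => Real.exp (-t i) := by
  rw [aMat, matrix_exp_intertwine (Hmat_mul_eMinus hqp t), exp_realDiag]
  rfl

theorem aMat_neg_mul (t : Fin q → ℝ) : aMat F p (-t) * aMat F p t = 1 := by
  have : Hmat F p (-t) = -Hmat F p t := by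
    rw [Hmat, Hmat, rectDiag_eq, rectDiag_eq, realDiag_neg, fromBlocks_neg]
    simp
  rw [aMat, aMat, this, matrix_exp_neg_mul]

theorem aMat_gram (t : Fin q → ℝ) : (aMat F p t)ᴴ * formJ F p q * aMat F p t = formJ F p q := by
  rw [aMat_conjTranspose, aMat, matrix_exp_intertwine (Hmat_mul_formJ t), Matrix.mul_assoc,
    matrix_exp_neg_mul, Matrix.mul_one]

theorem blockU_gram (u : U F q) (v : U F p) : (blockU u v)ᴴ * blockU u v = 1 := by
  simp [blockU, fromBlocks_conjTranspose, fromBlocks_multiply, unitary_conjTranspose_mul]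

theorem blockU_form (u : U F q) (v : U F p) :
    (blockU u v)ᴴ * formJ F p q * blockU u v = formJ F p q := by
  simp [blockU, formJ, fromBlocks_conjTranspose, fromBlocks_multiply, unitary_conjTranspose_mul]

theorem ePlus_gram (hqp : q ≤ p) : (ePlus F p q)ᴴ * ePlus F p q = (2 : ℝ) • 1 := by
  rw [ePlus, fromRows_conjTranspose, fromCols_mul_fromRows, inclusion_gram hqp, two_smul]
  simp

theorem ePlus_form (hqp : q ≤ p) : (ePlus F p q)ᴴ * eMinus F p q = 0 := by
  rw [ePlus, eMinus, fromRows_conjTranspose, fromCols_mul_fromRows, Matrix.mul_neg,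
    inclusion_gram hqp]
  simp

/-- The first `q` rows of `a_t k (e_1^+, …, e_q^+)` for `k = (u, v)`. -/
def topRows (t : Fin q → ℝ) (u : Matrix (Fin q) (Fin q) F) (v : Matrix (Fin p) (Fin p) F) :
    Matrix (Fin q) (Fin q) F :=
  realDiag F (fun i => Real.cosh (t i)) * u + realDiag F (fun i => Real.sinh (t i)) * corner q v

/-- The upper rows are half the sum of the pairings with E₊ and E₋, on which a_t acts by e^{t} and
e^{-t}. These pair with k E₊ to u + v₁₁ and u - v₁₁, and the halves combine to cosh and sinh. -/
theorem toRows₁_aMat_mul (hqp : q ≤ p) (t : Fin q → ℝ) (u : U F q) (v : U F p) :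
    (aMat F p t * blockU u v * ePlus F p q).toRows₁ =
      topRows t (u : Matrix (Fin q) (Fin q) F) (v : Matrix (Fin p) (Fin p) F) := by
  have h1 : ∀ M : Matrix (Fin q ⊕ Fin p) (Fin q) F, M.toRows₁ =
      (1 / 2 : ℝ) • ((ePlus F p q)ᴴ * M + (eMinus F p q)ᴴ * M) := by
    intro M
    obtain ⟨A, B, rfl⟩ : ∃ A B, M = fromRows A B := ⟨_, _, (fromRows_toRows M).symm⟩
    rw [toRows₁_fromRows, ePlus, eMinus, fromRows_conjTranspose, fromRows_conjTranspose,
      fromCols_mul_fromRows, fromCols_mul_fromRows]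
    simp only [conjTranspose_one, Matrix.one_mul, conjTranspose_neg, Matrix.neg_mul]
    module
  have h2 : (ePlus F p q)ᴴ * aMat F p t = realDiag F (fun i => Real.exp (t i)) * (ePlus F p q)ᴴ := by
    have := congrArg conjTranspose (aMat_mul_ePlus (F := F) hqp t)
    rwa [conjTranspose_mul, conjTranspose_mul, aMat_conjTranspose, realDiag_conjTranspose] at this
  have h3 : (eMinus F p q)ᴴ * aMat F p t =
      realDiag F (fun i => Real.exp (-t i)) * (eMinus F p q)ᴴ := by
    have := congrArg conjTranspose (aMat_mul_eMinus (F := F) hqp t)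
    rwa [conjTranspose_mul, conjTranspose_mul, aMat_conjTranspose, realDiag_conjTranspose] at this
  have h4 : (ePlus F p q)ᴴ * (blockU u v * ePlus F p q) =
      (u : Matrix (Fin q) (Fin q) F) + corner q (v : Matrix (Fin p) (Fin p) F) := by
    simp [ePlus, blockU, fromBlocks_mul_fromRows, fromRows_conjTranspose, fromCols_mul_fromRows,
      corner, inclusion_conjTranspose, Matrix.mul_assoc]
  have h5 : (eMinus F p q)ᴴ * (blockU u v * ePlus F p q) =
      (u : Matrix (Fin q) (Fin q) F) - corner q (v : Matrix (Fin p) (Fin p) F) := by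
    simp [ePlus, eMinus, blockU, fromBlocks_mul_fromRows, fromRows_conjTranspose,
      fromCols_mul_fromRows, corner, inclusion_conjTranspose, Matrix.mul_assoc, sub_eq_add_neg]
  rw [Matrix.mul_assoc, h1, ← Matrix.mul_assoc, h2, ← Matrix.mul_assoc (eMinus F p q)ᴴ, h3,
    Matrix.mul_assoc, Matrix.mul_assoc, h4, h5, topRows]
  ext i j
  simp only [Matrix.smul_apply, Matrix.add_apply, realDiag_mul_apply, Matrix.sub_apply, Real.cosh_eq, Real.sinh_eq]
  module

/-- The columns of E₊ span a J-isotropic space, and g preserves J = diag(1, -1). -/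
theorem toRows_gram_eq (hqp : q ≤ p) {g : BigMat F p q}
    (hg : gᴴ * formJ F p q * g = formJ F p q) :
    ((g * ePlus F p q).toRows₁)ᴴ * (g * ePlus F p q).toRows₁ =
      ((g * ePlus F p q).toRows₂)ᴴ * (g * ePlus F p q).toRows₂ := by
  have h : (g * ePlus F p q)ᴴ * (formJ F p q * (g * ePlus F p q)) = 0 := by
    calc _ = (ePlus F p q)ᴴ * ((gᴴ * formJ F p q * g) * ePlus F p q) := by
          rw [conjTranspose_mul]; simp only [Matrix.mul_assoc]
      _ = 0 := by rw [hg, formJ_mul_ePlus, ePlus_form hqp]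
  set M := g * ePlus F p q
  obtain ⟨A, B, hM⟩ : ∃ A B, M = fromRows A B := ⟨_, _, (fromRows_toRows M).symm⟩
  rw [hM, toRows₁_fromRows, toRows₂_fromRows]
  rw [hM, formJ, fromBlocks_mul_fromRows, fromRows_conjTranspose, fromCols_mul_fromRows] at h
  simpa [sub_eq_zero, ← sub_eq_add_neg] using h

/-- By isotropy a vector killed by the upper rows is killed by all of g E₊, which has trivial
kernel. -/
theorem toRows₁_injective (hqp : q ≤ p) {g : BigMat F p q}
    (hg : gᴴ * formJ F p q * g = formJ F p q) (x : Fin q → F)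
    (hx : (g * ePlus F p q).toRows₁ *ᵥ x = 0) : x = 0 := by
  have h1 := sum_norm_sq_mulVec_of_gram_eq (toRows_gram_eq hqp hg) x
  rw [hx] at h1
  have h2 : (g * ePlus F p q).toRows₂ *ᵥ x = 0 := by
    rw [← sum_norm_sq_eq_zero, ← h1]
    simp
  have h3 : (g * ePlus F p q) *ᵥ x = 0 := by
    rw [← fromRows_toRows (g * ePlus F p q), fromRows_mulVec, hx, h2]
    ext (i | i) <;> rfl
  -- Since J g^* J inverts g, the matrix E₊^* J g^* J is a left inverse of g E₊ up to the factor 2.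
  have h4 : ((ePlus F p q)ᴴ * (formJ F p q * gᴴ * formJ F p q)) *ᵥ ((g * ePlus F p q) *ᵥ x) = 0 := by
    rw [h3, mulVec_zero]
  have h5 : (ePlus F p q)ᴴ * (formJ F p q * gᴴ * formJ F p q) * (g * ePlus F p q) =
      (2 : ℝ) • 1 := by
    rw [← ePlus_gram hqp]
    calc _ = (ePlus F p q)ᴴ * (formJ F p q * (gᴴ * formJ F p q * g) * ePlus F p q) := by
          simp only [Matrix.mul_assoc]
      _ = _ := by rw [hg, formJ_mul_formJ, Matrix.one_mul]
  rw [mulVec_mulVec, h5, smul_mulVec, one_mulVec] at h4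
  simpa using h4

theorem aMat_blockU_form (t : Fin q → ℝ) (u : U F q) (v : U F p) :
    (aMat F p t * blockU u v)ᴴ * formJ F p q * (aMat F p t * blockU u v) = formJ F p q := by
  calc _ = (blockU u v)ᴴ * ((aMat F p t)ᴴ * formJ F p q * aMat F p t) * blockU u v := by
        rw [conjTranspose_mul]; simp only [Matrix.mul_assoc]
    _ = _ := by rw [aMat_gram, blockU_form]

theorem topRows_injective (hqp : q ≤ p) (t : Fin q → ℝ) (u : U F q) (v : U F p) (x : Fin q → F)
    (hx : topRows t (u : Matrix (Fin q) (Fin q) F) (v : Matrix (Fin p) (Fin p) F) *ᵥ x = 0) :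
    x = 0 := by
  rw [← toRows₁_aMat_mul hqp] at hx
  exact toRows₁_injective hqp (aMat_blockU_form t u v) x hx

/-! ### The action of `N` on the weight vectors -/

/-- The test point t = (q, q - 1, …, 1) lies in the open positive chamber; with indices from 0 its
entries are q - i. -/
theorem positiveRoots_pos {α : Fin q → ℝ} (hα : α ∈ positiveRoots q) :
    0 < ∑ i, α i * ((q : ℝ) - (i : ℕ)) := by
  have hpos : ∀ i : Fin q, (0 : ℝ) < (q : ℝ) - (i : ℕ) := fun i => by
    have : ((i : ℕ) : ℝ) < q := by exact_mod_cast i.2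
    linarith
  rcases hα with ⟨i, rfl⟩ | ⟨i, rfl⟩ | ⟨i, j, hij, rfl | rfl⟩
  · simp [Pi.single_apply, ite_mul]
  · simp [Pi.single_apply, ite_mul]
  · have : ((i : ℕ) : ℝ) < (j : ℕ) := by exact_mod_cast hij
    simp only [Pi.sub_apply, sub_mul, Finset.sum_sub_distrib, Pi.single_apply, ite_mul, one_mul,
      zero_mul, Finset.sum_ite_eq', Finset.mem_univ, if_true]
    linarith
  · simp only [Pi.add_apply, add_mul, Finset.sum_add_distrib, Pi.single_apply, ite_mul, one_mul,
      zero_mul, Finset.sum_ite_eq', Finset.mem_univ, if_true]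
    exact add_pos (hpos i) (hpos j)

/-- A single regular t suffices. A root vector X sends the eigenvector of H_t for t_j to one for t_j
+ c with c > 0. Positive eigenvalues occur only in the span of E₊, and t_i = t_j + c forces i < j
because t is decreasing. -/
theorem rootSpace_mul_ePlus (hqp : q ≤ p) {α : Fin q → ℝ} (hα : α ∈ positiveRoots q)
    {X : BigMat F p q} (hX : X ∈ rootSpace F p q α) :
    ∃ τ : Matrix (Fin q) (Fin q) F, IsStrictUpper τ ∧ X * ePlus F p q = ePlus F p q * τ := by
  set t : Fin q → ℝ := fun i => (q : ℝ) - (i : ℕ) with ht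
  set c := ∑ i, α i * t i with hc
  have hcpos : 0 < c := positiveRoots_pos hα
  have htpos : ∀ i, 0 < t i := fun i => by
    have : ((i : ℕ) : ℝ) < q := by exact_mod_cast i.2
    simp only [ht]
    linarith
  have h1 : Hmat F p t * (X * ePlus F p q) =
      X * ePlus F p q * realDiag F t + c • (X * ePlus F p q) := by
    rw [← Matrix.mul_assoc, ← sub_add_cancel (Hmat F p t * X) (X * Hmat F p t), hX.2 t,
      Matrix.add_mul, Matrix.mul_assoc X, Hmat_mul_ePlus hqp, Matrix.smul_mul, add_comm,
      Matrix.mul_assoc]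
  obtain ⟨A, B, hM⟩ : ∃ A B, X * ePlus F p q = fromRows A B :=
    ⟨_, _, (fromRows_toRows (X * ePlus F p q)).symm⟩
  have hAB : ∀ i j, t i • (inclusion F q p * B) i j = (t j + c) • A i j := by
    intro i j
    have := congrFun (congrFun h1 (Sum.inl i)) j
    rw [hM, Hmat, fromBlocks_mul_fromRows, rectDiag_eq, Matrix.zero_mul, zero_add,
      Matrix.mul_assoc, fromRows_apply_inl, realDiag_mul_apply, Matrix.add_apply, mul_realDiag_apply,
      Matrix.smul_apply, fromRows_apply_inl, ← add_smul] at this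
    exact this
  have hBA : ∀ i j, (inclusion F p q * (realDiag F t * A)) i j = (t j + c) • B i j := by
    intro i j
    have := congrFun (congrFun h1 (Sum.inr i)) j
    rw [hM, Hmat, fromBlocks_mul_fromRows, rectDiag_eq, Matrix.zero_mul B, add_zero,
      conjTranspose_mul, realDiag_conjTranspose, inclusion_conjTranspose,
      Matrix.mul_assoc, fromRows_apply_inr, Matrix.add_apply, mul_realDiag_apply,
      Matrix.smul_apply, fromRows_apply_inr, ← add_smul] at this
    rw [← Matrix.mul_assoc]
    exact this
  have htc : ∀ j, 0 < t j + c := fun j => add_pos (htpos j) hcpos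
  -- The rows of index at least q carry weight zero, but the eigenvalue t_j + c is positive.
  have hB0 : ∀ (i : Fin p) (j : Fin q), q ≤ (i : ℕ) → B i j = 0 := by
    intro i j hi
    have h := hBA i j
    have h0 : (inclusion F p q * (realDiag F t * A)) i j = 0 := by
      rw [Matrix.mul_apply]
      refine Finset.sum_eq_zero fun l _ => ?_
      have : (i : ℕ) ≠ l := by omega
      simp [inclusion_apply, this]
    rw [h0] at h
    exact (smul_eq_zero.mp h.symm).resolve_left (htc j).ne'
  have hBA' : ∀ i j, t i • A i j = (t j + c) • (inclusion F q p * B) i j := by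
    intro i j
    have h := hBA (Fin.castLE hqp i) j
    rw [← inclusion_mul_apply hqp (inclusion F p q * (realDiag F t * A)), ← Matrix.mul_assoc] at h
    have hg := inclusion_gram (F := F) hqp
    rw [inclusion_conjTranspose] at hg
    rw [hg, Matrix.one_mul, realDiag_mul_apply, ← inclusion_mul_apply hqp B] at h
    exact h
  -- The two block equations exclude a component along E₋, whose eigenvalue would be -t_i: their
  -- difference carries the factor t_i + t_j + c > 0.
  have hEq : inclusion F q p * B = A := by
    ext i j
    have h : (t i + (t j + c)) • ((inclusion F q p * B) i j - A i j) = 0 := by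
      rw [smul_sub, add_smul, add_smul (t i), hAB, hBA']
      abel
    have hne : t i + (t j + c) ≠ 0 := (add_pos (htpos i) (htc j)).ne'
    exact sub_eq_zero.mp ((smul_eq_zero.mp h).resolve_left hne)
  refine ⟨A, fun i j hij => ?_, ?_⟩
  · have h := hAB i j
    rw [hEq] at h
    have h' : (t j + c - t i) • A i j = 0 := by rw [sub_smul, h, sub_self]
    have hne : t j + c - t i ≠ 0 := by
      have : ((j : ℕ) : ℝ) ≤ (i : ℕ) := by exact_mod_cast hij
      simp only [ht]
      linarith
    exact (smul_eq_zero.mp h').resolve_left hne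
  · rw [hM, ePlus, fromRows_mul, Matrix.one_mul]
    congr 1
    rw [← hEq, inclusion_mul_of_rows_zero hqp B hB0]

theorem groupN_mul_ePlus (hqp : q ≤ p) {n : BigMat F p q} (hn : n ∈ groupN F p q) :
    ∃ T : Matrix (Fin q) (Fin q) F, T.BlockTriangular id ∧ (∀ i, T i i = 1) ∧
      n * ePlus F p q = ePlus F p q * T := by
  obtain ⟨X, hX, rfl⟩ := hn
  obtain ⟨τ, hτ, h⟩ : ∃ τ : Matrix (Fin q) (Fin q) F, IsStrictUpper τ ∧ X * ePlus F p q = ePlus F p q * τ := by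
    let S : Submodule ℝ (BigMat F p q) :=
      { carrier := {X | ∃ τ : Matrix (Fin q) (Fin q) F, IsStrictUpper τ ∧ X * ePlus F p q = ePlus F p q * τ}
        zero_mem' := ⟨0, fun _ _ _ => rfl, by simp⟩
        add_mem' := by
          rintro X Y ⟨σ, h1, h2⟩ ⟨τ, h3, h4⟩
          refine ⟨σ + τ, fun i j hij => ?_, ?_⟩
          · rw [Matrix.add_apply, h1 i j hij, h3 i j hij, add_zero]
          · rw [Matrix.add_mul, Matrix.mul_add, h2, h4]
        smul_mem' := by
          rintro c X ⟨σ, h1, h2⟩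
          refine ⟨c • σ, fun i j hij => ?_, ?_⟩
          · rw [Matrix.smul_apply, h1 i j hij, smul_zero]
          · rw [Matrix.smul_mul, h2, Matrix.mul_smul] }
    have : (⨆ α ∈ positiveRoots q, rootSpace F p q α) ≤ S :=
      iSup₂_le fun α hα X hX => rootSpace_mul_ePlus hqp hα hX
    exact this hX
  refine ⟨NormedSpace.exp τ, fun i j hij => ?_, fun i => ?_, matrix_exp_intertwine h⟩
  · have hij' : j < i := hij
    rw [hτ.exp_apply hij'.le, Matrix.one_apply_ne hij'.ne']
  · rw [hτ.exp_apply le_rfl, Matrix.one_apply_eq]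

theorem blockK_eq (k : Scalars.K (F := F) p q) : blockK F k = blockU k.1.1 k.1.2 := rfl

theorem topRows_eq_of_isAbelianPart (hqp : q ≤ p) {t s : Fin q → ℝ} {u : U F q} {v : U F p}
    (h : IsAbelianPart F (aMat F p t * blockU u v) s) :
    ∃ (k : U F q) (T : Matrix (Fin q) (Fin q) F), T.BlockTriangular id ∧
      (∀ i, ‖T i i‖ = Real.exp (s i)) ∧
      topRows t (u : Matrix (Fin q) (Fin q) F) (v : Matrix (Fin p) (Fin p) F) =
        (k : Matrix (Fin q) (Fin q) F) * T := by
  obtain ⟨k, n, hn, h⟩ := h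
  obtain ⟨T, hT, hT1, hnT⟩ := groupN_mul_ePlus hqp hn
  refine ⟨k.1.1, realDiag F (fun i => Real.exp (s i)) * T, fun i j hij => ?_, fun i => ?_, ?_⟩
  · rw [realDiag_mul_apply, hT hij, smul_zero]
  · rw [realDiag_mul_apply, hT1, norm_smul, norm_one, mul_one, Real.norm_of_nonneg
      (Real.exp_pos _).le]
  · rw [← toRows₁_aMat_mul hqp, h, Matrix.mul_assoc, hnT, Matrix.mul_assoc (blockK F k),
      ← Matrix.mul_assoc (aMat F p s), aMat_mul_ePlus hqp, Matrix.mul_assoc (ePlus F p q), blockK_eq,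
      blockU, ePlus, fromRows_mul, fromBlocks_mul_fromRows, toRows₁_fromRows]
    simp

variable [ScalarsLaws F]

/-- The leading minors of the Gram matrix of the upper rows depend only on a_t k and determine all
partial sums of s. -/
theorem isAbelianPart_unique (hqp : q ≤ p) {t s s' : Fin q → ℝ} {u : U F q} {v : U F p}
    (h : IsAbelianPart F (aMat F p t * blockU u v) s)
    (h' : IsAbelianPart F (aMat F p t * blockU u v) s') : s = s' := by
  obtain ⟨k, T, hT, hs, hk⟩ := topRows_eq_of_isAbelianPart hqp h
  obtain ⟨k', T', hT', hs', hk'⟩ := topRows_eq_of_isAbelianPart hqp h'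
  have hsum : ∀ r : Fin q, (∑ i : {i : Fin q // i ≤ r}, s i) = ∑ i : {i : Fin q // i ≤ r}, s' i := by
    intro r
    have h1 := (minor_gram hk hT hs r).symm.trans (minor_gram hk' hT' hs' r)
    have h2 := Real.exp_injective (Complex.ofReal_injective h1)
    linarith
  ext i
  -- Summation by parts against a unit vector recovers one coordinate from the partial sums.
  have h1 := sum_by_parts (fun j => (s j : ℂ)) (Pi.single i 1)
  have h2 := sum_by_parts (fun j => (s' j : ℂ)) (Pi.single i 1)
  have h3 : ∀ r : Fin q, (∑ i : {i : Fin q // i ≤ r}, (s i : ℂ)) =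
      ∑ i : {i : Fin q // i ≤ r}, (s' i : ℂ) := by
    intro r
    exact_mod_cast congrArg (fun x : ℝ => (x : ℂ)) (hsum r)
  simp only [h3] at h1
  rw [h1] at h2
  simpa [Pi.single_apply] using h2

/-- The abelian part enters only through the power function. Existence is assumed because
`abelianPart` is a choice that has its defining property only if some s exists. -/
theorem harishChandraIntegrand_eq (hqp : q ≤ p) (lam : Fin q → ℂ) (t : Fin q → ℝ)
    (k : Scalars.K (F := F) p q)
    (h : ∃ s, IsAbelianPart F (aMat F p t * blockK F k) s) :
    harishChandraIntegrand F lam (aMat F p t) k =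
      powerFunction (fun i => spectral F p lam i / 2)
        ((topRows t (k.1.1 : Matrix (Fin q) (Fin q) F) (k.1.2 : Matrix (Fin p) (Fin p) F))ᴴ *
          topRows t (k.1.1 : Matrix (Fin q) (Fin q) F) (k.1.2 : Matrix (Fin p) (Fin p) F)) := by
  have hs := Classical.epsilon_spec h
  obtain ⟨k', T, hT, hs, hk⟩ := topRows_eq_of_isAbelianPart hqp hs
  rw [powerFunction_gram hk hT hs, harishChandraIntegrand]
  congr 1
  refine Finset.sum_congr rfl fun i _ => ?_
  rw [abelianPart]
  ring

end Weights

/-! ### Weight projections -/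

section Projections

variable {F : Type} [NormedDivisionRing F] [NormedAlgebra ℝ F] [StarRing F] [CStarRing F]
  [FiniteDimensional ℝ F] [MeasureSpace F] [BorelSpace F] [Scalars F]

/-- The weights of `𝔞` on `F^(q+p)`: `f_i`, `-f_i` and `0`. -/
abbrev Weight (q : ℕ) := Fin q ⊕ (Fin q ⊕ Unit)

/-- A weight as a vector of coefficients. -/
def Weight.coeff {q : ℕ} : Weight q → Fin q → ℝ
  | Sum.inl i => Pi.single i 1
  | Sum.inr (Sum.inl i) => -Pi.single i 1
  | Sum.inr (Sum.inr _) => 0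

/-- The value of a weight at a fixed integral point of the positive chamber. -/
def Weight.height {q : ℕ} : Weight q → ℤ
  | Sum.inl i => (q : ℤ) - (i : ℕ)
  | Sum.inr (Sum.inl i) => -((q : ℤ) - (i : ℕ))
  | Sum.inr (Sum.inr _) => 0

/-- The opposite weight. -/
def Weight.opp {q : ℕ} : Weight q → Weight q
  | Sum.inl i => Sum.inr (Sum.inl i)
  | Sum.inr (Sum.inl i) => Sum.inl i
  | Sum.inr (Sum.inr _) => Sum.inr (Sum.inr ())

/-- The orthogonal projection onto a weight space. -/
def weightProj (F : Type) [NormedDivisionRing F] [NormedAlgebra ℝ F] [StarRing F] (p : ℕ) {q : ℕ} :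
    Weight q → BigMat F p q
  | Sum.inl i => (1 / 2 : ℝ) • (ePlus F p q * Matrix.single i i (1 : F) * (ePlus F p q)ᴴ)
  | Sum.inr (Sum.inl i) => (1 / 2 : ℝ) • (eMinus F p q * Matrix.single i i (1 : F) * (eMinus F p q)ᴴ)
  | Sum.inr (Sum.inr _) => 1 - (1 / 2 : ℝ) • (ePlus F p q * (ePlus F p q)ᴴ) -
      (1 / 2 : ℝ) • (eMinus F p q * (eMinus F p q)ᴴ)

variable {p q : ℕ}

theorem Weight.height_opp (w : Weight q) : w.opp.height = -w.height := by
  rcases w with i | i | i <;> simp [Weight.opp, Weight.height]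

theorem Weight.opp_opp (w : Weight q) : w.opp.opp = w := by
  rcases w with i | i | i <;> rfl

theorem Weight.abs_height_le (w : Weight q) : |w.height| ≤ q := by
  rcases w with i | i | i <;> simp only [Weight.height, abs_le]
  · have := i.2
    omega
  · have := i.2
    omega
  · omega

theorem Weight.sum_coeff (w : Weight q) :
    ∑ i, w.coeff i * ((q : ℝ) - (i : ℕ)) = w.height := by
  rcases w with i | i | i <;> simp [Weight.coeff, Weight.height, Pi.single_apply]

/-- The heights are the integers q, …, 1, then -q, …, -1, and 0: one regular element of 𝔞 separates
all weights. -/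
theorem Weight.height_injective : Function.Injective (Weight.height : Weight q → ℤ) := by
  rintro (i | i | i) (j | j | j) h <;> simp only [Weight.height] at h
  · have : i = j := Fin.ext (by omega)
    rw [this]
  · have := i.2; have := j.2; omega
  · have := i.2; omega
  · have := i.2; have := j.2; omega
  · have : i = j := Fin.ext (by omega)
    rw [this]
  · have := i.2; omega
  · have := j.2; omega
  · have := j.2; omega
  · rfl

/-- Hence a matrix component that strictly raises the height has a positive root as its weight under
ad 𝔞; f_i - (-f_i) accounts for the roots 2f_i. -/
theorem Weight.coeff_sub_mem_positiveRoots {v w : Weight q} (h : w.height < v.height) :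
    v.coeff - w.coeff ∈ positiveRoots q := by
  rcases v with i | i | i <;> rcases w with j | j | j <;>
    simp only [Weight.height, Weight.coeff] at h ⊢
  · exact Or.inr (Or.inr ⟨i, j, by rw [Fin.lt_def]; omega, Or.inl rfl⟩)
  · rcases lt_trichotomy i j with hij | hij | hij
    · exact Or.inr (Or.inr ⟨i, j, hij, Or.inr (by rw [sub_neg_eq_add])⟩)
    · subst hij
      refine Or.inr (Or.inl ⟨i, ?_⟩)
      rw [sub_neg_eq_add, ← Pi.single_add]
      norm_num
    · exact Or.inr (Or.inr ⟨j, i, hij, Or.inr (by rw [sub_neg_eq_add, add_comm])⟩)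
  · exact Or.inl ⟨i, by simp⟩
  · have := i.2; have := j.2; omega
  · exact Or.inr (Or.inr ⟨j, i, by rw [Fin.lt_def]; omega, Or.inl (by abel)⟩)
  · have := i.2; omega
  · have := j.2; omega
  · exact Or.inl ⟨j, by simp⟩
  · omega

theorem eMinus_conjTranspose_mul_ePlus (hqp : q ≤ p) : (eMinus F p q)ᴴ * ePlus F p q = 0 := by
  have := congrArg conjTranspose (ePlus_form (F := F) hqp)
  rwa [conjTranspose_mul, conjTranspose_conjTranspose, conjTranspose_zero] at this

theorem eMinus_gram (hqp : q ≤ p) : (eMinus F p q)ᴴ * eMinus F p q = (2 : ℝ) • 1 := by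
  rw [← formJ_mul_ePlus, conjTranspose_mul, formJ_conjTranspose, Matrix.mul_assoc,
    ← Matrix.mul_assoc (formJ F p q), formJ_mul_formJ, Matrix.one_mul, ePlus_gram hqp]

/-- The projection onto the zero weight space. -/
abbrev zeroProj (F : Type) [NormedDivisionRing F] [NormedAlgebra ℝ F] [StarRing F] (p q : ℕ) :
    BigMat F p q := weightProj F p (Sum.inr (Sum.inr ()) : Weight q)

theorem zeroProj_eq : zeroProj F p q = 1 - (1 / 2 : ℝ) • (ePlus F p q * (ePlus F p q)ᴴ) -
      (1 / 2 : ℝ) • (eMinus F p q * (eMinus F p q)ᴴ) := rfl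

theorem zeroProj_mul_ePlus (hqp : q ≤ p) : zeroProj F p q * ePlus F p q = 0 := by
  rw [zeroProj_eq, Matrix.sub_mul, Matrix.sub_mul, Matrix.smul_mul, Matrix.smul_mul,
    Matrix.mul_assoc, Matrix.mul_assoc, ePlus_gram hqp, eMinus_conjTranspose_mul_ePlus hqp]
  simp [smul_smul]

theorem zeroProj_mul_eMinus (hqp : q ≤ p) : zeroProj F p q * eMinus F p q = 0 := by
  rw [zeroProj_eq, Matrix.sub_mul, Matrix.sub_mul, Matrix.smul_mul, Matrix.smul_mul,
    Matrix.mul_assoc, Matrix.mul_assoc, eMinus_gram hqp, ePlus_form hqp]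
  simp [smul_smul]

theorem weightProj_conjTranspose (w : Weight q) : (weightProj F p w)ᴴ = weightProj F p w := by
  rcases w with i | i | i
  · simp [weightProj, Matrix.mul_assoc]
  · simp [weightProj, Matrix.mul_assoc]
  · simp [weightProj]

theorem formJ_mul_weightProj (w : Weight q) :
    formJ F p q * weightProj F p w = weightProj F p w.opp * formJ F p q := by
  have h1 := formJ_mul_ePlus (F := F) (p := p) (q := q)
  have h2 := formJ_mul_eMinus (F := F) (p := p) (q := q)
  have h3 : (ePlus F p q)ᴴ * formJ F p q = (eMinus F p q)ᴴ := by
    rw [← h1, conjTranspose_mul, formJ_conjTranspose]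
  have h4 : (eMinus F p q)ᴴ * formJ F p q = (ePlus F p q)ᴴ := by
    rw [← h2, conjTranspose_mul, formJ_conjTranspose]
  rcases w with i | i | i
  · simp only [weightProj, Weight.opp, mul_smul_comm, smul_mul_assoc]
    rw [Matrix.mul_assoc _ _ (formJ F p q), h4, ← Matrix.mul_assoc, ← Matrix.mul_assoc, h1]
  · simp only [weightProj, Weight.opp, mul_smul_comm, smul_mul_assoc]
    rw [Matrix.mul_assoc _ _ (formJ F p q), h3, ← Matrix.mul_assoc, ← Matrix.mul_assoc, h2]
  · simp only [weightProj, Weight.opp, mul_sub, sub_mul, mul_smul_comm, smul_mul_assoc, mul_one,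
      one_mul]
    rw [Matrix.mul_assoc _ _ (formJ F p q), Matrix.mul_assoc _ _ (formJ F p q), h3, h4,
      ← Matrix.mul_assoc, ← Matrix.mul_assoc, h1, h2]
    abel

theorem sum_weightProj : ∑ w : Weight q, weightProj F p w = 1 := by
  have h : ∑ i : Fin q, Matrix.single i i (1 : F) = 1 := by
    ext a b
    simp only [Matrix.sum_apply, Matrix.single_apply, Matrix.one_apply]
    by_cases hab : a = b
    · subst hab
      simp
    · rw [if_neg hab]
      refine Finset.sum_eq_zero fun i _ => if_neg ?_
      rintro ⟨rfl, h⟩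
      exact hab h
  simp only [Fintype.sum_sum_type, weightProj, Finset.univ_unique, Finset.sum_singleton,
    ← Finset.smul_sum, ← Matrix.sum_mul, ← Matrix.mul_sum, h, Matrix.mul_one]
  abel

theorem Hmat_eq (t : Fin q → ℝ) :
    Hmat F p t = (1 / 2 : ℝ) • (ePlus F p q * realDiag F t * (ePlus F p q)ᴴ) -
      (1 / 2 : ℝ) • (eMinus F p q * realDiag F t * (eMinus F p q)ᴴ) := by
  simp only [Hmat, ePlus, eMinus, fromRows_mul, fromRows_conjTranspose, rectDiag_eq,
    mul_fromCols, conjTranspose_one, Matrix.mul_one, Matrix.one_mul, conjTranspose_mul,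
    realDiag_conjTranspose, inclusion_conjTranspose, conjTranspose_neg, Matrix.mul_neg,
    Matrix.neg_mul]
  ext (i | i) (j | j)
  · simp
  · simp only [fromBlocks_apply₁₂, Matrix.sub_apply, Matrix.smul_apply, fromRows_apply_inl,
      fromCols_apply_inr, Matrix.neg_apply]
    module
  · simp only [fromBlocks_apply₂₁, Matrix.sub_apply, Matrix.smul_apply, fromRows_apply_inr,
      fromCols_apply_inl, Matrix.neg_apply]
    module
  · simp

theorem Hmat_mul_weightProj (hqp : q ≤ p) (t : Fin q → ℝ) (w : Weight q) :
    Hmat F p t * weightProj F p w = (∑ i, w.coeff i * t i) • weightProj F p w := by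
  have hs : ∀ i, realDiag F t * Matrix.single i i (1 : F) = t i • Matrix.single i i (1 : F) := by
    intro i
    ext a b
    rw [realDiag_mul_apply, Matrix.smul_apply, Matrix.single_apply]
    by_cases h : i = a
    · rw [h]
    · simp [h]
  rcases w with i | i | i
  · simp only [weightProj, Weight.coeff, mul_smul_comm]
    rw [← Matrix.mul_assoc, ← Matrix.mul_assoc, Hmat_mul_ePlus hqp, Matrix.mul_assoc (ePlus F p q),
      hs, Matrix.mul_smul, Matrix.smul_mul, smul_comm]
    simp [Pi.single_apply]
  · simp only [weightProj, Weight.coeff, mul_smul_comm]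
    rw [← Matrix.mul_assoc, ← Matrix.mul_assoc, Hmat_mul_eMinus hqp, Matrix.mul_assoc (eMinus F p q),
      realDiag_neg, Matrix.neg_mul, hs, ← neg_smul, Matrix.mul_smul, Matrix.smul_mul, smul_comm]
    simp [Pi.single_apply]
  · simp only [weightProj, Weight.coeff, mul_sub, mul_smul_comm, mul_one]
    rw [← Matrix.mul_assoc, ← Matrix.mul_assoc, Hmat_mul_ePlus hqp, Hmat_mul_eMinus hqp,
      realDiag_neg, Matrix.mul_neg, Matrix.neg_mul, Hmat_eq]
    simp only [Pi.zero_apply, zero_mul, Finset.sum_const_zero, zero_smul]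
    module

theorem weightProj_mul_Hmat (hqp : q ≤ p) (t : Fin q → ℝ) (w : Weight q) :
    weightProj F p w * Hmat F p t = (∑ i, w.coeff i * t i) • weightProj F p w := by
  have := congrArg conjTranspose (Hmat_mul_weightProj (F := F) hqp t w)
  rwa [conjTranspose_mul, conjTranspose_smul, weightProj_conjTranspose, Hmat_conjTranspose,
    star_trivial] at this

/-- Insert H at the regular point between the projections: it acts from the two sides by two
different heights. -/
theorem weightProj_mul_of_ne (hqp : q ≤ p) {v w : Weight q} (h : v ≠ w) :
    weightProj F p v * weightProj F p w = 0 := by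
  have h1 : ((v.height : ℝ) - w.height) • (weightProj F p v * weightProj F p w) = 0 := by
    rw [← Weight.sum_coeff, ← Weight.sum_coeff, sub_smul, ← smul_mul_assoc, ← mul_smul_comm,
      ← weightProj_mul_Hmat hqp, ← Hmat_mul_weightProj hqp, Matrix.mul_assoc, sub_self]
  refine (smul_eq_zero.mp h1).resolve_left (sub_ne_zero.mpr ?_)
  exact_mod_cast fun h' => h (Weight.height_injective h')

theorem weightProj_mul_self (hqp : q ≤ p) (w : Weight q) :
    weightProj F p w * weightProj F p w = weightProj F p w := by
  conv_rhs => rw [← Matrix.mul_one (weightProj F p w), ← sum_weightProj (F := F), Matrix.mul_sum]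
  rw [Finset.sum_eq_single w]
  · intro v _ hv
    exact weightProj_mul_of_ne hqp hv.symm
  · simp

/-! ### The filtration of matrices by the height of weights -/

/-- Matrices that raise the height of weights by at least `k`. -/
def RaisesBy (k : ℤ) (X : BigMat F p q) : Prop :=
  ∀ v w : Weight q, v.height < w.height + k → weightProj F p v * X * weightProj F p w = 0

theorem RaisesBy.mono {k l : ℤ} (h : l ≤ k) {X : BigMat F p q} (hX : RaisesBy k X) :
    RaisesBy l X := fun v w hvw => hX v w (by omega)

theorem RaisesBy.add {k : ℤ} {X Y : BigMat F p q} (hX : RaisesBy k X) (hY : RaisesBy k Y) :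
    RaisesBy k (X + Y) := fun v w h => by
  rw [mul_add, add_mul, hX v w h, hY v w h, add_zero]

theorem RaisesBy.smul {k : ℤ} {X : BigMat F p q} (hX : RaisesBy k X) (c : ℝ) :
    RaisesBy k (c • X) := fun v w h => by
  rw [mul_smul_comm, smul_mul_assoc, hX v w h, smul_zero]

theorem RaisesBy.neg {k : ℤ} {X : BigMat F p q} (hX : RaisesBy k X) :
    RaisesBy k (-X) := fun v w h => by
  rw [mul_neg, neg_mul, hX v w h, neg_zero]

theorem RaisesBy.sub {k : ℤ} {X Y : BigMat F p q} (hX : RaisesBy k X) (hY : RaisesBy k Y) :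
    RaisesBy k (X - Y) := by
  rw [sub_eq_add_neg]
  exact hX.add hY.neg

theorem RaisesBy.mul (hqp : q ≤ p) {k l : ℤ} {X Y : BigMat F p q} (hX : RaisesBy k X)
    (hY : RaisesBy l Y) : RaisesBy (k + l) (X * Y) := fun v w h => by
  have : weightProj F p v * (X * Y) * weightProj F p w =
      ∑ x : Weight q, (weightProj F p v * X * weightProj F p x) *
        (weightProj F p x * Y * weightProj F p w) := by
    have e : ∀ x : Weight q, (weightProj F p v * X * weightProj F p x) *
        (weightProj F p x * Y * weightProj F p w) =
        weightProj F p v * X * weightProj F p x * (Y * weightProj F p w) := by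
      intro x
      rw [Matrix.mul_assoc (weightProj F p x), ← Matrix.mul_assoc _ (weightProj F p x),
        Matrix.mul_assoc _ (weightProj F p x) (weightProj F p x), weightProj_mul_self hqp]
    simp only [e, ← Matrix.sum_mul, ← Matrix.mul_sum]
    rw [sum_weightProj]
    simp only [Matrix.mul_assoc, Matrix.one_mul]
  rw [this]
  refine Finset.sum_eq_zero fun x _ => ?_
  rcases lt_or_ge v.height (x.height + k) with h' | h'
  · rw [hX v x h', Matrix.zero_mul]
  · rw [hY x w (by omega), Matrix.mul_zero]

theorem raisesBy_zero_one (hqp : q ≤ p) : RaisesBy 0 (1 : BigMat F p q) := fun v w h => by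
  rw [Matrix.mul_one]
  refine weightProj_mul_of_ne hqp ?_
  rintro rfl
  omega

theorem sum_weightProj_mul (X : BigMat F p q) :
    ∑ v : Weight q, ∑ w : Weight q, weightProj F p v * X * weightProj F p w = X := by
  simp only [← Matrix.mul_sum, ← Matrix.sum_mul, sum_weightProj, Matrix.one_mul, Matrix.mul_one]

/-- Heights lie in [-q, q], so a rise by more than 2q is impossible. The filtration is therefore
finite. -/
theorem RaisesBy.eq_zero {k : ℤ} (hk : 2 * (q : ℤ) < k) {X : BigMat F p q} (hX : RaisesBy k X) :
    X = 0 := by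
  rw [← sum_weightProj_mul X]
  refine Finset.sum_eq_zero fun v _ => Finset.sum_eq_zero fun w _ => hX v w ?_
  have h1 := abs_le.mp v.abs_height_le
  have h2 := abs_le.mp w.abs_height_le
  omega

theorem RaisesBy.pow (hqp : q ≤ p) {X : BigMat F p q} (hX : RaisesBy 1 X) (n : ℕ) :
    RaisesBy n (X ^ n) := by
  induction n with
  | zero => simpa using raisesBy_zero_one hqp
  | succ n ih =>
    rw [pow_succ]
    exact_mod_cast ih.mul hqp hX

theorem raisesBy_of_hasSum {k : ℤ} {f : ℕ → BigMat F p q} {X : BigMat F p q} (hf : HasSum f X)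
    (h : ∀ n, RaisesBy k (f n)) : RaisesBy k X := fun v w hvw => by
  have h1 := hf.map (⟨⟨fun A => weightProj F p v * A * weightProj F p w, by simp⟩,
      fun A B => by simp [mul_add, add_mul]⟩ : BigMat F p q →+ BigMat F p q)
    ((continuous_const.matrix_mul continuous_id).matrix_mul continuous_const)
  refine h1.unique ?_
  convert hasSum_zero using 1
  ext1 n
  exact h n v w hvw

theorem RaisesBy.exp_sub_one (hqp : q ≤ p) {X : BigMat F p q} (hX : RaisesBy 1 X) :
    RaisesBy 1 (NormedSpace.exp X - 1) := by
  have h0 := hasSum_matrix_exp X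
  rw [hasSum_nat_add_iff' 1 |>.symm] at h0
  rw [Finset.sum_range_one, Nat.factorial_zero, Nat.cast_one, inv_one, one_smul, pow_zero] at h0
  refine raisesBy_of_hasSum h0 fun n => ((hX.pow hqp (n + 1)).mono ?_).smul _
  push_cast
  omega

/-- Every monomial of the difference contains Z and, the degree being at least 2, a further factor X
or Z that raises the height by at least one more. -/
theorem RaisesBy.pow_add_sub (hqp : q ≤ p) {k : ℤ} (hk : 1 ≤ k) {X Z : BigMat F p q}
    (hX : RaisesBy 1 X) (hZ : RaisesBy k Z) (n : ℕ) :
    RaisesBy (k + 1) ((X + Z) ^ (n + 2) - X ^ (n + 2)) := by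
  have hXZ : RaisesBy 1 (X + Z) := hX.add (hZ.mono hk)
  have step : ∀ m, RaisesBy k ((X + Z) ^ m - X ^ m) →
      RaisesBy (k + 1) ((X + Z) ^ (m + 1) - X ^ (m + 1) - X ^ m * Z) := by
    intro m hm
    have : (X + Z) ^ (m + 1) - X ^ (m + 1) - X ^ m * Z = ((X + Z) ^ m - X ^ m) * (X + Z) := by
      rw [pow_succ, pow_succ]
      noncomm_ring
    rw [this]
    exact hm.mul hqp hXZ
  have hXm : ∀ m : ℕ, RaisesBy (k + 1) (X ^ (m + 1) * Z) := fun m => by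
    refine ((hX.pow hqp (m + 1)).mul hqp hZ).mono ?_
    push_cast
    omega
  have main : ∀ m : ℕ, RaisesBy k ((X + Z) ^ (m + 1) - X ^ (m + 1)) := by
    intro m
    induction m with
    | zero => simpa using hZ
    | succ m ih =>
      have := (step _ ih).add (hXm m)
      rw [sub_add_cancel] at this
      exact this.mono (by omega)
  have := (step _ (main n)).add (hXm n)
  rwa [sub_add_cancel] at this

/-- To leading order a perturbation of the exponent is additive: the terms of degree at most 1
contribute exactly Z, the others are one level higher. -/
theorem RaisesBy.exp_add_sub (hqp : q ≤ p) {k : ℤ} (hk : 1 ≤ k) {X Z : BigMat F p q}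
    (hX : RaisesBy 1 X) (hZ : RaisesBy k Z) :
    RaisesBy (k + 1) (NormedSpace.exp (X + Z) - NormedSpace.exp X - Z) := by
  have h0 := (hasSum_matrix_exp (X + Z)).sub (hasSum_matrix_exp X)
  rw [hasSum_nat_add_iff' 2 |>.symm] at h0
  rw [Finset.sum_range_succ, Finset.sum_range_one] at h0
  have e : ((Nat.factorial 0 : ℝ)⁻¹ • (X + Z) ^ 0 - (Nat.factorial 0 : ℝ)⁻¹ • X ^ 0 +
      ((Nat.factorial 1 : ℝ)⁻¹ • (X + Z) ^ 1 - (Nat.factorial 1 : ℝ)⁻¹ • X ^ 1)) = Z := by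
    simp
  rw [e] at h0
  refine raisesBy_of_hasSum h0 fun n => ?_
  rw [← smul_sub]
  exact (RaisesBy.pow_add_sub hqp hk hX hZ n).smul _

/-! ### The unipotent group and its Lie algebra -/

/-- The anti-involution `X ↦ J X^* J`, which is `-1` on the Lie algebra and inversion on the
group. -/
def adj (X : BigMat F p q) : BigMat F p q := formJ F p q * Xᴴ * formJ F p q

theorem adj_mul (X Y : BigMat F p q) : adj (X * Y) = adj Y * adj X := by
  have : adj Y * adj X = formJ F p q * Yᴴ * (formJ F p q * formJ F p q) * Xᴴ * formJ F p q := by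
    simp only [adj, Matrix.mul_assoc]
  rw [this, formJ_mul_formJ, adj, conjTranspose_mul, Matrix.mul_one]
  simp only [Matrix.mul_assoc]

theorem adj_add (X Y : BigMat F p q) : adj (X + Y) = adj X + adj Y := by
  simp [adj, mul_add, add_mul]

theorem adj_sub (X Y : BigMat F p q) : adj (X - Y) = adj X - adj Y := by
  simp [adj, mul_sub, sub_mul]

theorem adj_smul (c : ℝ) (X : BigMat F p q) : adj (c • X) = c • adj X := by
  simp [adj]

theorem adj_adj (X : BigMat F p q) : adj (adj X) = X := by
  have : adj (adj X) = (formJ F p q * formJ F p q) * X * (formJ F p q * formJ F p q) := by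
    simp only [adj, conjTranspose_mul, formJ_conjTranspose, conjTranspose_conjTranspose,
      Matrix.mul_assoc]
  rw [this, formJ_mul_formJ, Matrix.one_mul, Matrix.mul_one]

theorem adj_sum {ι : Type*} (s : Finset ι) (f : ι → BigMat F p q) :
    adj (∑ i ∈ s, f i) = ∑ i ∈ s, adj (f i) := by
  simp [adj, conjTranspose_sum, Finset.mul_sum, Finset.sum_mul]

theorem adj_weightProj (w : Weight q) : adj (weightProj F p w) = weightProj F p w.opp := by
  rw [adj, weightProj_conjTranspose, formJ_mul_weightProj, Matrix.mul_assoc, formJ_mul_formJ,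
    Matrix.mul_one]

theorem adj_exp (X : BigMat F p q) : adj (NormedSpace.exp X) = NormedSpace.exp (adj X) := by
  have : Xᴴ * formJ F p q = formJ F p q * adj X := by
    rw [adj, ← Matrix.mul_assoc, ← Matrix.mul_assoc, formJ_mul_formJ, Matrix.one_mul]
  rw [adj, ← Matrix.exp_conjTranspose, Matrix.mul_assoc, matrix_exp_intertwine this,
    ← Matrix.mul_assoc, formJ_mul_formJ, Matrix.one_mul]

/-- The anti-involution reverses products and replaces weights by their opposites; the two reversals
cancel. -/
theorem RaisesBy.adj {k : ℤ} {X : BigMat F p q} (hX : RaisesBy k X) : RaisesBy k (adj X) :=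
  fun v w h => by
  have e : weightProj F p v * Grassmann.adj X * weightProj F p w =
      Grassmann.adj (weightProj F p w.opp * X * weightProj F p v.opp) := by
    rw [adj_mul, adj_mul, adj_weightProj, adj_weightProj, Weight.opp_opp, Weight.opp_opp,
      Matrix.mul_assoc]
  rw [e, hX _ _ (by rw [Weight.height_opp, Weight.height_opp]; omega)]
  simp [Grassmann.adj]

/-- Successive approximation of a logarithm inside the Lie algebra. If exp X agrees with n up to
level κ, then adding the skew part of the error to X gains one level; after finitely many steps the
error vanishes. -/
theorem exists_exp_eq (hqp : q ≤ p) {n : BigMat F p q} (hn : RaisesBy 1 (n - 1))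
    (hadj : adj n * n = 1) :
    ∃ X : BigMat F p q, RaisesBy 1 X ∧ adj X = -X ∧ NormedSpace.exp X = n := by
  have main : ∀ k : ℕ, ∃ X : BigMat F p q, RaisesBy 1 X ∧ adj X = -X ∧
      RaisesBy ((k : ℤ) + 1) (n - NormedSpace.exp X) := by
    intro k
    induction k with
    | zero =>
      refine ⟨0, fun v w _ => by simp, by simp [adj], ?_⟩
      simpa [NormedSpace.exp_zero] using hn
    | succ k ih =>
      obtain ⟨X, hX, hXa, hD⟩ := ih
      set D := n - NormedSpace.exp X with hDdef
      set κ : ℤ := (k : ℤ) + 1 with hκ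
      have hκ1 : 1 ≤ κ := by omega
      have hE : NormedSpace.exp (-X) * NormedSpace.exp X = 1 := matrix_exp_neg_mul X
      have hn' : n = NormedSpace.exp X + D := by rw [hDdef]; abel
      have han : adj n = NormedSpace.exp (-X) + adj D := by
        rw [hn', adj_add, adj_exp, hXa]
      -- Expand adj(n) n = 1 with n = exp X + D and adj(n) = exp(-X) + adj D. Each term on the right
      -- is a product in which D or adj D meets a factor raising the height, so D is skew up to the
      -- next level.
      have key : D + adj D = -((NormedSpace.exp (-X) - 1) * D + adj D * (NormedSpace.exp X - 1) +
          adj D * D) := by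
        have h0 : (NormedSpace.exp (-X) + adj D) * (NormedSpace.exp X + D) = 1 := by
          rw [← han, ← hn', hadj]
        have h1 : (NormedSpace.exp (-X) + adj D) * (NormedSpace.exp X + D) =
            NormedSpace.exp (-X) * NormedSpace.exp X + (NormedSpace.exp (-X) * D +
              adj D * NormedSpace.exp X + adj D * D) := by noncomm_ring
        rw [h1, hE] at h0
        have h2 : NormedSpace.exp (-X) * D + adj D * NormedSpace.exp X + adj D * D = 0 := by
          simpa using h0
        rw [← sub_eq_zero, ← h2]
        noncomm_ring
      have hsum : RaisesBy (κ + 1) (D + adj D) := by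
        rw [key]
        refine RaisesBy.neg (RaisesBy.add (RaisesBy.add ?_ ?_) ?_)
        · have := (hX.neg.exp_sub_one hqp).mul hqp hD
          rwa [add_comm] at this
        · exact hD.adj.mul hqp (hX.exp_sub_one hqp)
        · exact (hD.adj.mul hqp hD).mono (by omega)
      -- The skew part of D differs from D only by half of D + adj D, which is already one level
      -- higher.
      set Z := (1 / 2 : ℝ) • (D - adj D) with hZdef
      have hZ : RaisesBy κ Z := (hD.sub hD.adj).smul _
      refine ⟨X + Z, hX.add (hZ.mono hκ1), ?_, ?_⟩
      · rw [adj_add, hXa, hZdef, adj_smul, adj_sub, adj_adj]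
        module
      · have h1 := RaisesBy.exp_add_sub hqp hκ1 hX hZ
        have e : n - NormedSpace.exp (X + Z) = (1 / 2 : ℝ) • (D + adj D) -
            (NormedSpace.exp (X + Z) - NormedSpace.exp X - Z) := by
          have : D - Z = (1 / 2 : ℝ) • (D + adj D) := by
            rw [hZdef]
            module
          rw [← this, hDdef]
          abel
        rw [e]
        have h2 := (hsum.smul (1 / 2)).sub h1
        exact_mod_cast h2
  -- Level 2q + 2 exceeds the largest possible rise 2q.
  obtain ⟨X, hX, hXa, hD⟩ := main (2 * q + 1)
  refine ⟨X, hX, hXa, ?_⟩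
  have := hD.eq_zero (by push_cast; omega)
  exact (sub_eq_zero.mp this).symm

/-- Over ℍ the trace is cyclic only modulo commutators, which is what the reduced trace condition in
`lieG` allows. -/
theorem trace_mul_sub_trace_mul_mem {n : Type} [Fintype n] (A B : Matrix n n F) :
    (A * B).trace - (B * A).trace ∈ Submodule.span ℝ {z : F | ∃ x y : F, z = x * y - y * x} := by
  simp only [trace, diag_apply, Matrix.mul_apply]
  rw [Finset.sum_comm (f := fun i j => B i j * A j i), ← Finset.sum_sub_distrib]
  refine Submodule.sum_mem _ fun i _ => ?_
  rw [← Finset.sum_sub_distrib]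
  exact Submodule.sum_mem _ fun j _ => Submodule.subset_span ⟨_, _, rfl⟩

theorem trace_weightProj_mul_mem (hqp : q ≤ p) {v w : Weight q} (h : v ≠ w) (X : BigMat F p q) :
    (weightProj F p v * X * weightProj F p w).trace ∈
      Submodule.span ℝ {z : F | ∃ x y : F, z = x * y - y * x} := by
  have := trace_mul_sub_trace_mul_mem (weightProj F p v) (X * weightProj F p w)
  rwa [Matrix.mul_assoc X, weightProj_mul_of_ne hqp h.symm, Matrix.mul_zero, trace_zero, sub_zero,
    ← Matrix.mul_assoc] at this

theorem mem_lieG_of_adj {X : BigMat F p q} (h : adj X = -X)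
    (htr : X.trace ∈ Submodule.span ℝ {z : F | ∃ x y : F, z = x * y - y * x}) :
    X ∈ lieG F p q := by
  have e : adj X = fromBlocks X.toBlocks₁₁ᴴ (-X.toBlocks₂₁ᴴ) (-X.toBlocks₁₂ᴴ) X.toBlocks₂₂ᴴ := by
    conv_lhs => rw [← fromBlocks_toBlocks X]
    simp [adj, formJ, fromBlocks_conjTranspose, fromBlocks_multiply]
  have e2 : -X = fromBlocks (-X.toBlocks₁₁) (-X.toBlocks₁₂) (-X.toBlocks₂₁) (-X.toBlocks₂₂) := by
    conv_lhs => rw [← fromBlocks_toBlocks X]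
    rw [fromBlocks_neg]
  rw [e, e2, fromBlocks_inj] at h
  exact ⟨h.1, h.2.2.2, (neg_injective h.2.2.1).symm, htr⟩

/-- The components P_v X P_w are eigenvectors of ad 𝔞, and subtracting the image under `adj` places
each in 𝔤. Both terms have the weight v - w, because passing to opposites and exchanging sides
leaves the difference unchanged. -/
theorem mem_iSup_rootSpace (hqp : q ≤ p) {X : BigMat F p q} (hX : RaisesBy 1 X)
    (hadj : adj X = -X) : X ∈ (⨆ α ∈ positiveRoots q, rootSpace F p q α) := by
  have e : X = ∑ v : Weight q, ∑ w : Weight q, (1 / 2 : ℝ) •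
      (weightProj F p v * X * weightProj F p w - adj (weightProj F p v * X * weightProj F p w)) := by
    simp only [← Finset.smul_sum, Finset.sum_sub_distrib, ← adj_sum, sum_weightProj_mul, hadj]
    module
  rw [e]
  refine Submodule.sum_mem _ fun v _ => Submodule.sum_mem _ fun w _ => Submodule.smul_mem _ _ ?_
  rcases lt_or_ge w.height v.height with h | h
  · have hne : v ≠ w := by rintro rfl; omega
    have hopp : adj (weightProj F p v * X * weightProj F p w) =
        weightProj F p w.opp * adj X * weightProj F p v.opp := by
      rw [adj_mul, adj_mul, adj_weightProj, adj_weightProj, Matrix.mul_assoc]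
    have hne' : w.opp ≠ v.opp := fun h' => hne (by
      rw [← Weight.opp_opp v, ← h', Weight.opp_opp])
    set A := weightProj F p v * X * weightProj F p w with hA
    refine Submodule.mem_iSup_of_mem _ (Submodule.mem_iSup_of_mem
      (Weight.coeff_sub_mem_positiveRoots h) ⟨mem_lieG_of_adj ?_ ?_, fun t => ?_⟩)
    · rw [adj_sub, adj_adj]
      abel
    · rw [trace_sub, hopp]
      exact Submodule.sub_mem _ (trace_weightProj_mul_mem hqp hne X)
        (trace_weightProj_mul_mem hqp hne' _)
    · set c := ∑ i, (v.coeff - w.coeff) i * t i with hc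
      have hcA : Hmat F p t * A - A * Hmat F p t = c • A := by
        rw [hA, Matrix.mul_assoc _ _ (Hmat F p t), weightProj_mul_Hmat hqp, ← Matrix.mul_assoc,
          ← Matrix.mul_assoc, Hmat_mul_weightProj hqp, mul_smul_comm, smul_mul_assoc,
          smul_mul_assoc, ← sub_smul, ← Finset.sum_sub_distrib, hc]
        simp only [Pi.sub_apply, sub_mul]
      have hadjH : adj (Hmat F p t) = -Hmat F p t := by
        rw [adj, Hmat_conjTranspose, Matrix.mul_assoc, Hmat_mul_formJ, ← Matrix.mul_assoc,
          formJ_mul_formJ, Matrix.one_mul]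
      have hcA' : Hmat F p t * adj A - adj A * Hmat F p t = c • adj A := by
        rw [← adj_smul, ← hcA, adj_sub, adj_mul (Hmat F p t), adj_mul A, hadjH]
        noncomm_ring
      rw [mul_sub, sub_mul, smul_sub, ← hcA, ← hcA']
      abel
  · rw [hX v w (by omega)]
    simp [adj]

theorem mem_groupN (hqp : q ≤ p) {n : BigMat F p q} (hn : RaisesBy 1 (n - 1))
    (hadj : adj n * n = 1) : n ∈ groupN F p q := by
  obtain ⟨X, hX, hXa, rfl⟩ := exists_exp_eq hqp hn hadj
  exact ⟨X, mem_iSup_rootSpace hqp hX hXa, rfl⟩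

end Projections

/-! ### Existence of the Iwasawa decomposition -/

section Iwasawa

variable {F : Type} [NormedDivisionRing F] [NormedAlgebra ℝ F] [StarRing F] [CStarRing F]
  [FiniteDimensional ℝ F] [MeasureSpace F] [BorelSpace F] [Scalars F]

variable {p q : ℕ}

/-- Pairing with E₋ is the J-dual of E₊, so g acts on it by the inverse of the triangular matrix T.
-/
theorem eMinus_conjTranspose_mul {g : BigMat F p q} (hg : gᴴ * formJ F p q * g = formJ F p q)
    {T S : Matrix (Fin q) (Fin q) F} (hT : g * ePlus F p q = ePlus F p q * T) (hTS : T * S = 1) :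
    (eMinus F p q)ᴴ * g = Sᴴ * (eMinus F p q)ᴴ := by
  have h1 : (ePlus F p q)ᴴ * formJ F p q = (eMinus F p q)ᴴ := by
    rw [← formJ_mul_ePlus, conjTranspose_mul, formJ_conjTranspose]
  have h2 : Tᴴ * ((eMinus F p q)ᴴ * g) = (eMinus F p q)ᴴ := by
    calc _ = (ePlus F p q * T)ᴴ * formJ F p q * g := by
          rw [← h1, conjTranspose_mul]; simp only [Matrix.mul_assoc]
      _ = (ePlus F p q)ᴴ * (gᴴ * formJ F p q * g) := by
          rw [← hT, conjTranspose_mul]; simp only [Matrix.mul_assoc]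
      _ = _ := by rw [hg, h1]
  have h3 : Sᴴ * Tᴴ = 1 := by rw [← conjTranspose_mul, hTS, conjTranspose_one]
  calc _ = Sᴴ * Tᴴ * ((eMinus F p q)ᴴ * g) := by rw [h3, Matrix.one_mul]
    _ = _ := by rw [Matrix.mul_assoc, h2]

theorem zeroProj_mul_formJ : zeroProj F p q * formJ F p q = formJ F p q * zeroProj F p q :=
  (formJ_mul_weightProj (F := F) (p := p) (Sum.inr (Sum.inr ()) : Weight q)).symm

theorem zeroProj_eq_fromBlocks :
    zeroProj F p q = fromBlocks 0 0 0 (1 - inclusion F p q * inclusion F q p) := by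
  have e : (1 : BigMat F p q) = fromBlocks 1 0 0 1 := fromBlocks_one.symm
  rw [zeroProj_eq, e]
  simp only [ePlus, eMinus, fromRows_mul, fromRows_conjTranspose, mul_fromCols, conjTranspose_one,
    Matrix.mul_one, Matrix.one_mul, inclusion_conjTranspose, conjTranspose_neg, Matrix.mul_neg,
    Matrix.neg_mul]
  ext (i | i) (j | j)
  · simp only [Matrix.sub_apply, Matrix.smul_apply, fromBlocks_apply₁₁, fromRows_apply_inl,
      fromCols_apply_inl, Matrix.zero_apply]
    module
  · simp
  · simp
  · simp only [Matrix.sub_apply, Matrix.smul_apply, fromBlocks_apply₂₂, fromRows_apply_inr,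
      fromCols_apply_inr, Matrix.neg_apply]
    module

theorem zeroProj_mul_formJ_eq_neg : formJ F p q * zeroProj F p q = -zeroProj F p q := by
  rw [zeroProj_eq_fromBlocks, formJ, fromBlocks_multiply, fromBlocks_neg]
  simp

/-- Such a g preserves the span of E₊ and its J-orthogonal space, which is that span plus the zero
weight space. The induced map on the quotient preserves J, and J = -1 on the zero weight space, so
the map is unitary there. -/
theorem zeroProj_gram (hqp : q ≤ p) {g : BigMat F p q} (hg : gᴴ * formJ F p q * g = formJ F p q)
    {T S : Matrix (Fin q) (Fin q) F} (hT : g * ePlus F p q = ePlus F p q * T) (hTS : T * S = 1) :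
    (zeroProj F p q * g * zeroProj F p q)ᴴ * (zeroProj F p q * g * zeroProj F p q) =
      zeroProj F p q := by
  set Q := zeroProj F p q with hQ
  have hQQ : Q * Q = Q := weightProj_mul_self hqp _
  have hQs : Qᴴ = Q := weightProj_conjTranspose _
  have hQJ : formJ F p q * Q = -Q := zeroProj_mul_formJ_eq_neg
  set R := (1 / 2 : ℝ) • (ePlus F p q * (ePlus F p q)ᴴ) with hR
  have hRs : Rᴴ = R := by simp [hR]
  have hQe : Q * eMinus F p q = 0 := zeroProj_mul_eMinus hqp
  have hme : (eMinus F p q)ᴴ * (g * Q) = 0 := by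
    rw [← Matrix.mul_assoc, eMinus_conjTranspose_mul hg hT hTS, Matrix.mul_assoc, ← hQs,
      ← conjTranspose_mul, hQe, conjTranspose_zero, Matrix.mul_zero]
  set h := g * Q with hh
  have hdecomp : h = R * h + Q * h := by
    have : Q = 1 - R - (1 / 2 : ℝ) • (eMinus F p q * (eMinus F p q)ᴴ) := zeroProj_eq
    rw [← Matrix.add_mul, this, add_sub, add_sub_cancel, Matrix.sub_mul, Matrix.one_mul,
      Matrix.smul_mul, Matrix.mul_assoc, hme, Matrix.mul_zero, smul_zero, sub_zero]
  have hJh : hᴴ * formJ F p q * h = -Q := by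
    calc _ = Q * (gᴴ * formJ F p q * g) * Q := by
          rw [hh, conjTranspose_mul, hQs]; simp only [Matrix.mul_assoc]
      _ = -Q := by rw [hg, Matrix.mul_assoc, hQJ, Matrix.mul_neg, hQQ]
  have hJR : formJ F p q * R = (1 / 2 : ℝ) • (eMinus F p q * (ePlus F p q)ᴴ) := by
    rw [hR, mul_smul_comm, ← Matrix.mul_assoc, formJ_mul_ePlus]
  have hhs : hᴴ = hᴴ * R + hᴴ * Q := by
    have := congrArg conjTranspose hdecomp
    rwa [conjTranspose_add, conjTranspose_mul R, conjTranspose_mul Q, hRs, hQs] at this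
  have h1 : hᴴ * (formJ F p q * R) = 0 := by
    have hRe : R * eMinus F p q = 0 := by
      rw [hR, Matrix.smul_mul, Matrix.mul_assoc, ePlus_form hqp, Matrix.mul_zero, smul_zero]
    have : hᴴ * eMinus F p q = 0 := by
      rw [hhs, Matrix.add_mul, Matrix.mul_assoc, Matrix.mul_assoc, hRe, hQe]
      simp
    rw [hJR, mul_smul_comm, ← Matrix.mul_assoc, this, Matrix.zero_mul, smul_zero]
  have h2 : hᴴ * formJ F p q * h = -(hᴴ * Q * h) := by
    calc hᴴ * formJ F p q * h = hᴴ * formJ F p q * (R * h + Q * h) := by rw [← hdecomp]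
      _ = hᴴ * (formJ F p q * R) * h + hᴴ * (formJ F p q * Q) * h := by
        rw [mul_add]; simp only [Matrix.mul_assoc]
      _ = _ := by rw [h1, hQJ, Matrix.zero_mul, zero_add, Matrix.mul_neg, Matrix.neg_mul]
  rw [hJh] at h2
  rw [Matrix.mul_assoc Q, ← hh, conjTranspose_mul, hQs, Matrix.mul_assoc, ← Matrix.mul_assoc Q Q,
    hQQ, ← Matrix.mul_assoc]
  exact (neg_injective h2).symm

/-- This separates the factor centralizing A from N. The compression of g to the zero weight space,
extended by the identity, is unitary of the form diag(1, v) and commutes with every a_s; removing it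
leaves an element of N. -/
theorem exists_unipotent (hqp : q ≤ p) {g : BigMat F p q}
    (hg : gᴴ * formJ F p q * g = formJ F p q) {T S : Matrix (Fin q) (Fin q) F}
    (hT : g * ePlus F p q = ePlus F p q * T) (hTT : T.BlockTriangular id) (hT1 : ∀ i, T i i = 1)
    (hTS : T * S = 1) :
    ∃ v : U F p, (∀ s : Fin q → ℝ, aMat F p s * blockU 1 v = blockU 1 v * aMat F p s) ∧
      ∃ n ∈ groupN F p q, g = blockU 1 v * n := by
  set Q := zeroProj F p q with hQ
  have hQQ : Q * Q = Q := weightProj_mul_self hqp _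
  have hQs : Qᴴ = Q := weightProj_conjTranspose _
  have hQJ : formJ F p q * Q = -Q := zeroProj_mul_formJ_eq_neg
  have hQE : Q * ePlus F p q = 0 := zeroProj_mul_ePlus hqp
  have hQe : Q * eMinus F p q = 0 := zeroProj_mul_eMinus hqp
  have hgram := zeroProj_gram hqp hg hT hTS
  rw [← hQ] at hgram
  set m := Q * g * Q with hm
  have hQm : Q * m = m := by rw [hm, ← Matrix.mul_assoc, ← Matrix.mul_assoc, hQQ]
  have hmQ : m * Q = m := by rw [hm, Matrix.mul_assoc, hQQ]
  have hmsQ : mᴴ * Q = mᴴ := by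
    have := congrArg conjTranspose hQm
    rwa [conjTranspose_mul, hQs] at this
  have hQms : Q * mᴴ = mᴴ := by
    have := congrArg conjTranspose hmQ
    rwa [conjTranspose_mul, hQs] at this
  set B := m + (1 - Q) with hB
  have hBs : Bᴴ = mᴴ + (1 - Q) := by
    rw [hB, conjTranspose_add, conjTranspose_sub, conjTranspose_one, hQs]
  have hBB : Bᴴ * B = 1 := by
    rw [hBs, hB]
    have : (mᴴ + (1 - Q)) * (m + (1 - Q)) =
        mᴴ * m + (mᴴ - mᴴ * Q) + (m - Q * m) + (1 - Q - Q + Q * Q) := by noncomm_ring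
    rw [this, hgram, hmsQ, hQm, hQQ]
    abel
  set P : Matrix (Fin p) (Fin p) F := 1 - inclusion F p q * inclusion F q p with hP
  have hQP : Q = fromBlocks 0 0 0 P := zeroProj_eq_fromBlocks
  set V := P * g.toBlocks₂₂ * P + (1 - P) with hV
  have hBV : B = fromBlocks 1 0 0 V := by
    have e1 : m = fromBlocks 0 0 0 (P * g.toBlocks₂₂ * P) := by
      rw [hm, hQP]
      conv_lhs => rw [← fromBlocks_toBlocks g]
      simp [fromBlocks_multiply]
    have e2 : (1 : BigMat F p q) - Q = fromBlocks 1 0 0 (1 - P) := by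
      rw [hQP, ← fromBlocks_one, sub_eq_add_neg, fromBlocks_neg, fromBlocks_add]
      simp [sub_eq_add_neg]
    rw [hB, e1, e2, fromBlocks_add, hV]
    simp
  have hVV : Vᴴ * V = 1 := by
    rw [hBV, fromBlocks_conjTranspose, fromBlocks_multiply, ← fromBlocks_one, fromBlocks_inj] at hBB
    simpa using hBB.2.2.2
  let v : U F p := unitaryOf V hVV
  have hv : blockU (1 : U F q) v = B := by rw [hBV]; rfl
  have hBB' : B * Bᴴ = 1 := mul_eq_one_comm.mp hBB
  have hJB : formJ F p q * B = B * formJ F p q := by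
    have hJm : formJ F p q * m = m * formJ F p q := by
      have h1 : Q * formJ F p q = -Q := zeroProj_mul_formJ.trans zeroProj_mul_formJ_eq_neg
      calc formJ F p q * m = formJ F p q * (Q * m) := by rw [hQm]
        _ = -(Q * m) := by rw [← Matrix.mul_assoc, hQJ, Matrix.neg_mul]
        _ = -(m * Q) := by rw [hQm, hmQ]
        _ = m * Q * formJ F p q := by rw [Matrix.mul_assoc m Q, h1, Matrix.mul_neg]
        _ = _ := by rw [hmQ]
    rw [hB, mul_add, add_mul, hJm, mul_sub, sub_mul, ← zeroProj_mul_formJ, Matrix.mul_one,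
      Matrix.one_mul]
  refine ⟨v, fun s => ?_, Bᴴ * g, ?_, ?_⟩
  · rw [hv]
    have hHQ : Hmat F p s * Q = 0 := by
      rw [hQ, zeroProj, Hmat_mul_weightProj hqp]
      simp [Weight.coeff]
    have hQH : Q * Hmat F p s = 0 := by
      rw [hQ, zeroProj, weightProj_mul_Hmat hqp]
      simp [Weight.coeff]
    refine matrix_exp_intertwine ?_
    have h1 : Hmat F p s * B = Hmat F p s := by
      rw [hB, mul_add, mul_sub, ← hQm, ← Matrix.mul_assoc, hHQ]
      simp
    have h2 : B * Hmat F p s = Hmat F p s := by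
      rw [hB, add_mul, sub_mul, ← hmQ, Matrix.mul_assoc, hQH]
      simp
    rw [h1, h2]
  · set n := Bᴴ * g with hn
    have hnJ : nᴴ * formJ F p q * n = formJ F p q := by
      calc _ = gᴴ * (B * formJ F p q) * (Bᴴ * g) := by
            rw [hn, conjTranspose_mul, conjTranspose_conjTranspose, Matrix.mul_assoc gᴴ]
        _ = gᴴ * formJ F p q * (B * Bᴴ) * g := by rw [← hJB]; simp only [Matrix.mul_assoc]
        _ = _ := by rw [hBB', Matrix.mul_one, hg]
    have hBE : Bᴴ * ePlus F p q = ePlus F p q := by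
      rw [hBs, Matrix.add_mul, Matrix.sub_mul, hQE, ← hmsQ, Matrix.mul_assoc, hQE]
      simp
    have hnE : n * ePlus F p q = ePlus F p q * T := by
      rw [hn, Matrix.mul_assoc, hT, ← Matrix.mul_assoc, hBE]
    have hne : (eMinus F p q)ᴴ * n = Sᴴ * (eMinus F p q)ᴴ := eMinus_conjTranspose_mul hnJ hnE hTS
    -- Removal of B normalizes the zero-weight block: it is m^*m, which equals Q by `zeroProj_gram`.
    have hQnQ : Q * n * Q = Q := by
      rw [hn, hBs]
      have : Q * ((mᴴ + (1 - Q)) * g) * Q = (Q * mᴴ) * g * Q + (Q - Q * Q) * g * Q := by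
        noncomm_ring
      rw [this, hQms, hQQ, sub_self, Matrix.zero_mul, Matrix.zero_mul, add_zero, ← hmsQ,
        Matrix.mul_assoc, Matrix.mul_assoc, ← Matrix.mul_assoc Q, ← hm, hgram]
    have hSS := blockTriangular_inverse hTT hTS
    have hS1 : ∀ i, S i i = 1 := by
      intro i
      have h1 := congrFun (congrFun hTS i) i
      rw [Matrix.mul_apply, Finset.sum_eq_single i, hT1, one_mul, Matrix.one_apply_eq] at h1
      · exact h1
      · intro l _ hl
        rcases lt_or_gt_of_ne hl with h | h
        · rw [hTT (show id l < id i from h), zero_mul]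
        · rw [hSS.2 (show id i < id l from h), mul_zero]
      · simp
    have hsingle : ∀ (A : Matrix (Fin q) (Fin q) F) (i j : Fin q), A i j = 0 →
        Matrix.single i i (1 : F) * A * Matrix.single j j (1 : F) = 0 := by
      intro A i j h
      ext a b
      rw [Matrix.single_mul_mul_single]
      simp [h]
    have hcol : (n - 1) * ePlus F p q = ePlus F p q * (T - 1) := by
      rw [Matrix.sub_mul, hnE, Matrix.mul_sub, Matrix.one_mul, Matrix.mul_one]
    have hrow : (eMinus F p q)ᴴ * (n - 1) = (S - 1)ᴴ * (eMinus F p q)ᴴ := by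
      rw [Matrix.mul_sub, hne, conjTranspose_sub, Matrix.sub_mul, conjTranspose_one,
        Matrix.one_mul, Matrix.mul_one]
    have hT0 : ∀ i j : Fin q, j ≤ i → (T - 1) i j = 0 := by
      intro i j hij
      rcases hij.lt_or_eq with h | h
      · rw [Matrix.sub_apply, hTT (show id j < id i from h), Matrix.one_apply_ne h.ne', sub_zero]
      · rw [h, Matrix.sub_apply, hT1, Matrix.one_apply_eq, sub_self]
    have hS0 : ∀ i j : Fin q, i ≤ j → (S - 1)ᴴ i j = 0 := by
      intro i j hij
      rw [conjTranspose_apply]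
      rcases hij.lt_or_eq with h | h
      · rw [Matrix.sub_apply, hSS.2 (show id i < id j from h), Matrix.one_apply_ne h.ne', sub_zero,
          star_zero]
      · rw [h, Matrix.sub_apply, hS1, Matrix.one_apply_eq, sub_self, star_zero]
    refine mem_groupN hqp ?_ ?_
    -- The blocks that do not raise the height: columns of weight f_j are governed by T - 1, rows of
    -- weight -f_i by (S - 1)^*, both strictly triangular, and the zero-zero block is trivial by
    -- `hQnQ`.
    · intro a b hab
      rcases b with j | j | j
      · have e1 : (n - 1) * weightProj F p (Sum.inl j : Weight q) = (1 / 2 : ℝ) •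
            (ePlus F p q * ((T - 1) * Matrix.single j j (1 : F) * (ePlus F p q)ᴴ)) := by
          rw [weightProj, mul_smul_comm, ← Matrix.mul_assoc, ← Matrix.mul_assoc, hcol]
          simp only [Matrix.mul_assoc]
        rw [Matrix.mul_assoc, e1]
        rcases a with i | i | i
        · have hij : j ≤ i := by
            simp only [Weight.height] at hab
            rw [Fin.le_def]
            omega
          have e2 : ∀ Z : Matrix (Fin q) (Fin q ⊕ Fin p) F,
              weightProj F p (Sum.inl i : Weight q) * (ePlus F p q * Z) =
              ePlus F p q * (Matrix.single i i (1 : F) * Z) := by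
            intro Z
            rw [weightProj, smul_mul_assoc, Matrix.mul_assoc, ← Matrix.mul_assoc (ePlus F p q)ᴴ,
              ePlus_gram hqp, Matrix.smul_mul, Matrix.one_mul, Matrix.mul_smul, smul_smul]
            norm_num [Matrix.mul_assoc]
          rw [mul_smul_comm, e2, ← Matrix.mul_assoc (Matrix.single i i (1 : F)),
            ← Matrix.mul_assoc (Matrix.single i i (1 : F)), hsingle _ _ _ (hT0 i j hij)]
          simp
        · rw [weightProj, mul_smul_comm, smul_mul_assoc, Matrix.mul_assoc,
            ← Matrix.mul_assoc (eMinus F p q)ᴴ, eMinus_conjTranspose_mul_ePlus hqp]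
          simp
        · have : weightProj F p (Sum.inr (Sum.inr i) : Weight q) = Q := rfl
          rw [this, mul_smul_comm, ← Matrix.mul_assoc, hQE]
          simp
      · have hi : ∃ i : Fin q, a = Sum.inr (Sum.inl i) := by
          rcases a with i | i | i
          · exfalso
            have := i.2
            have := j.2
            simp only [Weight.height] at hab
            omega
          · exact ⟨i, rfl⟩
          · exfalso
            have := j.2
            simp only [Weight.height] at hab
            omega
        obtain ⟨i, rfl⟩ := hi
        have hij : i ≤ j := by
          simp only [Weight.height] at hab
          rw [Fin.le_def]
          omega
        have e1 : weightProj F p (Sum.inr (Sum.inl i) : Weight q) * (n - 1) = (1 / 2 : ℝ) •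
            (eMinus F p q * (Matrix.single i i (1 : F) * (S - 1)ᴴ) * (eMinus F p q)ᴴ) := by
          rw [weightProj, smul_mul_assoc, Matrix.mul_assoc, hrow]
          simp only [Matrix.mul_assoc]
        have e2 : ∀ Z : Matrix (Fin q ⊕ Fin p) (Fin q) F,
            Z * (eMinus F p q)ᴴ * weightProj F p (Sum.inr (Sum.inl j) : Weight q) =
            Z * Matrix.single j j (1 : F) * (eMinus F p q)ᴴ := by
          intro Z
          rw [weightProj, mul_smul_comm, Matrix.mul_assoc Z, ← Matrix.mul_assoc (eMinus F p q)ᴴ,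
            ← Matrix.mul_assoc (eMinus F p q)ᴴ, eMinus_gram hqp, Matrix.smul_mul, Matrix.one_mul,
            Matrix.smul_mul, Matrix.mul_smul, smul_smul]
          norm_num [Matrix.mul_assoc]
        rw [e1, smul_mul_assoc, e2, Matrix.mul_assoc (eMinus F p q), hsingle _ _ _ (hS0 i j hij)]
        simp
      · have hb : weightProj F p (Sum.inr (Sum.inr j) : Weight q) = Q := rfl
        rw [hb]
        rcases a with i | i | i
        · exfalso
          have := i.2
          simp only [Weight.height] at hab
          omega
        · have heQ : (eMinus F p q)ᴴ * Q = 0 := by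
            rw [← hQs, ← conjTranspose_mul, hQe, conjTranspose_zero]
          rw [weightProj, smul_mul_assoc, Matrix.mul_assoc, hrow, smul_mul_assoc,
            Matrix.mul_assoc, Matrix.mul_assoc ((S - 1)ᴴ), heQ]
          simp
        · have : weightProj F p (Sum.inr (Sum.inr i) : Weight q) = Q := rfl
          rw [this, mul_sub, sub_mul, hQnQ, Matrix.mul_one, hQQ, sub_self]
    · rw [adj, Matrix.mul_assoc, Matrix.mul_assoc, ← Matrix.mul_assoc nᴴ, hnJ, formJ_mul_formJ]
  · rw [hv, ← Matrix.mul_assoc, hBB', Matrix.one_mul]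

theorem blockU_mul (u u' : U F q) (v v' : U F p) :
    blockU u v * blockU u' v' = blockU (u * u') (v * v') := by
  simp [blockU, fromBlocks_multiply]

/-- The QR factors of the upper rows give k₁ and s. By isotropy the lower rows have the same Gram
matrix, which gives k₂. After division by k and a_s the matrix acts unipotently on E₊. -/
theorem exists_iwasawa (hqp : q ≤ p) (t : Fin q → ℝ) (u : U F q) (v : U F p) :
    ∃ (k₁ : U F q) (k₂ : U F p) (s : Fin q → ℝ) (T : Matrix (Fin q) (Fin q) F),
      T.BlockTriangular id ∧ (∀ i, T i i = algebraMap ℝ F (Real.exp (s i))) ∧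
      topRows t (u : Matrix (Fin q) (Fin q) F) (v : Matrix (Fin p) (Fin p) F) =
        (k₁ : Matrix (Fin q) (Fin q) F) * T ∧
      ∃ n ∈ groupN F p q, aMat F p t * blockU u v = blockU k₁ k₂ * aMat F p s * n := by
  set g := aMat F p t * blockU u v with hgdef
  have hg : gᴴ * formJ F p q * g = formJ F p q := aMat_blockU_form t u v
  obtain ⟨k₁, T, s, hT, hs, hk₁⟩ := exists_unitary_mul_positive_triangular
    (topRows_injective hqp t u v)
  obtain ⟨Y, hY, -⟩ := exists_right_inverse (topRows_injective hqp t u v)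
  set S := Y * (k₁ : Matrix (Fin q) (Fin q) F) with hS
  have hTS : T * S = 1 := by
    rw [hk₁] at hY
    have h1 : T * Y = (k₁ : Matrix (Fin q) (Fin q) F)ᴴ := by
      calc _ = (k₁ : Matrix (Fin q) (Fin q) F)ᴴ * ((k₁ : Matrix (Fin q) (Fin q) F) * T * Y) := by
            rw [Matrix.mul_assoc, ← Matrix.mul_assoc, unitary_conjTranspose_mul, Matrix.one_mul]
        _ = _ := by rw [hY, Matrix.mul_one]
    rw [hS, ← Matrix.mul_assoc, h1, unitary_conjTranspose_mul]
  have hST : S * T = 1 := mul_eq_one_comm.mp hTS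
  have htop : (g * ePlus F p q).toRows₁ = (k₁ : Matrix (Fin q) (Fin q) F) * T := by
    rw [← hk₁, hgdef, toRows₁_aMat_mul hqp]
  -- After division by T the lower rows form an orthonormal frame, which some k₂ carries to the
  -- standard one.
  have hV : ((g * ePlus F p q).toRows₂ * S)ᴴ * ((g * ePlus F p q).toRows₂ * S) = 1 := by
    calc _ = Sᴴ * (((g * ePlus F p q).toRows₂)ᴴ * (g * ePlus F p q).toRows₂) * S := by
          rw [conjTranspose_mul]; simp only [Matrix.mul_assoc]
      _ = Sᴴ * (Tᴴ * T) * S := by rw [← toRows_gram_eq hqp hg, htop, gram_unitary_mul]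
      _ = (T * S)ᴴ * (T * S) := by rw [conjTranspose_mul T S]; simp only [Matrix.mul_assoc]
      _ = 1 := by rw [hTS]; simp
  obtain ⟨k₂, hk₂⟩ := exists_unitary_mul_inclusion hqp hV
  have hbot : (g * ePlus F p q).toRows₂ =
      (k₂ : Matrix (Fin p) (Fin p) F) * inclusion F p q * T := by
    rw [← hk₂, Matrix.mul_assoc (g * ePlus F p q).toRows₂ S T, hST, Matrix.mul_one]
  have hgE : g * ePlus F p q = blockU k₁ k₂ * ePlus F p q * T := by
    rw [← fromRows_toRows (g * ePlus F p q), htop, hbot, blockU, ePlus, fromBlocks_mul_fromRows,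
      fromRows_mul]
    simp
  set D := realDiag F fun i => Real.exp (-s i) with hD
  set D' := realDiag F fun i => Real.exp (s i) with hD'
  have hDD' : D' * D = 1 := by
    rw [hD, hD', realDiag_mul_realDiag, ← realDiag_one]
    congr 1
    ext i
    simp [← Real.exp_add]
  have hD'D : D * D' = 1 := mul_eq_one_comm.mp hDD'
  set g' := aMat F p (-s) * (blockU k₁ k₂)ᴴ * g with hg'def
  have hkk : blockU k₁ k₂ * (blockU k₁ k₂)ᴴ = 1 := mul_eq_one_comm.mp (blockU_gram k₁ k₂)
  have hg'E : g' * ePlus F p q = ePlus F p q * (D * T) := by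
    rw [hg'def, Matrix.mul_assoc, hgE, Matrix.mul_assoc, Matrix.mul_assoc, ← Matrix.mul_assoc _ᴴ,
      blockU_gram, Matrix.one_mul, ← Matrix.mul_assoc, aMat_mul_ePlus hqp, Matrix.mul_assoc]
    rfl
  have hbs : blockU k₁ k₂ * formJ F p q * (blockU k₁ k₂)ᴴ = formJ F p q := by
    simp [blockU, formJ, fromBlocks_conjTranspose, fromBlocks_multiply, unitary_mul_conjTranspose]
  have hg'J : g'ᴴ * formJ F p q * g' = formJ F p q := by
    calc _ = gᴴ * blockU k₁ k₂ * ((aMat F p (-s))ᴴ * formJ F p q * aMat F p (-s)) *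
          (blockU k₁ k₂)ᴴ * g := by
          rw [hg'def, conjTranspose_mul (aMat F p (-s) * (blockU k₁ k₂)ᴴ) g,
            conjTranspose_mul (aMat F p (-s)), conjTranspose_conjTranspose]
          simp only [Matrix.mul_assoc]
      _ = gᴴ * (blockU k₁ k₂ * formJ F p q * (blockU k₁ k₂)ᴴ) * g := by
          rw [aMat_gram]; simp only [Matrix.mul_assoc]
      _ = _ := by rw [hbs, hg]
  obtain ⟨v₀, hcomm, n, hn, hg'n⟩ := exists_unipotent hqp hg'J hg'E
    (fun i j hij => by rw [hD, realDiag_mul_apply, hT hij, smul_zero])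
    (fun i => by
      rw [hD, realDiag_mul_apply, hs, Algebra.smul_def, ← map_mul, ← Real.exp_add]
      simp)
    (S := S * D') (by
      rw [Matrix.mul_assoc, ← Matrix.mul_assoc T, hTS, Matrix.one_mul, hD'D])
  -- The factor diag(1, v₀) commutes with a_s and is moved to the left into the unitary part.
  refine ⟨k₁, k₂ * v₀, s, T, hT, hs, hk₁, n, hn, ?_⟩
  have ha : aMat F p s * aMat F p (-s) = 1 := mul_eq_one_comm.mp (aMat_neg_mul s)
  calc g = blockU k₁ k₂ * (aMat F p s * g') := by
        rw [hg'def, ← Matrix.mul_assoc (aMat F p s), ← Matrix.mul_assoc (aMat F p s), ha,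
          Matrix.one_mul, ← Matrix.mul_assoc, hkk, Matrix.one_mul]
    _ = blockU k₁ k₂ * (blockU 1 v₀ * aMat F p s * n) := by
        rw [hg'n, ← hcomm, Matrix.mul_assoc (aMat F p s)]
    _ = _ := by
        rw [Matrix.mul_assoc, ← Matrix.mul_assoc (blockU k₁ k₂), blockU_mul, mul_one,
          Matrix.mul_assoc]

end Iwasawa

/-- The properties of the maximal compact subgroup on which the integral formulas depend. -/
class CompactLaws (F : Type) [NormedDivisionRing F] [NormedAlgebra ℝ F] [StarRing F] [CStarRing F]
    [FiniteDimensional ℝ F] [MeasureSpace F] [BorelSpace F] [Scalars F] : Prop where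
  exists_mul : ∀ {p q : ℕ}, q < p → ∀ (u : U F q) (v : U F p),
    ∃ k ∈ Scalars.K (F := F) p q, ∃ (d : Fin q → F) (hd : ∀ i, ‖d i‖ = 1) (w : U F p),
      (w : Matrix (Fin p) (Fin p) F) * inclusion F p q = inclusion F p q * diagonal d ∧
      u = k.1 * unitaryDiagonal d hd ∧ v = k.2 * w
  mem_K : ∀ {p q : ℕ}, q ≤ p → ∀ (t s : Fin q → ℝ) (u k₁ : U F q) (v k₂ : U F p)
    (T : Matrix (Fin q) (Fin q) F) (n : BigMat F p q), (u, v) ∈ Scalars.K (F := F) p q →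
    T.BlockTriangular id → (∀ i, T i i = algebraMap ℝ F (Real.exp (s i))) →
    topRows t (u : Matrix (Fin q) (Fin q) F) (v : Matrix (Fin p) (Fin p) F) =
        (k₁ : Matrix (Fin q) (Fin q) F) * T →
    n ∈ groupN F p q → aMat F p t * blockU u v = blockU k₁ k₂ * aMat F p s * n →
    (k₁, k₂) ∈ Scalars.K (F := F) p q

section Existence

variable {F : Type} [NormedDivisionRing F] [NormedAlgebra ℝ F] [StarRing F] [CStarRing F]
  [FiniteDimensional ℝ F] [MeasureSpace F] [BorelSpace F] [Scalars F]

theorem exists_isAbelianPart [CompactLaws F] {p q : ℕ} (hqp : q ≤ p) (t : Fin q → ℝ)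
    (k : Scalars.K (F := F) p q) : ∃ s, IsAbelianPart F (aMat F p t * blockK F k) s := by
  obtain ⟨k₁, k₂, s, T, hT, hs, hk, n, hn, h⟩ := exists_iwasawa hqp t k.1.1 k.1.2
  exact ⟨s, ⟨(k₁, k₂), CompactLaws.mem_K hqp t s _ _ _ _ T n k.2 hT hs hk hn h⟩, n, hn, h⟩

end Existence

/-! ### Averages over compact groups -/

section Averaging

theorem haarMeasure_top_apply_univ {G : Type*} [Group G] [TopologicalSpace G] [IsTopologicalGroup G]
    [CompactSpace G] [MeasurableSpace G] [BorelSpace G] :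
    (Measure.haarMeasure (⊤ : TopologicalSpace.PositiveCompacts G)) Set.univ = 1 :=
  Measure.haarMeasure_self

/-- Compact groups are unimodular: a right translate of Haar probability is again a Haar probability
measure, and there is only one. -/
theorem isMulRightInvariant_of_compact {G : Type*} [Group G] [TopologicalSpace G]
    [IsTopologicalGroup G] [CompactSpace G] [MeasurableSpace G] [BorelSpace G] (μ : Measure G)
    [μ.IsHaarMeasure] [IsProbabilityMeasure μ] : μ.IsMulRightInvariant := by
  refine ⟨fun g => ?_⟩
  have hm : Measurable fun x : G => x * g := (continuous_mul_const g).measurable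
  have : IsProbabilityMeasure (μ.map (· * g)) := Measure.isProbabilityMeasure_map hm.aemeasurable
  have : (μ.map (· * g)).IsHaarMeasure := by
    have h := (Homeomorph.mulRight g).symm
    refine { lt_top_of_isCompact := fun K _ => measure_lt_top _ _, open_pos := ?_ }
    intro O hO hne
    rw [Measure.map_apply hm hO.measurableSet]
    refine (hO.preimage (continuous_mul_const g)).measure_ne_zero μ ?_
    obtain ⟨x, hx⟩ := hne
    exact ⟨x * g⁻¹, by simpa using hx⟩
  exact Measure.isHaarMeasure_eq_of_isProbabilityMeasure _ _

/-- If `G = ι(H) S` and `Φ` is right invariant under `S`, then `Φ` has the same average over `G`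
and over the compact group `H`. -/
theorem integral_comp_eq_of_exists_mul {G H : Type*} [Group G] [TopologicalSpace G]
    [IsTopologicalGroup G] [CompactSpace G] [SecondCountableTopology G] [MeasurableSpace G]
    [BorelSpace G] [Group H] [TopologicalSpace H] [IsTopologicalGroup H]
    [SecondCountableTopology H] [CompactSpace H] [MeasurableSpace H] [BorelSpace H]
    (μ : Measure G) [μ.IsMulLeftInvariant] [IsProbabilityMeasure μ] (ν : Measure H)
    [ν.IsMulRightInvariant] [IsProbabilityMeasure ν] (ι : H →* G) (hι : Continuous ι)
    (S : Set G) (hS : ∀ g : G, ∃ h : H, ∃ s ∈ S, g = ι h * s) {Φ : G → ℂ} (hΦ : Continuous Φ)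
    (hΦS : ∀ g, ∀ s ∈ S, Φ (g * s) = Φ g) :
    ∫ h, Φ (ι h) ∂ν = ∫ g, Φ g ∂μ := by
  have h1 : ∀ g : G, ∫ h, Φ (ι h * g) ∂ν = ∫ h, Φ (ι h) ∂ν := by
    intro g
    obtain ⟨h', s, hs, rfl⟩ := hS g
    calc ∫ h, Φ (ι h * (ι h' * s)) ∂ν = ∫ h, Φ (ι (h * h')) ∂ν := by
          refine integral_congr_ae (Filter.Eventually.of_forall fun h => ?_)
          simp only
          rw [← mul_assoc, hΦS _ s hs, map_mul]
      _ = _ := integral_mul_right_eq_self (fun h => Φ (ι h)) h'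
  have h2 : ∀ h : H, ∫ g, Φ (ι h * g) ∂μ = ∫ g, Φ g ∂μ := fun h =>
    integral_mul_left_eq_self (fun g => Φ g) (ι h)
  have hint : Integrable (Function.uncurry fun (h : H) (g : G) => Φ (ι h * g)) (ν.prod μ) := by
    refine Continuous.integrable_of_hasCompactSupport ?_ (HasCompactSupport.of_compactSpace _)
    exact hΦ.comp ((hι.comp continuous_fst).mul continuous_snd)
  -- In the double integral of Φ(ι(h) g), the inner integral over h is independent of g and the
  -- inner integral over g is independent of h.
  have h3 := integral_integral_swap hint
  simp only [h1, h2, integral_const, probReal_univ, one_smul] at h3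
  exact h3.symm

end Averaging

/-! ### Reduction of the spherical function to an average over unitary groups -/

section Spherical

variable {F : Type} [NormedDivisionRing F] [NormedAlgebra ℝ F] [StarRing F] [CStarRing F]
  [FiniteDimensional ℝ F] [MeasureSpace F] [BorelSpace F] [Scalars F]

instance instSecondCountableU (n : ℕ) : SecondCountableTopology (U F n) := by
  have : ProperSpace F := FiniteDimensional.proper_real F
  exact TopologicalSpace.Subtype.secondCountableTopology
    (unitary (Matrix (Fin n) (Fin n) F) : Set (Matrix (Fin n) (Fin n) F))

instance instSecondCountableU₀ (n : ℕ) : SecondCountableTopology (U₀ F n) :=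
  TopologicalSpace.Subtype.secondCountableTopology (U₀ F n : Set (U F n))

instance instSecondCountableK (p q : ℕ) : SecondCountableTopology (Scalars.K (F := F) p q) :=
  TopologicalSpace.Subtype.secondCountableTopology (Scalars.K (F := F) p q : Set (U F q × U F p))

instance instBorelSpaceU (n : ℕ) : BorelSpace (U F n) := by
  have : ProperSpace F := FiniteDimensional.proper_real F
  infer_instance

variable (F) in
/-- The normalized Haar measure of `U(n, F)`. -/
def haarU (n : ℕ) : Measure (U F n) := Measure.haarMeasure ⊤

instance (n : ℕ) : (haarU F n).IsHaarMeasure := by unfold haarU; infer_instance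
instance (n : ℕ) : IsProbabilityMeasure (haarU F n) := ⟨haarMeasure_top_apply_univ⟩
instance (n : ℕ) : (haarU F n).IsMulRightInvariant := isMulRightInvariant_of_compact _
instance (n : ℕ) : (haarU₀ F n).IsHaarMeasure := by unfold haarU₀; infer_instance
instance (n : ℕ) : IsProbabilityMeasure (haarU₀ F n) := ⟨haarMeasure_top_apply_univ⟩
instance (n : ℕ) : (haarU₀ F n).IsMulRightInvariant := isMulRightInvariant_of_compact _
instance (p q : ℕ) : (haarK F p q).IsHaarMeasure := by unfold haarK; infer_instance
instance (p q : ℕ) : IsProbabilityMeasure (haarK F p q) := ⟨haarMeasure_top_apply_univ⟩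
instance (p q : ℕ) : (haarK F p q).IsMulRightInvariant := isMulRightInvariant_of_compact _

variable {p q : ℕ}

variable [ScalarsLaws F]

/-- Right multiplication by a diagonal unitary matrix keeps the QR factor triangular and does not
change the moduli of its diagonal. -/
theorem powerFunction_gram_mul_diagonal {X : Matrix (Fin q) (Fin q) F}
    (hX : ∀ x : Fin q → F, X *ᵥ x = 0 → x = 0) {d : Fin q → F} (hd : ∀ i, ‖d i‖ = 1)
    (mu : Fin q → ℂ) :
    powerFunction mu ((X * diagonal d)ᴴ * (X * diagonal d)) = powerFunction mu (Xᴴ * X) := by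
  obtain ⟨k, T, s, hT, hs, hk⟩ := exists_unitary_mul_positive_triangular hX
  have hs' : ∀ i, ‖T i i‖ = Real.exp (s i) := fun i => by
    rw [hs, norm_algebraMap', Real.norm_of_nonneg (Real.exp_pos _).le]
  rw [powerFunction_gram hk hT hs', powerFunction_gram (X := X * diagonal d) (T := T * diagonal d)
    (k := k) (s := s)]
  · rw [hk, Matrix.mul_assoc]
  · intro i j hij
    rw [mul_diagonal, hT hij, zero_mul]
  · intro i
    rw [mul_diagonal, norm_mul, hd, mul_one, hs']

/-- The power function of the Gram matrix of the upper block of `a_t k e₊`. -/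
def gramPower (mu : Fin q → ℂ) (t : Fin q → ℝ) (x : U F q × U F p) : ℂ :=
  powerFunction mu
    ((topRows t (x.1 : Matrix (Fin q) (Fin q) F) (x.2 : Matrix (Fin p) (Fin p) F))ᴴ *
      topRows t (x.1 : Matrix (Fin q) (Fin q) F) (x.2 : Matrix (Fin p) (Fin p) F))

theorem continuous_gramPower (hqp : q ≤ p) (mu : Fin q → ℂ) (t : Fin q → ℝ) :
    Continuous (gramPower mu t : U F q × U F p → ℂ) := by
  rw [continuous_iff_continuousAt]
  intro x
  have h := continuousAt_powerFunction_gram (topRows_injective hqp t x.1 x.2) mu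
  have hc : Continuous fun x : U F q × U F p =>
      topRows t (x.1 : Matrix (Fin q) (Fin q) F) (x.2 : Matrix (Fin p) (Fin p) F) := by
    unfold topRows corner
    fun_prop
  have hc' : Continuous fun x : U F q × U F p =>
      (topRows t (x.1 : Matrix (Fin q) (Fin q) F) (x.2 : Matrix (Fin p) (Fin p) F))ᴴ *
      topRows t (x.1 : Matrix (Fin q) (Fin q) F) (x.2 : Matrix (Fin p) (Fin p) F) := by
    fun_prop
  exact ContinuousAt.comp (f := fun x : U F q × U F p =>
      (topRows t (x.1 : Matrix (Fin q) (Fin q) F) (x.2 : Matrix (Fin p) (Fin p) F))ᴴ *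
      topRows t (x.1 : Matrix (Fin q) (Fin q) F) (x.2 : Matrix (Fin p) (Fin p) F))
      (g := powerFunction mu) h hc'.continuousAt

theorem corner_mul {v w : Matrix (Fin p) (Fin p) F} {D : Matrix (Fin q) (Fin q) F}
    (hw : w * inclusion F p q = inclusion F p q * D) : corner q (v * w) = corner q v * D := by
  rw [corner, corner, Matrix.mul_assoc, Matrix.mul_assoc v, hw]
  simp only [Matrix.mul_assoc]

theorem topRows_mul (t : Fin q → ℝ) (u : Matrix (Fin q) (Fin q) F)
    {v w : Matrix (Fin p) (Fin p) F} {D : Matrix (Fin q) (Fin q) F}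
    (hw : w * inclusion F p q = inclusion F p q * D) :
    topRows t (u * D) (v * w) = topRows t u v * D := by
  rw [topRows, topRows, corner_mul hw, Matrix.add_mul, Matrix.mul_assoc, Matrix.mul_assoc]

theorem gramPower_mul (hqp : q ≤ p) (mu : Fin q → ℂ) (t : Fin q → ℝ) (x : U F q × U F p)
    {d : Fin q → F} (hd : ∀ i, ‖d i‖ = 1) {w : U F p}
    (hw : (w : Matrix (Fin p) (Fin p) F) * inclusion F p q = inclusion F p q * diagonal d) :
    gramPower mu t (x * (unitaryDiagonal d hd, w)) = gramPower mu t x := by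
  rw [gramPower, gramPower, Prod.fst_mul, Prod.snd_mul, Submonoid.coe_mul, Submonoid.coe_mul,
    coe_unitaryDiagonal, topRows_mul t _ hw,
    powerFunction_gram_mul_diagonal (topRows_injective hqp t x.1 x.2) hd]

variable (F) in
/-- The elements `(D, w)` with a diagonal matrix `D`, and with `D` as the upper left block of `w`. -/
def diagonalPairs (p q : ℕ) : Set (U F q × U F p) :=
  {s | ∃ (d : Fin q → F) (hd : ∀ i, ‖d i‖ = 1) (w : U F p),
    (w : Matrix (Fin p) (Fin p) F) * inclusion F p q = inclusion F p q * diagonal d ∧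
      s = (unitaryDiagonal d hd, w)}

theorem gramPower_mul_mem (hqp : q ≤ p) (mu : Fin q → ℂ) (t : Fin q → ℝ) (x : U F q × U F p) :
    ∀ s ∈ diagonalPairs F p q, gramPower mu t (x * s) = gramPower mu t x := by
  rintro _ ⟨d, hd, w, hw, rfl⟩
  exact gramPower_mul hqp mu t x hd hw

theorem exists_extension (hqp : q ≤ p) (u : U F q) : ∃ w : U F p,
    (w : Matrix (Fin p) (Fin p) F) * inclusion F p q =
      inclusion F p q * (u : Matrix (Fin q) (Fin q) F) := by
  obtain ⟨w, hw⟩ := exists_unitary_mul_inclusion hqp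
    (V := inclusion F p q * (u : Matrix (Fin q) (Fin q) F)) (by
      rw [conjTranspose_mul, Matrix.mul_assoc, ← Matrix.mul_assoc _ (inclusion F p q),
        inclusion_gram hqp, Matrix.one_mul, unitary_conjTranspose_mul])
  exact ⟨w, hw.symm⟩

theorem harishChandraIntegrand_eq_gramPower [CompactLaws F] (hqp : q ≤ p) (lam : Fin q → ℂ)
    (t : Fin q → ℝ) : harishChandraIntegrand F lam (aMat F p t) =
      fun k : Scalars.K (F := F) p q => gramPower (fun i => spectral F p lam i / 2) t k.1 :=
  funext fun k => harishChandraIntegrand_eq hqp lam t k (exists_isAbelianPart hqp t k)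

theorem integrable_harishChandraIntegrand [CompactLaws F] (hqp : q ≤ p) (lam : Fin q → ℂ)
    (t : Fin q → ℝ) : Integrable (harishChandraIntegrand F lam (aMat F p t)) (haarK F p q) := by
  rw [harishChandraIntegrand_eq_gramPower hqp]
  exact ((continuous_gramPower hqp _ t).comp continuous_subtype_val).integrable_of_hasCompactSupport
    (HasCompactSupport.of_compactSpace _)

/-- The strict inequality leaves a free coordinate in which determinants can be corrected, so that K
and the pairs (D, w) together exhaust U(q) × U(p). -/
theorem sphericalFunction_eq_integral_gramPower [CompactLaws F] (hqp : q < p) (lam : Fin q → ℂ)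
    (t : Fin q → ℝ) : sphericalFunction F lam (aMat F p t) =
      ∫ x, gramPower (fun i => spectral F p lam i / 2) t x ∂((haarU F q).prod (haarU F p)) := by
  rw [sphericalFunction, harishChandraIntegrand_eq_gramPower hqp.le]
  refine integral_comp_eq_of_exists_mul ((haarU F q).prod (haarU F p)) (haarK F p q)
    (Scalars.K (F := F) p q).subtype continuous_subtype_val (diagonalPairs F p q) ?_
    (continuous_gramPower hqp.le _ t) (gramPower_mul_mem hqp.le _ t)
  rintro ⟨u, v⟩
  obtain ⟨k, hk, d, hd, w, hw, h1, h2⟩ := CompactLaws.exists_mul hqp u v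
  exact ⟨⟨k, hk⟩, _, ⟨d, hd, w, hw, rfl⟩, Prod.ext h1 h2⟩

theorem coshSinh_eq_topRows (t : Fin q → ℝ) (v : Matrix (Fin p) (Fin p) F) :
    coshSinh t (corner q v) = topRows t 1 v := by
  rw [topRows, Matrix.mul_one]
  rfl

theorem gMat_eq (t : Fin q → ℝ) (u : U₀ F q) (w : Matrix (Fin q) (Fin q) F) :
    gMat t u w = (coshSinh t w * ((u.1 : U F q) : Matrix (Fin q) (Fin q) F))ᴴ *
      (coshSinh t w * ((u.1 : U F q) : Matrix (Fin q) (Fin q) F)) := by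
  rw [gMat, coe_unitary_inv, conjTranspose_mul]
  simp only [Matrix.mul_assoc]

theorem gMatTilde_eq (t : Fin q → ℝ) (u : U₀ F q) (w : Matrix (Fin q) (Fin q) F) :
    gMatTilde t u w = ((coshSinh t w)ᴴ * ((u.1 : U F q) : Matrix (Fin q) (Fin q) F))ᴴ *
      ((coshSinh t w)ᴴ * ((u.1 : U F q) : Matrix (Fin q) (Fin q) F)) := by
  rw [gMatTilde, coe_unitary_inv, conjTranspose_mul, conjTranspose_conjTranspose]
  simp only [Matrix.mul_assoc]

theorem powerFunction_gMat_corner (mu : Fin q → ℂ) (t : Fin q → ℝ) (u : U₀ F q) (v w : U F p)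
    (hw : (w : Matrix (Fin p) (Fin p) F) * inclusion F p q =
      inclusion F p q * ((u.1 : U F q) : Matrix (Fin q) (Fin q) F)) :
    powerFunction mu (gMat t u (corner q (v : Matrix (Fin p) (Fin p) F))) =
      gramPower mu t (u.1, v * w) := by
  rw [gramPower, gMat_eq, coshSinh_eq_topRows, ← topRows_mul t _ hw, Matrix.one_mul]
  rfl

theorem mul_unitary_injective {X : Matrix (Fin q) (Fin q) F}
    (hX : ∀ x : Fin q → F, X *ᵥ x = 0 → x = 0) (u : U F q) (x : Fin q → F)
    (hx : (X * (u : Matrix (Fin q) (Fin q) F)) *ᵥ x = 0) : x = 0 := by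
  rw [← mulVec_mulVec] at hx
  have h := congrArg (fun y => (u : Matrix (Fin q) (Fin q) F)ᴴ *ᵥ y) (hX _ hx)
  simpa [mulVec_mulVec, unitary_conjTranspose_mul] using h

theorem coshSinh_injective (hqp : q ≤ p) (t : Fin q → ℝ) (v : U F p) (x : Fin q → F)
    (hx : coshSinh t (corner q (v : Matrix (Fin p) (Fin p) F)) *ᵥ x = 0) : x = 0 := by
  rw [coshSinh_eq_topRows] at hx
  exact topRows_injective hqp t 1 v x hx

theorem conjTranspose_injective {X : Matrix (Fin q) (Fin q) F}
    (hX : ∀ x : Fin q → F, X *ᵥ x = 0 → x = 0) (x : Fin q → F) (hx : Xᴴ *ᵥ x = 0) : x = 0 := by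
  obtain ⟨Y, hY, -⟩ := exists_right_inverse hX
  have h : Yᴴ * Xᴴ = 1 := by rw [← conjTranspose_mul, hY, conjTranspose_one]
  have := congrArg (fun y => Yᴴ *ᵥ y) hx
  simpa [mulVec_mulVec, h] using this

theorem continuous_corner : Continuous fun v : U F p =>
    corner q (v : Matrix (Fin p) (Fin p) F) := by
  unfold corner
  fun_prop

theorem continuous_coshSinh (t : Fin q → ℝ) :
    Continuous (coshSinh t : Matrix (Fin q) (Fin q) F → Matrix (Fin q) (Fin q) F) := by
  unfold coshSinh
  fun_prop

theorem continuous_powerFunction_of_injective {α : Type*} [TopologicalSpace α] (mu : Fin q → ℂ)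
    {X : α → Matrix (Fin q) (Fin q) F} (hc : Continuous X)
    (hX : ∀ a, ∀ x : Fin q → F, X a *ᵥ x = 0 → x = 0) :
    Continuous fun a => powerFunction mu ((X a)ᴴ * X a) := by
  rw [continuous_iff_continuousAt]
  intro a
  have hc' : Continuous fun a => (X a)ᴴ * X a := by fun_prop
  exact ContinuousAt.comp (f := fun a => (X a)ᴴ * X a) (g := powerFunction mu)
    (continuousAt_powerFunction_gram (hX a) mu) hc'.continuousAt

theorem continuous_powerFunction_gMat (hqp : q ≤ p) (mu : Fin q → ℂ) (t : Fin q → ℝ) :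
    Continuous fun x : U₀ F q × U F p =>
      powerFunction mu (gMat t x.1 (corner q (x.2 : Matrix (Fin p) (Fin p) F))) := by
  simp only [gMat_eq]
  refine continuous_powerFunction_of_injective mu ?_ fun x =>
    mul_unitary_injective (coshSinh_injective hqp t x.2) x.1.1
  have h1 := (continuous_coshSinh (F := F) t).comp (continuous_corner (p := p))
  have h2 : Continuous fun x : U₀ F q × U F p =>
      coshSinh t (corner q (x.2 : Matrix (Fin p) (Fin p) F)) := h1.comp continuous_snd
  fun_prop

theorem continuous_powerFunction_gMatTilde (hqp : q ≤ p) (mu : Fin q → ℂ) (t : Fin q → ℝ) :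
    Continuous fun x : U₀ F q × U F p =>
      powerFunction mu (gMatTilde t x.1 (corner q (x.2 : Matrix (Fin p) (Fin p) F))) := by
  simp only [gMatTilde_eq]
  refine continuous_powerFunction_of_injective mu ?_ fun x =>
    mul_unitary_injective (conjTranspose_injective (coshSinh_injective hqp t x.2)) x.1.1
  have h1 := (continuous_coshSinh (F := F) t).comp (continuous_corner (p := p))
  have h2 : Continuous fun x : U₀ F q × U F p =>
      coshSinh t (corner q (x.2 : Matrix (Fin p) (Fin p) F)) := h1.comp continuous_snd
  fun_prop

/-- First U(q) is replaced by its identity component, using invariance under diagonal pairs; then,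
for fixed u, the translation of v by an extension of u produces g_t. -/
theorem integral_powerFunction_gMat (hqp : q ≤ p) (mu : Fin q → ℂ) (t : Fin q → ℝ) :
    ∫ x : U₀ F q × U F p, powerFunction mu
        (gMat t x.1 (corner q (x.2 : Matrix (Fin p) (Fin p) F))) ∂((haarU₀ F q).prod (haarU F p)) =
      ∫ x, gramPower mu t x ∂((haarU F q).prod (haarU F p)) := by
  have h1 : ∫ x : U₀ F q × U F p, gramPower mu t (x.1.1, x.2)
      ∂((haarU₀ F q).prod (haarU F p)) =
      ∫ x, gramPower mu t x ∂((haarU F q).prod (haarU F p)) := by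
    refine integral_comp_eq_of_exists_mul ((haarU F q).prod (haarU F p))
      ((haarU₀ F q).prod (haarU F p)) ((U₀ F q).subtype.prodMap (MonoidHom.id (U F p)))
      (continuous_subtype_val.prodMap continuous_id) (diagonalPairs F p q) ?_
      (continuous_gramPower hqp _ t) (gramPower_mul_mem hqp _ t)
    rintro ⟨u, v⟩
    obtain ⟨g, hg, d, hd, rfl⟩ := exists_connected_mul_diagonal u
    obtain ⟨w, hw⟩ := exists_extension hqp (unitaryDiagonal d hd)
    exact ⟨(⟨g, hg⟩, v * w⁻¹), _, ⟨d, hd, w, hw, rfl⟩, Prod.ext rfl (by simp)⟩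
  have hc : Continuous fun x : U₀ F q × U F p => gramPower mu t (x.1.1, x.2) :=
    (continuous_gramPower hqp mu t).comp (continuous_subtype_val.prodMap continuous_id)
  rw [← h1, integral_prod _ ((continuous_powerFunction_gMat hqp mu t).integrable_of_hasCompactSupport
    (HasCompactSupport.of_compactSpace _)), integral_prod _ (hc.integrable_of_hasCompactSupport
    (HasCompactSupport.of_compactSpace _))]
  refine integral_congr_ae (Filter.Eventually.of_forall fun u => ?_)
  obtain ⟨w, hw⟩ := exists_extension hqp u.1
  simp only [fun v => powerFunction_gMat_corner mu t u v w hw]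
  exact integral_mul_right_eq_self (fun v => gramPower mu t (u.1, v)) w

/-- The unitary matrix supplied by the polar decomposition need not lie in the identity component,
so the average is first enlarged to U(q). -/
theorem integral_gram_unitary {X : Matrix (Fin q) (Fin q) F}
    (hX : ∀ x : Fin q → F, X *ᵥ x = 0 → x = 0) (mu : Fin q → ℂ) :
    ∫ u : U₀ F q, powerFunction mu ((X * ((u.1 : U F q) : Matrix (Fin q) (Fin q) F))ᴴ *
      (X * ((u.1 : U F q) : Matrix (Fin q) (Fin q) F))) ∂(haarU₀ F q) =
    ∫ u : U F q, powerFunction mu ((X * (u : Matrix (Fin q) (Fin q) F))ᴴ *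
      (X * (u : Matrix (Fin q) (Fin q) F))) ∂(haarU F q) := by
  refine integral_comp_eq_of_exists_mul (haarU F q) (haarU₀ F q) (U₀ F q).subtype
    continuous_subtype_val {s | ∃ (d : Fin q → F) (hd : ∀ i, ‖d i‖ = 1), s = unitaryDiagonal d hd}
    ?_ (Φ := fun u : U F q => powerFunction mu ((X * (u : Matrix (Fin q) (Fin q) F))ᴴ *
      (X * (u : Matrix (Fin q) (Fin q) F)))) ?_ ?_
  · intro u
    obtain ⟨g, hg, d, hd, h⟩ := exists_connected_mul_diagonal u
    exact ⟨⟨g, hg⟩, _, ⟨d, hd, rfl⟩, h⟩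
  · exact continuous_powerFunction_of_injective mu (by fun_prop) fun u => mul_unitary_injective hX u
  · rintro u _ ⟨d, hd, rfl⟩
    simp only [Submonoid.coe_mul, coe_unitaryDiagonal]
    rw [← Matrix.mul_assoc X, powerFunction_gram_mul_diagonal (mul_unitary_injective hX u) hd]

/-- XX^* = k^*(X^*X)k, and the translation u ↦ ku removes k. -/
theorem integral_gram_conjTranspose (X : Matrix (Fin q) (Fin q) F) (mu : Fin q → ℂ) :
    ∫ u : U F q, powerFunction mu ((Xᴴ * (u : Matrix (Fin q) (Fin q) F))ᴴ *
      (Xᴴ * (u : Matrix (Fin q) (Fin q) F))) ∂(haarU F q) =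
    ∫ u : U F q, powerFunction mu ((X * (u : Matrix (Fin q) (Fin q) F))ᴴ *
      (X * (u : Matrix (Fin q) (Fin q) F))) ∂(haarU F q) := by
  obtain ⟨k, hk⟩ := exists_unitary_gram_eq X
  rw [← integral_mul_left_eq_self (fun u : U F q => powerFunction mu
    ((X * (u : Matrix (Fin q) (Fin q) F))ᴴ * (X * (u : Matrix (Fin q) (Fin q) F)))) k]
  refine integral_congr_ae (Filter.Eventually.of_forall fun u => ?_)
  simp only
  congr 1
  rw [conjTranspose_mul, conjTranspose_conjTranspose, Matrix.mul_assoc, ← Matrix.mul_assoc X, hk]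
  simp only [Submonoid.coe_mul, conjTranspose_mul, Matrix.mul_assoc]

theorem integral_powerFunction_gMatTilde (hqp : q ≤ p) (mu : Fin q → ℂ) (t : Fin q → ℝ) :
    ∫ x : U₀ F q × U F p, powerFunction mu
        (gMatTilde t x.1 (corner q (x.2 : Matrix (Fin p) (Fin p) F)))
        ∂((haarU₀ F q).prod (haarU F p)) =
      ∫ x : U₀ F q × U F p, powerFunction mu
        (gMat t x.1 (corner q (x.2 : Matrix (Fin p) (Fin p) F)))
        ∂((haarU₀ F q).prod (haarU F p)) := by
  rw [integral_prod_symm _ ((continuous_powerFunction_gMat hqp mu t).integrable_of_hasCompactSupport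
    (HasCompactSupport.of_compactSpace _)),
    integral_prod_symm _ ((continuous_powerFunction_gMatTilde hqp mu t).integrable_of_hasCompactSupport
    (HasCompactSupport.of_compactSpace _))]
  refine integral_congr_ae (Filter.Eventually.of_forall fun v => ?_)
  have hX := coshSinh_injective hqp t v
  simp only [gMat_eq, gMatTilde_eq]
  rw [integral_gram_unitary hX, integral_gram_unitary (conjTranspose_injective hX),
    integral_gram_conjTranspose]

end Spherical

/-! ### Radial integration on `F^n` -/

section Radial

open Set

variable {F : Type} [NormedDivisionRing F] [NormedAlgebra ℝ F]
  [FiniteDimensional ℝ F] [MeasureSpace F] [BorelSpace F]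

/-- The square of the euclidean norm. -/
def sqNorm {n : ℕ} (x : Fin n → F) : ℝ := ∑ i, ‖x i‖ ^ 2

theorem sqNorm_nonneg {n : ℕ} (x : Fin n → F) : 0 ≤ sqNorm x :=
  Finset.sum_nonneg fun _ _ => sq_nonneg _

theorem sqNorm_smul {n : ℕ} (r : ℝ) (x : Fin n → F) : sqNorm (r • x) = r ^ 2 * sqNorm x := by
  rw [sqNorm, sqNorm, Finset.mul_sum]
  refine Finset.sum_congr rfl fun i _ => ?_
  rw [Pi.smul_apply, norm_smul, mul_pow, Real.norm_eq_abs, sq_abs]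

theorem sqNorm_eq_zero {n : ℕ} {x : Fin n → F} : sqNorm x = 0 ↔ x = 0 := by
  rw [sqNorm, Finset.sum_eq_zero_iff_of_nonneg fun i _ => sq_nonneg _]
  simp [funext_iff]

theorem continuous_sqNorm {n : ℕ} : Continuous (sqNorm : (Fin n → F) → ℝ) := by
  unfold sqNorm
  fun_prop

theorem finrank_vector (n : ℕ) : Module.finrank ℝ (Fin n → F) = n * d F := by
  rw [Module.finrank_pi_fintype]
  simp [d]

theorem d_pos : 0 < d F := Module.finrank_pos

variable [ProperSpace F] [(volume : Measure F).IsAddHaarMeasure]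

theorem volume_sqNorm_le_one_lt_top (n : ℕ) :
    volume {x : Fin n → F | sqNorm x ≤ 1} < ⊤ := by
  refine (measure_mono ?_).trans_lt
    (isCompact_closedBall (0 : Fin n → F) 1).measure_lt_top
  intro x (hx : sqNorm x ≤ 1)
  rw [mem_closedBall_zero_iff, pi_norm_le_iff_of_nonneg zero_le_one]
  intro i
  have h : ‖x i‖ ^ 2 ≤ sqNorm x :=
    Finset.single_le_sum (f := fun i => ‖x i‖ ^ 2) (fun k _ => sq_nonneg _) (Finset.mem_univ i)
  nlinarith [norm_nonneg (x i)]

theorem volume_sqNorm_le {n : ℕ} (hn : 0 < n) {a : ℝ} (ha : 0 ≤ a) :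
    volume {x : Fin n → F | sqNorm x ≤ a} =
      ENNReal.ofReal (a ^ ((n * d F : ℕ) / 2 : ℝ)) * volume {x : Fin n → F | sqNorm x ≤ 1} := by
  have hD : (0 : ℝ) < (n * d F : ℕ) / 2 := by
    have := Nat.mul_pos hn (d_pos (F := F))
    positivity
  rcases ha.eq_or_lt with rfl | ha
  · have h0 : {x : Fin n → F | sqNorm x ≤ 0} = {0} := by
      ext x
      simp only [mem_ofPred_eq, mem_singleton_iff]
      rw [← sqNorm_eq_zero]
      exact ⟨fun h => le_antisymm h (sqNorm_nonneg x), fun h => h.le⟩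
    have : Nonempty (Fin n) := ⟨⟨0, hn⟩⟩
    rw [h0, measure_singleton, Real.zero_rpow hD.ne', ENNReal.ofReal_zero, zero_mul]
  · have hs : 0 < Real.sqrt a := Real.sqrt_pos.mpr ha
    have h1 : {x : Fin n → F | sqNorm x ≤ a} =
        ((Real.sqrt a)⁻¹ • ·) ⁻¹' {x : Fin n → F | sqNorm x ≤ 1} := by
      ext x
      simp only [mem_ofPred_eq, mem_preimage]
      rw [sqNorm_smul, inv_pow, Real.sq_sqrt ha.le, inv_mul_le_iff₀ ha, mul_one]
    rw [h1, Measure.addHaar_preimage_smul _ (inv_pos.mpr hs).ne', finrank_vector]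
    congr 2
    rw [inv_pow, inv_inv, abs_of_pos (by positivity), Real.sqrt_eq_rpow, ← Real.rpow_natCast,
      ← Real.rpow_mul ha.le]
    congr 1
    ring

theorem lintegral_Ioc_rpow {s a b : ℝ} (hs : 0 < s) (ha : 0 ≤ a) (hab : a ≤ b) :
    ∫⁻ t in Ioc a b, ENNReal.ofReal (t ^ (s - 1)) =
      ENNReal.ofReal ((b ^ s - a ^ s) / s) := by
  have hint : IntervalIntegrable (fun t : ℝ => t ^ (s - 1)) volume a b :=
    intervalIntegral.intervalIntegrable_rpow' (by linarith)
  rw [← ofReal_integral_eq_lintegral_ofReal ((intervalIntegrable_iff_integrableOn_Ioc_of_le hab).mp hint)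
    ((ae_restrict_mem measurableSet_Ioc).mono fun t ht =>
      Real.rpow_nonneg (ha.trans ht.1.le) _), ← intervalIntegral.integral_of_le hab,
    integral_rpow (Or.inl (by linarith))]
  simp

/-- Integration of radial functions. -/
theorem exists_lintegral_sqNorm {n : ℕ} (hn : 0 < n) : ∃ C : ENNReal, ∀ G : ℝ → ENNReal,
    Measurable G → ∫⁻ x : Fin n → F, G (sqNorm x) =
      C * ∫⁻ t in Ioi (0 : ℝ), G t * ENNReal.ofReal (t ^ (((n * d F : ℕ) : ℝ) / 2 - 1)) := by
  set s : ℝ := (n * d F : ℕ) / 2 with hs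
  have hspos : 0 < s := by
    have := Nat.mul_pos hn (d_pos (F := F))
    rw [hs]
    positivity
  set v := volume {x : Fin n → F | sqNorm x ≤ 1} with hv
  have hvtop : v < ⊤ := volume_sqNorm_le_one_lt_top n
  have hw : Measurable fun t : ℝ => ENNReal.ofReal (t ^ (s - 1)) := by fun_prop
  set C : ENNReal := v * ENNReal.ofReal s with hC
  have hle : ∀ a : ℝ, volume {x : Fin n → F | sqNorm x ≤ a} = ENNReal.ofReal ((max a 0) ^ s) * v := by
    intro a
    rcases le_total 0 a with h | h
    · rw [max_eq_left h, volume_sqNorm_le hn h]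
    · rw [max_eq_right h, ← volume_sqNorm_le hn le_rfl]
      rcases h.eq_or_lt with rfl | h
      · rfl
      · have h1 : {x : Fin n → F | sqNorm x ≤ a} = ∅ := by
          ext x
          simp only [mem_ofPred_eq, mem_empty_iff_false, iff_false, not_le]
          exact h.trans_le (sqNorm_nonneg x)
        rw [h1, measure_empty, volume_sqNorm_le hn le_rfl, Real.zero_rpow hspos.ne']
        simp
  have hfin : ∀ a : ℝ, volume {x : Fin n → F | sqNorm x ≤ a} ≠ ⊤ := fun a => by
    rw [hle]; exact ENNReal.mul_ne_top ENNReal.ofReal_ne_top hvtop.ne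
  -- The image of volume under the squared norm is compared with the density t^{s-1} on half-open
  -- intervals; both are multiples of differences of t^s. Truncation at 0 covers intervals reaching
  -- below zero.
  have key : (volume : Measure (Fin n → F)).map sqNorm =
      C • ((volume.restrict (Ioi (0 : ℝ))).withDensity fun t => ENNReal.ofReal (t ^ (s - 1))) := by
    have hIoc : ∀ a b : ℝ, a ≤ b → (volume : Measure (Fin n → F)).map sqNorm (Ioc a b) =
        ENNReal.ofReal ((max b 0) ^ s - (max a 0) ^ s) * v := by
      intro a b hab
      rw [Measure.map_apply continuous_sqNorm.measurable measurableSet_Ioc]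
      have h1 : sqNorm ⁻¹' Ioc a b =
          {x : Fin n → F | sqNorm x ≤ b} \ {x : Fin n → F | sqNorm x ≤ a} := by
        ext x
        simp only [mem_preimage, mem_Ioc, mem_sdiff, mem_ofPred_eq, not_le]
        tauto
      rw [h1, measure_sdiff
        (show {x : Fin n → F | sqNorm x ≤ a} ⊆ {x : Fin n → F | sqNorm x ≤ b} from
          fun x hx => le_trans hx hab)
        (measurableSet_le continuous_sqNorm.measurable measurable_const).nullMeasurableSet (hfin a),
        hle, hle, ENNReal.ofReal_sub _ (by positivity), ENNReal.sub_mul]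
      intro _ _
      exact hvtop.ne
    refine Measure.ext_of_Ioc' _ _ (fun a b hab => ?_) (fun a b hab => ?_)
    · rw [hIoc a b hab.le]
      exact ENNReal.mul_ne_top ENNReal.ofReal_ne_top hvtop.ne
    · rw [hIoc a b hab.le, Measure.smul_apply, withDensity_apply _ measurableSet_Ioc,
        Measure.restrict_restrict measurableSet_Ioc]
      have h2 : Ioc a b ∩ Ioi 0 = Ioc (max a 0) (max b 0) := by
        ext x
        simp only [mem_inter_iff, mem_Ioc, mem_Ioi, max_lt_iff, le_max_iff]
        constructor
        · rintro ⟨⟨h1, h2⟩, h3⟩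
          exact ⟨⟨h1, h3⟩, Or.inl h2⟩
        · rintro ⟨⟨h1, h3⟩, h2 | h2⟩
          · exact ⟨⟨h1, h2⟩, h3⟩
          · exact absurd h3 (not_lt.mpr h2)
      rw [h2, lintegral_Ioc_rpow hspos (le_max_right _ _) (max_le_max_right _ hab.le), hC,
        smul_eq_mul, mul_assoc, ← ENNReal.ofReal_mul hspos.le, mul_div_cancel₀ _ hspos.ne', mul_comm]
  refine ⟨C, fun G hG => ?_⟩
  rw [← lintegral_map hG continuous_sqNorm.measurable, key, lintegral_smul_measure,
    lintegral_withDensity_eq_lintegral_mul _ hw hG, smul_eq_mul]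
  congr 1
  refine lintegral_congr fun t => ?_
  rw [Pi.mul_apply, mul_comm]

theorem lintegral_smul_vector {n : ℕ} {r : ℝ} (hr : 0 < r) {f : (Fin n → F) → ENNReal}
    (hf : Measurable f) : ∫⁻ x : Fin n → F, f x =
      ENNReal.ofReal (r ^ (n * d F)) * ∫⁻ x : Fin n → F, f (r • x) := by
  have h := Measure.map_addHaar_smul (volume : Measure (Fin n → F)) hr.ne'
  have h1 : ∫⁻ x : Fin n → F, f (r • x) = ∫⁻ x, f x ∂(volume.map (r • · : (Fin n → F) → Fin n → F)) :=
    (lintegral_map hf (measurable_const_smul r)).symm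
  rw [h1, h, lintegral_smul_measure, smul_eq_mul, ← mul_assoc, finrank_vector,
    ← ENNReal.ofReal_mul (by positivity), abs_of_pos (by positivity),
    mul_inv_cancel₀ (by positivity), ENNReal.ofReal_one, one_mul]

/-- The joint distribution of the direction of the first `n` coordinates and of the norm, for a
vector with `n + k` coordinates. -/
theorem exists_lintegral_prod {n k : ℕ} (hk : 0 < k) : ∃ C : ENNReal, ∀ f : (Fin n → F) → ENNReal,
    Measurable f → ∫⁻ x : Fin n → F, ∫⁻ y : Fin k → F,
        (Ioc (0 : ℝ) 1).indicator (fun t => f ((Real.sqrt t)⁻¹ • x)) (sqNorm x + sqNorm y) =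
      C * ∫⁻ x : Fin n → F, {x : Fin n → F | sqNorm x < 1}.indicator
        (fun x => f x * ENNReal.ofReal ((1 - sqNorm x) ^ (((k * d F : ℕ) : ℝ) / 2 - 1))) x := by
  obtain ⟨C, hC⟩ := exists_lintegral_sqNorm (F := F) hk
  set e : ℝ := ((k * d F : ℕ) : ℝ) / 2 - 1 with he
  refine ⟨C * ∫⁻ t in Ioc (0 : ℝ) 1, ENNReal.ofReal (Real.sqrt t ^ (n * d F)) *
    ENNReal.ofReal (t ^ e), fun f hf => ?_⟩
  have hfm : Measurable fun z : ℝ × (Fin n → F) => f ((Real.sqrt z.1)⁻¹ • z.2) := by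
    refine hf.comp ?_
    fun_prop
  -- Integrate radially in y and substitute t = |x|² + |y|².
  have h1 : ∀ x : Fin n → F, ∫⁻ y : Fin k → F,
      (Ioc (0 : ℝ) 1).indicator (fun t => f ((Real.sqrt t)⁻¹ • x)) (sqNorm x + sqNorm y) =
      C * ∫⁻ t : ℝ, (Ioc (0 : ℝ) 1).indicator (fun t => {x : Fin n → F | sqNorm x < t}.indicator
        (fun x => f ((Real.sqrt t)⁻¹ • x) * ENNReal.ofReal ((t - sqNorm x) ^ e)) x) t := by
    intro x
    have hG : Measurable fun t : ℝ => (Ioc (0 : ℝ) 1).indicator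
        (fun t => f ((Real.sqrt t)⁻¹ • x)) (sqNorm x + t) :=
      ((hfm.comp (measurable_id.prodMk measurable_const)).indicator measurableSet_Ioc).comp
        (measurable_const_add _)
    rw [hC _ hG, ← lintegral_indicator measurableSet_Ioi]
    congr 1
    refine Eq.trans (lintegral_congr fun t => ?_) (lintegral_add_right_eq_self _ (sqNorm x))
    by_cases h : 0 < t
    · have h' : x ∈ {y : Fin n → F | sqNorm y < t + sqNorm x} := by simpa using h
      rw [indicator_of_mem (mem_Ioi.mpr h), add_comm (sqNorm x) t]
      by_cases h2 : t + sqNorm x ∈ Ioc (0 : ℝ) 1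
      · rw [indicator_of_mem h2, indicator_of_mem h2, indicator_of_mem h', add_sub_cancel_right]
      · rw [indicator_of_notMem h2, indicator_of_notMem h2, zero_mul]
    · have h' : x ∉ {y : Fin n → F | sqNorm y < t + sqNorm x} := by simpa using h
      rw [indicator_of_notMem (by simpa using h)]
      by_cases h2 : t + sqNorm x ∈ Ioc (0 : ℝ) 1
      · rw [indicator_of_mem h2, indicator_of_notMem h']
      · rw [indicator_of_notMem h2]
  simp only [h1]
  set Θ : (Fin n → F) → ℝ → ENNReal := fun x t => (Ioc (0 : ℝ) 1).indicator
    (fun t => {x : Fin n → F | sqNorm x < t}.indicator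
        (fun x => f ((Real.sqrt t)⁻¹ • x) * ENNReal.ofReal ((t - sqNorm x) ^ e)) x) t with hΘ
  have hΘm : Measurable (Function.uncurry Θ) := by
    have e1 : Function.uncurry Θ = ({z : (Fin n → F) × ℝ | z.2 ∈ Ioc (0 : ℝ) 1} ∩
        {z : (Fin n → F) × ℝ | sqNorm z.1 < z.2}).indicator (fun z =>
        f ((Real.sqrt z.2)⁻¹ • z.1) * ENNReal.ofReal ((z.2 - sqNorm z.1) ^ e)) := by
      ext ⟨x, t⟩
      simp only [Function.uncurry, hΘ]
      by_cases h1 : t ∈ Ioc (0 : ℝ) 1 <;> by_cases h2 : sqNorm x < t <;>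
        simp only [indicator, mem_ofPred_eq, mem_inter_iff, h1, h2] <;> simp
    rw [e1]
    have hN : Measurable fun z : (Fin n → F) × ℝ => sqNorm z.1 :=
      continuous_sqNorm.measurable.comp measurable_fst
    refine Measurable.indicator ?_ ((measurable_snd measurableSet_Ioc).inter
      (measurableSet_lt hN measurable_snd))
    refine (hfm.comp (measurable_snd.prodMk measurable_fst)).mul ?_
    exact ((measurable_snd.sub hN).pow_const e).ennreal_ofReal
  rw [lintegral_const_mul _ (Measurable.lintegral_prod_right' (f := fun z => Θ z.1 z.2) hΘm),
    mul_assoc]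
  congr 1
  rw [lintegral_lintegral_swap hΘm.aemeasurable]
  -- The scaling x ↦ √t x separates the variables: a power of t times an integral over the unit
  -- ball.
  have h2 : ∀ t : ℝ, ∫⁻ x : Fin n → F, Θ x t = (Ioc (0 : ℝ) 1).indicator (fun t =>
      (ENNReal.ofReal (Real.sqrt t ^ (n * d F)) * ENNReal.ofReal (t ^ e)) *
      ∫⁻ x : Fin n → F, {x : Fin n → F | sqNorm x < 1}.indicator
        (fun x => f x * ENNReal.ofReal ((1 - sqNorm x) ^ e)) x) t := by
    intro t
    by_cases h : t ∈ Ioc (0 : ℝ) 1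
    · have ht := h.1
      rw [indicator_of_mem h, lintegral_smul_vector (f := fun x => Θ x t) (Real.sqrt_pos.mpr ht)
        (hΘm.comp (measurable_id.prodMk measurable_const)), mul_assoc]
      congr 1
      rw [← lintegral_const_mul' _ _ ENNReal.ofReal_ne_top]
      · refine lintegral_congr fun x => ?_
        simp only [hΘ, indicator_of_mem h]
        have hN : sqNorm (Real.sqrt t • x) = t * sqNorm x := by
          rw [sqNorm_smul, Real.sq_sqrt ht.le]
        by_cases hx : sqNorm x < 1
        · have hx' : Real.sqrt t • x ∈ {x : Fin n → F | sqNorm x < t} := by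
            rw [mem_ofPred_eq, hN]; nlinarith
          have hx'' : x ∈ {x : Fin n → F | sqNorm x < 1} := hx
          rw [indicator_of_mem hx', indicator_of_mem hx'', smul_smul,
            inv_mul_cancel₀ (Real.sqrt_pos.mpr ht).ne', one_smul, hN]
          have e2 : t - t * sqNorm x = t * (1 - sqNorm x) := by ring
          rw [e2, Real.mul_rpow ht.le (by linarith), ENNReal.ofReal_mul (Real.rpow_nonneg ht.le _)]
          ring
        · have hx' : Real.sqrt t • x ∉ {x : Fin n → F | sqNorm x < t} := by
            rw [mem_ofPred_eq, hN]; push Not at hx ⊢; nlinarith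
          have hx'' : x ∉ {x : Fin n → F | sqNorm x < 1} := hx
          rw [indicator_of_notMem hx', indicator_of_notMem hx'', mul_zero]
    · simp only [hΘ, indicator_of_notMem h, lintegral_zero]
  simp only [h2]
  rw [lintegral_indicator measurableSet_Ioc, lintegral_mul_const]
  fun_prop

end Radial

/-! ### The distribution of a row of a random unitary matrix -/

section RowLaw

open Set

variable {F : Type} [NormedDivisionRing F] [NormedAlgebra ℝ F] [StarRing F] [CStarRing F]
  [FiniteDimensional ℝ F] [MeasureSpace F] [BorelSpace F] [Scalars F]

theorem sqNorm_mulVec_of_gram_eq {l m n : ℕ} {A : Matrix (Fin l) (Fin n) F}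
    {B : Matrix (Fin m) (Fin n) F} (h : Aᴴ * A = Bᴴ * B) (x : Fin n → F) :
    sqNorm (A *ᵥ x) = sqNorm (B *ᵥ x) :=
  sum_norm_sq_mulVec_of_gram_eq h x

theorem sqNorm_star {n : ℕ} (x : Fin n → F) : sqNorm (star x) = sqNorm x := by
  simp [sqNorm]

theorem sqNorm_vecMul_unitary {n : ℕ} (k : U F n) (x : Fin n → F) :
    sqNorm (x ᵥ* (k : Matrix (Fin n) (Fin n) F)) = sqNorm x := by
  rw [← sqNorm_star, star_vecMul, sqNorm_mulVec_of_gram_eq (B := (1 : Matrix (Fin n) (Fin n) F)),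
    one_mulVec, sqNorm_star]
  rw [conjTranspose_conjTranspose, unitary_mul_conjTranspose, conjTranspose_one, Matrix.mul_one]

/-- Right multiplication of row vectors by a matrix. -/
def vecMulMap {n : ℕ} (A : Matrix (Fin n) (Fin n) F) : (Fin n → F) →ₗ[ℝ] (Fin n → F) where
  toFun x := x ᵥ* A
  map_add' x y := add_vecMul A x y
  map_smul' c x := smul_vecMul c x A

theorem vecMulMap_apply {n : ℕ} (A : Matrix (Fin n) (Fin n) F) (x : Fin n → F) :
    vecMulMap A x = x ᵥ* A := rfl

theorem vecMulMap_mul {n : ℕ} (A B : Matrix (Fin n) (Fin n) F) :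
    vecMulMap (A * B) = vecMulMap B ∘ₗ vecMulMap A := by
  refine LinearMap.ext fun x => ?_
  simp [vecMulMap_apply, vecMul_vecMul]

theorem det_vecMulMap_diagonal {n : ℕ} (δ : Fin n → ℝ) :
    LinearMap.det (vecMulMap (diagonal fun i => algebraMap ℝ F (δ i))) = ∏ i, δ i ^ d F := by
  have h : vecMulMap (diagonal fun i => algebraMap ℝ F (δ i)) =
      LinearMap.pi fun i => (δ i • (LinearMap.id : F →ₗ[ℝ] F)).comp (LinearMap.proj i) := by
    refine LinearMap.ext fun x => funext fun i => ?_
    simp [vecMulMap_apply, vecMul_diagonal, Algebra.smul_def, Algebra.commutes]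
  rw [h, LinearMap.det_pi]
  simp [LinearMap.det_smul, d]

variable [ProperSpace F] [(volume : Measure F).IsAddHaarMeasure]

/-- The map preserves the euclidean unit ball, whose volume is positive and finite. -/
theorem abs_det_vecMulMap_unitary {n : ℕ} (k : U F n) :
    |LinearMap.det (vecMulMap (k : Matrix (Fin n) (Fin n) F))| = 1 := by
  have h0 : LinearMap.det (vecMulMap (k : Matrix (Fin n) (Fin n) F)) ≠ 0 := by
    have h1 := vecMulMap_mul (k : Matrix (Fin n) (Fin n) F) (k : Matrix (Fin n) (Fin n) F)ᴴ
    rw [unitary_mul_conjTranspose] at h1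
    have h2 : vecMulMap (1 : Matrix (Fin n) (Fin n) F) = LinearMap.id := by
      refine LinearMap.ext fun x => ?_
      simp [vecMulMap_apply]
    rw [h2] at h1
    have h3 := congrArg LinearMap.det h1
    rw [LinearMap.det_id, LinearMap.det_comp] at h3
    exact fun h => by simp [h] at h3
  have h1 := Measure.addHaar_preimage_linearMap (volume : Measure (Fin n → F)) h0
    {x | sqNorm x ≤ 1}
  have h2 : vecMulMap (k : Matrix (Fin n) (Fin n) F) ⁻¹' {x | sqNorm x ≤ 1} =
      {x : Fin n → F | sqNorm x ≤ 1} := by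
    ext x
    simp only [mem_preimage, mem_ofPred_eq, vecMulMap_apply, sqNorm_vecMul_unitary]
  have hpos : volume {x : Fin n → F | sqNorm x ≤ 1} ≠ 0 := by
    have ho : IsOpen {x : Fin n → F | sqNorm x < 1} := isOpen_lt continuous_sqNorm continuous_const
    have hne : {x : Fin n → F | sqNorm x < 1}.Nonempty := ⟨0, by simp [sqNorm]⟩
    refine ((ho.measure_pos volume hne).trans_le (measure_mono ?_)).ne'
    exact fun x hx => (show sqNorm x < 1 from hx).le
  rw [h2] at h1
  nth_rewrite 1 [← one_mul (volume {x : Fin n → F | sqNorm x ≤ 1})] at h1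
  rw [ENNReal.mul_left_inj hpos (volume_sqNorm_le_one_lt_top n).ne, eq_comm,
    ENNReal.ofReal_eq_one, abs_inv, inv_eq_one] at h1
  exact h1

theorem lintegral_linearMap {E : Type*} [NormedAddCommGroup E] [NormedSpace ℝ E]
    [FiniteDimensional ℝ E] [MeasurableSpace E] [BorelSpace E] (μ : Measure E) [μ.IsAddHaarMeasure]
    {L : E →ₗ[ℝ] E} (hL : LinearMap.det L ≠ 0) {f : E → ENNReal} (hf : Measurable f) :
    ∫⁻ x, f (L x) ∂μ = ENNReal.ofReal |LinearMap.det L|⁻¹ * ∫⁻ x, f x ∂μ := by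
  rw [← lintegral_map hf (LinearMap.continuous_of_finiteDimensional L).measurable,
    Measure.map_linearMap_addHaar_eq_smul_addHaar μ hL, lintegral_smul_measure, abs_inv, smul_eq_mul]

theorem lintegral_vecMul_unitary {n : ℕ} (k : U F n) {f : (Fin n → F) → ENNReal}
    (hf : Measurable f) :
    ∫⁻ x : Fin n → F, f (x ᵥ* (k : Matrix (Fin n) (Fin n) F)) = ∫⁻ x : Fin n → F, f x := by
  have h := abs_det_vecMulMap_unitary k
  have h1 := lintegral_linearMap (volume : Measure (Fin n → F))
    (L := vecMulMap (k : Matrix (Fin n) (Fin n) F)) (fun h0 => by simp [h0] at h) hf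
  rw [h] at h1
  simpa [vecMulMap_apply] using h1

theorem lintegral_vector_split {n k p : ℕ} (hp : p = n + k) {g : (Fin n → F) → ℝ → ENNReal}
    (hg : Measurable (Function.uncurry g)) :
    ∫⁻ z : Fin p → F, g (fun i => z (Fin.castLE (by omega) i)) (sqNorm z) =
      ∫⁻ x : Fin n → F, ∫⁻ y : Fin k → F, g x (sqNorm x + sqNorm y) := by
  subst hp
  have h1 := (volume_measurePreserving_piCongrLeft (fun _ : Fin (n + k) => F) finSumFinEquiv).comp
    (volume_measurePreserving_sumPiEquivProdPi_symm fun _ : Fin n ⊕ Fin k => F)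
  have hm : Measurable fun z : Fin (n + k) → F =>
      g (fun i => z (Fin.castLE (by omega) i)) (sqNorm z) := by
    refine hg.comp (Measurable.prodMk ?_ continuous_sqNorm.measurable)
    fun_prop
  rw [← h1.lintegral_comp hm]
  have hN : Measurable fun a : (Fin n → F) × (Fin k → F) => g a.1 (sqNorm a.1 + sqNorm a.2) := by
    refine hg.comp (Measurable.prodMk measurable_fst ?_)
    exact (continuous_sqNorm.measurable.comp measurable_fst).add
      (continuous_sqNorm.measurable.comp measurable_snd)
  rw [← lintegral_prod _ hN.aemeasurable]
  refine lintegral_congr fun a => ?_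
  obtain ⟨x, y⟩ := a
  set z := ((MeasurableEquiv.piCongrLeft (fun _ : Fin (n + k) => F) finSumFinEquiv) ∘
    (MeasurableEquiv.sumPiEquivProdPi fun _ : Fin n ⊕ Fin k => F).symm) (x, y) with hz
  have hl : ∀ i : Fin n, z (Fin.castAdd k i) = x i := fun i => by
    have := Equiv.piCongrLeft_apply_apply (fun _ : Fin (n + k) => F) finSumFinEquiv
      ((MeasurableEquiv.sumPiEquivProdPi fun _ : Fin n ⊕ Fin k => F).symm (x, y)) (Sum.inl i)
    rw [finSumFinEquiv_apply_left] at this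
    exact this
  have hr : ∀ i : Fin k, z (Fin.natAdd n i) = y i := fun i => by
    have := Equiv.piCongrLeft_apply_apply (fun _ : Fin (n + k) => F) finSumFinEquiv
      ((MeasurableEquiv.sumPiEquivProdPi fun _ : Fin n ⊕ Fin k => F).symm (x, y)) (Sum.inr i)
    rw [finSumFinEquiv_apply_right] at this
    exact this
  have h2 : (fun i : Fin n => z (Fin.castLE (by omega) i)) = x := funext hl
  have h3 : sqNorm z = sqNorm x + sqNorm y := by
    simp only [sqNorm, Fin.sum_univ_add, hl, hr]
  simp only
  rw [h2, h3]

/-- Integrate a function of the first coordinates of zV and of |z| over Haar V and Lebesgue z. For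
fixed V unitary invariance removes V; for fixed z the normalized vector zV is distributed like the
first row of V. The cutoff |z|² ≤ 1 keeps the total mass finite. -/
theorem exists_row_law {n k p : ℕ} (hk : 0 < k) (hp : p + 1 = n + k) : ∃ c : ENNReal,
    ∀ f : (Fin n → F) → ENNReal, Measurable f →
      ∫⁻ V : U F (p + 1), f (fun i => (V : Matrix (Fin (p + 1)) (Fin (p + 1)) F) 0
        (Fin.castLE (by omega) i)) ∂(haarU F (p + 1)) =
      c * ∫⁻ x : Fin n → F, {x : Fin n → F | sqNorm x < 1}.indicator
        (fun x => f x * ENNReal.ofReal ((1 - sqNorm x) ^ (((k * d F : ℕ) : ℝ) / 2 - 1))) x := by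
  obtain ⟨C, hC⟩ := exists_lintegral_prod (F := F) (n := n) hk
  have hnp : n ≤ p + 1 := by omega
  set v := volume (sqNorm ⁻¹' Ioc (0 : ℝ) 1 : Set (Fin (p + 1) → F)) with hv
  have hv0 : v ≠ 0 := by
    have ho : IsOpen (sqNorm ⁻¹' Ioo (0 : ℝ) 1 : Set (Fin (p + 1) → F)) :=
      isOpen_Ioo.preimage continuous_sqNorm
    have hne : (sqNorm ⁻¹' Ioo (0 : ℝ) 1 : Set (Fin (p + 1) → F)).Nonempty := by
      refine ⟨Pi.single 0 (algebraMap ℝ F (1 / 2)), ?_⟩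
      have : sqNorm (Pi.single 0 (algebraMap ℝ F (1 / 2)) : Fin (p + 1) → F) = 1 / 4 := by
        rw [sqNorm, Finset.sum_eq_single 0]
        · rw [Pi.single_eq_same, norm_algebraMap']
          norm_num
        · intro i _ hi
          simp [hi]
        · simp
      rw [mem_preimage, this]
      norm_num
    exact ((ho.measure_pos volume hne).trans_le
      (measure_mono (preimage_mono Ioo_subset_Ioc_self))).ne'
  have hvt : v ≠ ⊤ :=
    ((measure_mono fun x hx => (hx : sqNorm x ∈ Ioc (0 : ℝ) 1).2).trans_lt
      (volume_sqNorm_le_one_lt_top (F := F) (p + 1))).ne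
  refine ⟨C / v, fun f hf => ?_⟩
  set E := ∫⁻ V : U F (p + 1), f (fun i => (V : Matrix (Fin (p + 1)) (Fin (p + 1)) F) 0
        (Fin.castLE hnp i)) ∂(haarU F (p + 1)) with hE
  set g : (Fin n → F) → ℝ → ENNReal := fun x =>
    (Ioc (0 : ℝ) 1).indicator (fun t => f ((Real.sqrt t)⁻¹ • x)) with hg
  have hgm : Measurable (Function.uncurry g) := by
    have e : Function.uncurry g = {a : (Fin n → F) × ℝ | a.2 ∈ Ioc (0 : ℝ) 1}.indicator
        (fun a => f ((Real.sqrt a.2)⁻¹ • a.1)) := rfl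
    rw [e]
    refine Measurable.indicator (hf.comp ?_) (measurable_snd measurableSet_Ioc)
    fun_prop
  have h1 := hC f hf
  rw [← lintegral_vector_split hp hgm] at h1
  have htop : Continuous fun z : Fin (p + 1) → F => fun i : Fin n => z (Fin.castLE hnp i) := by
    fun_prop
  have hcont : Continuous fun a : U F (p + 1) × (Fin (p + 1) → F) =>
      a.2 ᵥ* (a.1 : Matrix (Fin (p + 1)) (Fin (p + 1)) F) :=
    continuous_snd.matrix_vecMul (continuous_subtype_val.comp continuous_fst)
  have hm : Measurable (Function.uncurry fun (V : U F (p + 1)) (z : Fin (p + 1) → F) =>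
      g (fun i => (z ᵥ* (V : Matrix (Fin (p + 1)) (Fin (p + 1)) F)) (Fin.castLE hnp i))
        (sqNorm z)) :=
    hgm.comp ((htop.comp hcont).measurable.prodMk
      (continuous_sqNorm.measurable.comp measurable_snd))
  have hgm' : Measurable fun z : Fin (p + 1) → F => g (fun i => z (Fin.castLE hnp i)) (sqNorm z) :=
    hgm.comp (htop.measurable.prodMk continuous_sqNorm.measurable)
  have h2 : ∀ V : U F (p + 1), ∫⁻ z : Fin (p + 1) → F,
      g (fun i => (z ᵥ* (V : Matrix (Fin (p + 1)) (Fin (p + 1)) F)) (Fin.castLE hnp i))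
        (sqNorm z) = ∫⁻ z : Fin (p + 1) → F, g (fun i => z (Fin.castLE hnp i)) (sqNorm z) := by
    intro V
    rw [← lintegral_vecMul_unitary V hgm']
    simp only [sqNorm_vecMul_unitary]
  have h3 : ∀ z : Fin (p + 1) → F, ∫⁻ V : U F (p + 1),
      g (fun i => (z ᵥ* (V : Matrix (Fin (p + 1)) (Fin (p + 1)) F)) (Fin.castLE hnp i))
        (sqNorm z) ∂(haarU F (p + 1)) =
      (sqNorm ⁻¹' Ioc (0 : ℝ) 1 : Set (Fin (p + 1) → F)).indicator (fun _ => E) z := by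
    intro z
    by_cases hz : sqNorm z ∈ Ioc (0 : ℝ) 1
    · have hs : 0 < Real.sqrt (sqNorm z) := Real.sqrt_pos.mpr hz.1
      rw [indicator_of_mem (show z ∈ sqNorm ⁻¹' Ioc (0 : ℝ) 1 from hz)]
      -- The normalized z is the first row of some unitary k, so zV normalized is the first row of
      -- kV, and left invariance applies.
      obtain ⟨k, hk⟩ := exists_unitary_row ((Real.sqrt (sqNorm z))⁻¹ • z) (by
        have := sqNorm_smul (Real.sqrt (sqNorm z))⁻¹ z
        rw [inv_pow, Real.sq_sqrt hz.1.le, inv_mul_cancel₀ hz.1.ne'] at this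
        exact this)
      have hEk : E = ∫⁻ V : U F (p + 1), f (fun i =>
          ((k * V : U F (p + 1)) : Matrix (Fin (p + 1)) (Fin (p + 1)) F) 0
            (Fin.castLE hnp i)) ∂(haarU F (p + 1)) :=
        (lintegral_mul_left_eq_self (fun V : U F (p + 1) => f (fun i =>
          (V : Matrix (Fin (p + 1)) (Fin (p + 1)) F) 0 (Fin.castLE hnp i))) k).symm
      rw [hEk]
      refine lintegral_congr fun V => ?_
      simp only [hg, indicator_of_mem hz]
      congr 1
      funext i
      rw [Submonoid.coe_mul, Matrix.mul_apply, Pi.smul_apply, vecMul, dotProduct, Finset.smul_sum]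
      refine Finset.sum_congr rfl fun l _ => ?_
      rw [← hk, Pi.smul_apply, smul_mul_assoc]
    · rw [indicator_of_notMem (show z ∉ sqNorm ⁻¹' Ioc (0 : ℝ) 1 from hz)]
      simp only [hg, indicator_of_notMem hz, lintegral_zero]
  have h4 := lintegral_lintegral_swap (μ := haarU F (p + 1))
    (ν := (volume : Measure (Fin (p + 1) → F))) hm.aemeasurable
  simp only [h2, h3] at h4
  rw [lintegral_const, measure_univ, mul_one, h1,
    lintegral_indicator (continuous_sqNorm.measurable measurableSet_Ioc), lintegral_const,
    Measure.restrict_apply_univ, ← hv] at h4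
  rw [ENNReal.div_eq_inv_mul, mul_assoc, h4, mul_comm E, ← mul_assoc,
    ENNReal.inv_mul_cancel hv0 hvt, one_mul]

end RowLaw

/-! ### The distribution of a corner of a random unitary matrix -/

section CornerLaw

open Set

variable {F : Type} [NormedDivisionRing F] [NormedAlgebra ℝ F] [StarRing F] [CStarRing F]
  [FiniteDimensional ℝ F] [MeasureSpace F] [BorelSpace F] [Scalars F]

variable (F) in
/-- The ball of all `m × n` matrices `w` with `w^* w < I`. -/
def rectBall (m n : ℕ) : Set (Fin m → Fin n → F) :=
  {w | IsPosDef (1 - (Matrix.of w)ᴴ * Matrix.of w)}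

/-- The real part of `Δ(I - w^* w)`. -/
def defect {m n : ℕ} (w : Fin m → Fin n → F) : ℝ :=
  (Scalars.det (1 - (Matrix.of w)ᴴ * Matrix.of w)).re

theorem mem_rectBall {m n : ℕ} {w : Fin m → Fin n → F} :
    w ∈ rectBall F m n ↔ ∀ x : Fin n → F, x ≠ 0 → sqNorm (Matrix.of w *ᵥ x) < sqNorm x := by
  have h : ∀ x : Fin n → F, star x ⬝ᵥ ((1 - (Matrix.of w)ᴴ * Matrix.of w) *ᵥ x) =
      algebraMap ℝ F (sqNorm x - sqNorm (Matrix.of w *ᵥ x)) := by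
    intro x
    rw [sub_mulVec, one_mulVec, dotProduct_sub, star_dotProduct_self, star_dotProduct_gram,
      map_sub]
    rfl
  constructor
  · rintro ⟨-, h1⟩ x hx
    obtain ⟨r, hr, h2⟩ := h1 x hx
    rw [h] at h2
    have := (algebraMap ℝ F).injective h2
    linarith
  · intro h1
    refine ⟨by simp, fun x hx => ⟨_, sub_pos.mpr (h1 x hx), h x⟩⟩

/-- The condition is a strict inequality over the compact unit sphere, hence stable under small
perturbations of w. -/
theorem isOpen_rectBall [ProperSpace F] (m n : ℕ) : IsOpen (rectBall F m n) := by
  have hcomp : IsCompact {x : Fin n → F | sqNorm x = 1} := by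
    refine (isCompact_closedBall (0 : Fin n → F) 1).of_isClosed_subset
      (isClosed_eq continuous_sqNorm continuous_const) ?_
    intro x (hx : sqNorm x = 1)
    rw [mem_closedBall_zero_iff, pi_norm_le_iff_of_nonneg zero_le_one]
    intro i
    have h : ‖x i‖ ^ 2 ≤ sqNorm x :=
      Finset.single_le_sum (f := fun i => ‖x i‖ ^ 2) (fun k _ => sq_nonneg _) (Finset.mem_univ i)
    nlinarith [norm_nonneg (x i)]
  have hiff : ∀ w : Fin m → Fin n → F, w ∈ rectBall F m n ↔
      ∀ x ∈ {x : Fin n → F | sqNorm x = 1}, sqNorm (Matrix.of w *ᵥ x) < 1 := by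
    intro w
    rw [mem_rectBall]
    constructor
    · intro h x (hx : sqNorm x = 1)
      rw [← hx]
      exact h x fun h0 => by rw [h0, sqNorm_eq_zero.mpr rfl] at hx; exact zero_ne_one hx
    · intro h x hx
      have hpos : 0 < sqNorm x :=
        lt_of_le_of_ne (sqNorm_nonneg x) fun h0 => hx (sqNorm_eq_zero.mp h0.symm)
      have hs : (Real.sqrt (sqNorm x))⁻¹ ^ 2 = (sqNorm x)⁻¹ := by
        rw [inv_pow, Real.sq_sqrt hpos.le]
      have h1 := h ((Real.sqrt (sqNorm x))⁻¹ • x) (by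
        rw [mem_ofPred_eq, sqNorm_smul, hs, inv_mul_cancel₀ hpos.ne'])
      rw [mulVec_smul, sqNorm_smul, hs, inv_mul_lt_iff₀ hpos, mul_one] at h1
      exact h1
  rw [isOpen_iff_eventually]
  intro w hw
  rw [hiff] at hw
  simp only [hiff]
  refine hcomp.eventually_forall_of_forall_eventually fun x hx => ?_
  have hc : Continuous fun z : (Fin m → Fin n → F) × (Fin n → F) =>
      sqNorm (Matrix.of z.1 *ᵥ z.2) :=
    continuous_sqNorm.comp (Continuous.matrix_mulVec (A := fun z : (Fin m → Fin n → F) ×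
      (Fin n → F) => Matrix.of z.1) continuous_fst continuous_snd)
  exact hc.continuousAt.eventually_lt continuousAt_const (hw x hx)

theorem measurable_defect [ProperSpace F] [ScalarsLaws F] (m n : ℕ) :
    Measurable (defect : (Fin m → Fin n → F) → ℝ) := by
  refine Complex.measurable_re.comp (ScalarsLaws.measurable_det.comp ?_)
  have h : Continuous fun w : Fin m → Fin n → F => (Matrix.of w : Matrix (Fin m) (Fin n) F) :=
    continuous_id
  have h1 : Continuous fun w : Fin m → Fin n → F =>
      1 - (Matrix.of w : Matrix (Fin m) (Fin n) F)ᴴ * Matrix.of w :=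
    continuous_const.sub (h.matrix_conjTranspose.matrix_mul h)
  exact h1.measurable

theorem of_cons_mulVec {m n : ℕ} (r : Fin n → F) (w : Fin m → Fin n → F) (x : Fin n → F) :
    (Matrix.of (Fin.cons r w : Fin (m + 1) → Fin n → F)) *ᵥ x =
      Fin.cons (r ⬝ᵥ x) (Matrix.of w *ᵥ x) := by
  funext i
  refine Fin.cases ?_ (fun i => ?_) i <;> rfl

theorem sqNorm_cons {m : ℕ} (a : F) (x : Fin m → F) :
    sqNorm (Fin.cons a x : Fin (m + 1) → F) = ‖a‖ ^ 2 + sqNorm x := by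
  simp [sqNorm, Fin.sum_univ_succ]

theorem cons_gram {m n : ℕ} (r : Fin n → F) (w : Fin m → Fin n → F) :
    (Matrix.of (Fin.cons r w : Fin (m + 1) → Fin n → F))ᴴ *
      Matrix.of (Fin.cons r w : Fin (m + 1) → Fin n → F) =
    vecMulVec (star r) r + (Matrix.of w)ᴴ * Matrix.of w := by
  ext i j
  simp [Matrix.mul_apply, Fin.sum_univ_succ, vecMulVec_apply]

/-- Test the contraction on r^*: the first coordinate alone gives |r|⁴ < |r|². -/
theorem sqNorm_lt_one_of_mem_rectBall {m n : ℕ} {r : Fin n → F} {w : Fin m → Fin n → F}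
    (h : (Fin.cons r w : Fin (m + 1) → Fin n → F) ∈ rectBall F (m + 1) n) : sqNorm r < 1 := by
  by_cases h0 : r = 0
  · rw [h0, sqNorm_eq_zero.mpr rfl]
    exact zero_lt_one
  · have h1 := mem_rectBall.mp h (star r) (by simpa using h0)
    have h2 : r ⬝ᵥ star r = algebraMap ℝ F (sqNorm r) := by
      rw [sqNorm, map_sum]
      exact Finset.sum_congr rfl fun i _ => mul_star_self_eq (r i)
    have hpos : 0 < sqNorm r :=
      lt_of_le_of_ne (sqNorm_nonneg r) fun h => h0 (sqNorm_eq_zero.mp h.symm)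
    rw [of_cons_mulVec, sqNorm_cons, h2, norm_algebraMap', Real.norm_of_nonneg hpos.le,
      sqNorm_star] at h1
    have := sqNorm_nonneg (Matrix.of w *ᵥ star r)
    nlinarith

theorem exists_smul_unitary_row {n : ℕ} (r : Fin (n + 1) → F) :
    ∃ k : U F (n + 1), ∀ j, r j = Real.sqrt (sqNorm r) •
      (k : Matrix (Fin (n + 1)) (Fin (n + 1)) F) 0 j := by
  by_cases h0 : r = 0
  · refine ⟨1, fun j => ?_⟩
    rw [h0, sqNorm_eq_zero.mpr rfl]
    simp
  · have hpos : 0 < sqNorm r :=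
      lt_of_le_of_ne (sqNorm_nonneg r) fun h => h0 (sqNorm_eq_zero.mp h.symm)
    obtain ⟨k, hk⟩ := exists_unitary_row ((Real.sqrt (sqNorm r))⁻¹ • r) (by
      have := sqNorm_smul (Real.sqrt (sqNorm r))⁻¹ r
      rw [inv_pow, Real.sq_sqrt hpos.le, inv_mul_cancel₀ hpos.ne'] at this
      exact this)
    refine ⟨k, fun j => ?_⟩
    rw [← hk, Pi.smul_apply, smul_smul, mul_inv_cancel₀ (Real.sqrt_pos.mpr hpos).ne', one_smul]

theorem det_one [ScalarsLaws F] (n : ℕ) : Scalars.det (1 : Matrix (Fin n) (Fin n) F) = 1 := by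
  have h := ScalarsLaws.det_gram_triangular (1 : Matrix (Fin n) (Fin n) F) blockTriangular_one
  simpa using h

/-- A square root of `I - r^* r`, for a row vector `r` of norm less than one. -/
theorem exists_sqrt_one_sub [ProperSpace F] [(volume : Measure F).IsAddHaarMeasure]
    [ScalarsLaws F] {n : ℕ} {r : Fin (n + 1) → F} (hr : sqNorm r < 1) :
    ∃ C C' : Matrix (Fin (n + 1)) (Fin (n + 1)) F, C * C' = 1 ∧
      Cᴴ * C = 1 - vecMulVec (star r) r ∧ Scalars.det (Cᴴ * C) = ((1 - sqNorm r : ℝ) : ℂ) ∧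
      |LinearMap.det (vecMulMap C)| = (1 - sqNorm r) ^ ((d F : ℝ) / 2) := by
  obtain ⟨k, hk⟩ := exists_smul_unitary_row r
  set ρ := sqNorm r with hρ
  have hρ0 : 0 ≤ ρ := sqNorm_nonneg r
  have hpos : 0 < 1 - ρ := by linarith
  have hs : 0 < Real.sqrt (1 - ρ) := Real.sqrt_pos.mpr hpos
  set K := (k : Matrix (Fin (n + 1)) (Fin (n + 1)) F) with hK
  have hKK : Kᴴ * K = 1 := unitary_conjTranspose_mul k
  have hKK' : K * Kᴴ = 1 := unitary_mul_conjTranspose k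
  -- C = DK, where the first row of the unitary K points along r and D shrinks that direction by √(1
  -- - |r|²).
  set δ : Fin (n + 1) → ℝ := Fin.cons (Real.sqrt (1 - ρ)) fun _ => 1 with hδ
  set δ' : Fin (n + 1) → ℝ := Fin.cons (Real.sqrt (1 - ρ))⁻¹ fun _ => 1 with hδ'
  set D : Matrix (Fin (n + 1)) (Fin (n + 1)) F := diagonal fun i => algebraMap ℝ F (δ i) with hD
  set D' : Matrix (Fin (n + 1)) (Fin (n + 1)) F := diagonal fun i => algebraMap ℝ F (δ' i) with hD'
  have hDD' : D * D' = 1 := by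
    rw [hD, hD', diagonal_mul_diagonal, ← diagonal_one]
    congr 1
    funext i
    rw [← map_mul, ← map_one (algebraMap ℝ F)]
    congr 1
    refine Fin.cases ?_ (fun i => ?_) i
    · simp [hδ, hδ', hs.ne']
    · simp [hδ, hδ']
  have hDD : Dᴴ * D = diagonal fun i => algebraMap ℝ F (δ i ^ 2) := by
    rw [hD, diagonal_conjTranspose, diagonal_mul_diagonal]
    congr 1
    funext i
    rw [Pi.star_apply, star_algebraMap_real, ← map_mul, sq]
  have hgram : (D * K)ᴴ * (D * K) = Kᴴ * (Dᴴ * D) * K := by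
    rw [conjTranspose_mul D K]; simp only [Matrix.mul_assoc]
  clear_value K
  refine ⟨D * K, Kᴴ * D', ?_, ?_, ?_, ?_⟩
  · rw [Matrix.mul_assoc, ← Matrix.mul_assoc K, hKK', Matrix.one_mul, hDD']
  · rw [hgram, hDD]
    ext i j
    have h1 := congrFun (congrFun hKK i) j
    rw [Matrix.mul_apply, Fin.sum_univ_succ] at h1
    rw [Matrix.mul_apply, Fin.sum_univ_succ, Matrix.sub_apply, ← h1, vecMulVec_apply,
      Pi.star_apply, hk, hk]
    simp only [mul_diagonal, conjTranspose_apply, hδ, Fin.cons_zero, Fin.cons_succ, one_pow,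
      map_one, mul_one]
    rw [Real.sq_sqrt hpos.le, star_smul, star_trivial (Real.sqrt ρ), smul_mul_smul_comm,
      Real.mul_self_sqrt hρ0, ← Algebra.commutes, ← Algebra.smul_def, smul_mul_assoc,
      sub_smul, one_smul]
    abel
  · rw [hgram, ScalarsLaws.det_congr, hKK, det_one, one_mul,
      ScalarsLaws.det_gram_triangular D (blockTriangular_diagonal _)]
    congr 1
    rw [Fin.prod_univ_succ]
    simp [hD, hδ, Real.sq_sqrt hpos.le]
  · rw [vecMulMap_mul, LinearMap.det_comp, abs_mul, hK, abs_det_vecMulMap_unitary, one_mul, hD,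
      det_vecMulMap_diagonal, Fin.prod_univ_succ]
    simp only [hδ, Fin.cons_zero, Fin.cons_succ, one_pow, Finset.prod_const_one, mul_one]
    rw [abs_of_pos (by positivity), Real.sqrt_eq_rpow, ← Real.rpow_natCast, ← Real.rpow_mul hpos.le]
    congr 1
    ring

/-- Right multiplication of `m × n` matrices by a square matrix. -/
def rowMul {m n : ℕ} (C : Matrix (Fin n) (Fin n) F) :
    (Fin m → Fin n → F) →ₗ[ℝ] (Fin m → Fin n → F) :=
  LinearMap.pi fun i => (vecMulMap C).comp (LinearMap.proj i)

theorem of_rowMul {m n : ℕ} (C : Matrix (Fin n) (Fin n) F) (w : Fin m → Fin n → F) :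
    Matrix.of (rowMul C w) = Matrix.of w * C := rfl

theorem det_rowMul {m n : ℕ} (C : Matrix (Fin n) (Fin n) F) :
    LinearMap.det (rowMul C : (Fin m → Fin n → F) →ₗ[ℝ] (Fin m → Fin n → F)) =
      LinearMap.det (vecMulMap C) ^ m := by
  rw [rowMul, LinearMap.det_pi]
  simp

/-- The reason for the substitution w ↦ wC: I - r^*r - C^*w^*wC = C^*(I - w^*w)C. -/
theorem defect_cons [ScalarsLaws F] {m n : ℕ} {r : Fin n → F} {C : Matrix (Fin n) (Fin n) F}
    (hC : Cᴴ * C = 1 - vecMulVec (star r) r)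
    (hdet : Scalars.det (Cᴴ * C) = ((1 - sqNorm r : ℝ) : ℂ)) (w : Fin m → Fin n → F) :
    defect (Fin.cons r (rowMul C w) : Fin (m + 1) → Fin n → F) = (1 - sqNorm r) * defect w := by
  have h : 1 - (vecMulVec (star r) r + (Matrix.of w * C)ᴴ * (Matrix.of w * C)) =
      Cᴴ * (1 - (Matrix.of w)ᴴ * Matrix.of w) * C := by
    rw [Matrix.mul_sub, Matrix.sub_mul, Matrix.mul_one, hC, conjTranspose_mul]
    simp only [Matrix.mul_assoc]
    abel
  rw [defect, cons_gram, of_rowMul, h, ScalarsLaws.det_congr, hdet, Complex.re_ofReal_mul, defect]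

/-- Since |x|² = |r·x|² + |Cx|², the contraction condition for the enlarged matrix at x is the one
for w at Cx. -/
theorem cons_mem_rectBall_iff {m n : ℕ} {r : Fin n → F} {C C' : Matrix (Fin n) (Fin n) F}
    (hC : Cᴴ * C = 1 - vecMulVec (star r) r) (hCC : C * C' = 1) (w : Fin m → Fin n → F) :
    (Fin.cons r (rowMul C w) : Fin (m + 1) → Fin n → F) ∈ rectBall F (m + 1) n ↔
      w ∈ rectBall F m n := by
  have hN : ∀ x : Fin n → F, sqNorm x = ‖r ⬝ᵥ x‖ ^ 2 + sqNorm (C *ᵥ x) := by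
    intro x
    have h := sqNorm_mulVec_of_gram_eq (A := Matrix.of (Fin.cons r (fun i j => C i j) : Fin (n + 1) → Fin n → F))
      (B := (1 : Matrix (Fin n) (Fin n) F)) (by
        rw [cons_gram, conjTranspose_one, Matrix.one_mul]
        have : (Matrix.of fun i j => C i j)ᴴ * (Matrix.of fun i j => C i j) = Cᴴ * C := rfl
        rw [this, hC]
        abel) x
    rw [of_cons_mulVec, sqNorm_cons, one_mulVec] at h
    exact h.symm
  have hCC' : C' * C = 1 := mul_eq_one_comm.mp hCC
  rw [mem_rectBall, mem_rectBall]
  have key : ∀ x : Fin n → F,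
      sqNorm (Matrix.of (Fin.cons r (rowMul C w) : Fin (m + 1) → Fin n → F) *ᵥ x) < sqNorm x ↔
      sqNorm (Matrix.of w *ᵥ (C *ᵥ x)) < sqNorm (C *ᵥ x) := by
    intro x
    rw [of_cons_mulVec, sqNorm_cons, hN x, of_rowMul, ← mulVec_mulVec]
    exact add_lt_add_iff_left _
  constructor
  · intro h y hy
    have h1 := (key (C' *ᵥ y)).mp (h _ fun h0 => hy (by
      have := congrArg (fun z => C *ᵥ z) h0
      simpa [mulVec_mulVec, hCC] using this))
    rwa [mulVec_mulVec y C C', hCC, one_mulVec] at h1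
  · intro h x hx
    exact (key x).mpr (h _ fun h0 => hx (by
      have := congrArg (fun z => C' *ᵥ z) h0
      simpa [mulVec_mulVec, hCC'] using this))

/-- Only one factor has to be positive, so the sign of the defect on the ball need not be discussed.
-/
theorem mul_rpow_of_pos {x : ℝ} (hx : 0 < x) (y e : ℝ) : (x * y) ^ e = x ^ e * y ^ e := by
  rcases le_or_gt 0 y with h | h
  · exact Real.mul_rpow hx.le h
  · rw [Real.rpow_def_of_neg (mul_neg_of_pos_of_neg hx h), Real.rpow_def_of_neg h,
      Real.rpow_def_of_pos hx, Real.log_mul hx.ne' h.ne, add_mul, Real.exp_add]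
    ring

/-- The unitary matrix with blocks `1` and `h`. -/
def oneOplus {p : ℕ} (h : U F p) : U F (p + 1) :=
  unitaryOf (Matrix.of (Fin.cons (Pi.single 0 1) fun i =>
      (Fin.cons 0 ((h : Matrix (Fin p) (Fin p) F) i) : Fin (p + 1) → F))) (by
    have hh := unitary_conjTranspose_mul h
    ext i j
    rw [Matrix.mul_apply, Fin.sum_univ_succ]
    refine Fin.cases ?_ (fun i => ?_) i <;> refine Fin.cases ?_ (fun j => ?_) j
    · simp
    · simp [(Fin.succ_ne_zero j).symm]
    · simp
    · have := congrFun (congrFun hh i) j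
      rw [Matrix.mul_apply] at this
      simp only [conjTranspose_apply] at this
      simp [this, Matrix.one_apply])

theorem oneOplus_mul_zero {p : ℕ} (h : U F p) (V : U F (p + 1)) (l : Fin (p + 1)) :
    ((oneOplus h * V : U F (p + 1)) : Matrix (Fin (p + 1)) (Fin (p + 1)) F) 0 l =
      (V : Matrix (Fin (p + 1)) (Fin (p + 1)) F) 0 l := by
  rw [Submonoid.coe_mul, Matrix.mul_apply, Fin.sum_univ_succ]
  simp [oneOplus]

theorem oneOplus_mul_succ {p : ℕ} (h : U F p) (V : U F (p + 1)) (i : Fin p) (l : Fin (p + 1)) :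
    ((oneOplus h * V : U F (p + 1)) : Matrix (Fin (p + 1)) (Fin (p + 1)) F) i.succ l =
      ∑ a : Fin p, (h : Matrix (Fin p) (Fin p) F) i a *
        (V : Matrix (Fin (p + 1)) (Fin (p + 1)) F) a.succ l := by
  rw [Submonoid.coe_mul, Matrix.mul_apply, Fin.sum_univ_succ]
  simp [oneOplus]

theorem continuous_oneOplus {p : ℕ} : Continuous (oneOplus : U F p → U F (p + 1)) := by
  refine Continuous.subtype_mk ?_ _
  refine continuous_matrix fun i j => ?_
  refine Fin.cases ?_ (fun i => ?_) i
  · exact continuous_const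
  · refine Fin.cases ?_ (fun j => ?_) j
    · exact continuous_const
    · exact continuous_subtype_val.matrix_elem i j

end CornerLaw

/-! ### Induction on the number of rows of the corner -/

section CornerInduction

open Set

variable {F : Type} [NormedDivisionRing F] [NormedAlgebra ℝ F] [StarRing F] [CStarRing F]
  [FiniteDimensional ℝ F] [MeasureSpace F] [BorelSpace F] [Scalars F]
  [ProperSpace F] [(volume : Measure F).IsAddHaarMeasure] [ScalarsLaws F]

instance instIsAddHaarMeasureMatrix (m n : ℕ) :
    (volume : Measure (Fin m → Fin n → F)).IsAddHaarMeasure :=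
  Measure.pi.isAddHaarMeasure fun _ : Fin m => (volume : Measure (Fin n → F))

/-- The upper left `m × n` block of a square matrix. -/
def topLeft {p m n : ℕ} (hm : m ≤ p) (hn : n ≤ p) (v : Matrix (Fin p) (Fin p) F) :
    Fin m → Fin n → F :=
  fun i l => v (Fin.castLE hm i) (Fin.castLE hn l)

theorem continuous_topLeft {p m n : ℕ} (hm : m ≤ p) (hn : n ≤ p) :
    Continuous fun V : U F p => topLeft hm hn (V : Matrix (Fin p) (Fin p) F) :=
  continuous_pi fun _ => continuous_pi fun _ => continuous_subtype_val.matrix_elem _ _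

/-- Conditioning on the first row r: the rest L of the first n columns satisfies L^*L = I - r^*r =
C^*C, so L is a frame times C, and multiplication by 1 ⊕ h rotates that frame without touching r. -/
theorem exists_topLeft_oneOplus {p m n : ℕ} (hm : m ≤ p) (hn : n ≤ p) (V : U F (p + 1))
    {C C' : Matrix (Fin n) (Fin n) F} {r : Fin n → F}
    (hr : r = fun l => (V : Matrix (Fin (p + 1)) (Fin (p + 1)) F) 0 (Fin.castLE (by omega) l))
    (hC : Cᴴ * C = 1 - vecMulVec (star r) r) (hCC : C * C' = 1) :
    ∃ k : U F p, ∀ h : U F p,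
      topLeft (m := m + 1) (by omega) (n := n) (by omega)
        ((oneOplus h * V : U F (p + 1)) : Matrix (Fin (p + 1)) (Fin (p + 1)) F) =
      Fin.cons r (rowMul C (topLeft hm hn ((h * k : U F p) : Matrix (Fin p) (Fin p) F))) := by
  have hn' : n ≤ p + 1 := by omega
  set L : Matrix (Fin p) (Fin n) F := Matrix.of fun i l =>
    (V : Matrix (Fin (p + 1)) (Fin (p + 1)) F) i.succ (Fin.castLE hn' l) with hL
  have hgram : Lᴴ * L = Cᴴ * C := by
    rw [hC, eq_sub_iff_add_eq]
    ext a b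
    have h1 := congrFun (congrFun (unitary_conjTranspose_mul V) (Fin.castLE hn' a))
      (Fin.castLE hn' b)
    rw [Matrix.mul_apply, Fin.sum_univ_succ, Matrix.one_apply] at h1
    rw [Matrix.add_apply, Matrix.mul_apply, vecMulVec_apply, Pi.star_apply, hr, Matrix.one_apply,
      add_comm]
    simpa [Fin.ext_iff, hL] using h1
  have hiso : (L * C')ᴴ * (L * C') = 1 := by
    calc (L * C')ᴴ * (L * C') = C'ᴴ * (Lᴴ * L) * C' := by
          rw [conjTranspose_mul L C']; simp only [Matrix.mul_assoc]
      _ = (C * C')ᴴ * (C * C') := by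
          rw [hgram, conjTranspose_mul C C']; simp only [Matrix.mul_assoc]
      _ = 1 := by rw [hCC]; simp
  obtain ⟨k, hk⟩ := exists_unitary_mul_inclusion hn hiso
  have hCC' : C' * C = 1 := mul_eq_one_comm.mp hCC
  have hLk : L = (k : Matrix (Fin p) (Fin p) F) * inclusion F p n * C := by
    rw [← hk, Matrix.mul_assoc, hCC', Matrix.mul_one]
  refine ⟨k, fun h => ?_⟩
  funext i l
  refine Fin.cases ?_ (fun i => ?_) i
  · rw [Fin.cons_zero, hr]
    exact oneOplus_mul_zero h V _
  · rw [Fin.cons_succ]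
    have e1 : topLeft (m := m + 1) (by omega) (n := n) (by omega)
        ((oneOplus h * V : U F (p + 1)) : Matrix (Fin (p + 1)) (Fin (p + 1)) F) i.succ l =
        ((h : Matrix (Fin p) (Fin p) F) * L) (Fin.castLE hm i) l := by
      rw [Matrix.mul_apply]
      exact oneOplus_mul_succ h V (Fin.castLE hm i) (Fin.castLE hn' l)
    have e2 : rowMul C (topLeft hm hn ((h * k : U F p) : Matrix (Fin p) (Fin p) F)) i l =
        (((h : Matrix (Fin p) (Fin p) F) * (k : Matrix (Fin p) (Fin p) F)) * inclusion F p n * C)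
          (Fin.castLE hm i) l := by
      rw [Matrix.mul_apply]
      simp only [mul_inclusion_apply hn]
      rfl
    rw [e1, e2, hLk]
    simp only [Matrix.mul_assoc]

variable (F) in
/-- The integral of `f` against the density `Δ(I - w^* w)^e` over the ball. -/
def ballIntegrand (m n : ℕ) (e : ℝ) (f : (Fin m → Fin n → F) → ENNReal) :
    (Fin m → Fin n → F) → ENNReal :=
  (rectBall F m n).indicator fun w => f w * ENNReal.ofReal (defect w ^ e)

theorem measurable_ballIntegrand (m n : ℕ) (e : ℝ) {f : (Fin m → Fin n → F) → ENNReal}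
    (hf : Measurable f) : Measurable (ballIntegrand F m n e f) :=
  (hf.mul ((measurable_defect m n).pow_const e).ennreal_ofReal).indicator
    (isOpen_rectBall m n).measurableSet

theorem continuous_cons_pair (m n : ℕ) : Continuous fun a : (Fin n → F) × (Fin m → Fin n → F) =>
    (Fin.cons a.1 a.2 : Fin (m + 1) → Fin n → F) := by
  refine continuous_pi fun i => ?_
  refine Fin.cases ?_ (fun i => ?_) i
  · exact continuous_fst
  · exact (continuous_apply i).comp continuous_snd

/-- Change of variables w ↦ wC: the density contributes (1 - |r|²)^e and the Jacobian, one factor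
for each of the m rows, (1 - |r|²)^{md/2}. -/
theorem lintegral_ballIntegrand_rowMul {m n : ℕ} {e : ℝ} {f : (Fin (m + 1) → Fin n → F) → ENNReal}
    (hf : Measurable f) {r : Fin n → F} (hr : sqNorm r < 1) {C C' : Matrix (Fin n) (Fin n) F}
    (hC : Cᴴ * C = 1 - vecMulVec (star r) r) (hCC : C * C' = 1)
    (hdet : Scalars.det (Cᴴ * C) = ((1 - sqNorm r : ℝ) : ℂ))
    (hJ : |LinearMap.det (vecMulMap C)| = (1 - sqNorm r) ^ ((d F : ℝ) / 2)) :
    ∫⁻ w, ballIntegrand F m n e (fun w => f (Fin.cons r (rowMul C w))) w =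
      ENNReal.ofReal ((1 - sqNorm r) ^ (-e - m * d F / 2)) *
        ∫⁻ w : Fin m → Fin n → F, ballIntegrand F (m + 1) n e f (Fin.cons r w) := by
  have hpos : 0 < 1 - sqNorm r := by linarith
  have h1 : ∀ w : Fin m → Fin n → F,
      ballIntegrand F m n e (fun w => f (Fin.cons r (rowMul C w))) w =
      ENNReal.ofReal ((1 - sqNorm r) ^ (-e)) *
        ballIntegrand F (m + 1) n e f (Fin.cons r (rowMul C w)) := by
    intro w
    by_cases hw : w ∈ rectBall F m n
    · rw [ballIntegrand, ballIntegrand, indicator_of_mem hw,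
        indicator_of_mem ((cons_mem_rectBall_iff hC hCC w).mpr hw), defect_cons hC hdet,
        mul_rpow_of_pos hpos, ENNReal.ofReal_mul (Real.rpow_nonneg hpos.le _), mul_left_comm,
        ← mul_assoc (ENNReal.ofReal ((1 - sqNorm r) ^ (-e))),
        ← ENNReal.ofReal_mul (Real.rpow_nonneg hpos.le _), ← Real.rpow_add hpos, neg_add_cancel,
        Real.rpow_zero, ENNReal.ofReal_one, one_mul]
    · rw [ballIntegrand, ballIntegrand, indicator_of_notMem hw,
        indicator_of_notMem fun h => hw ((cons_mem_rectBall_iff hC hCC w).mp h), mul_zero]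
  simp only [h1]
  have hm : Measurable fun w : Fin m → Fin n → F =>
      ballIntegrand F (m + 1) n e f (Fin.cons r w) :=
    (measurable_ballIntegrand (m + 1) n e hf).comp
      ((continuous_cons_pair m n).comp (continuous_const.prodMk continuous_id)).measurable
  have hdetne : LinearMap.det (rowMul C : (Fin m → Fin n → F) →ₗ[ℝ] (Fin m → Fin n → F)) ≠ 0 := by
    rw [det_rowMul]
    refine pow_ne_zero _ fun h => ?_
    rw [h, abs_zero] at hJ
    exact (Real.rpow_pos_of_pos hpos _).ne hJ
  rw [lintegral_const_mul' _ _ ENNReal.ofReal_ne_top, lintegral_linearMap volume hdetne hm,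
    ← mul_assoc, ← ENNReal.ofReal_mul (Real.rpow_nonneg hpos.le _), det_rowMul, abs_pow, hJ]
  congr 2
  rw [← Real.rpow_natCast, ← Real.rpow_mul hpos.le, ← Real.rpow_neg hpos.le, ← Real.rpow_add hpos]
  congr 1
  ring

theorem lintegral_cons {m n : ℕ} {g : (Fin (m + 1) → Fin n → F) → ENNReal} (hg : Measurable g) :
    ∫⁻ w, g w = ∫⁻ r : Fin n → F, ∫⁻ w : Fin m → Fin n → F, g (Fin.cons r w) := by
  have h := (volume_preserving_piFinSuccAbove (fun _ : Fin (m + 1) => Fin n → F) 0).symm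
  rw [← h.lintegral_comp hg]
  have e : ∀ a : (Fin n → F) × (Fin m → Fin n → F),
      (MeasurableEquiv.piFinSuccAbove (fun _ : Fin (m + 1) => Fin n → F) 0).symm a =
      Fin.cons a.1 a.2 := by
    intro a
    simp only [MeasurableEquiv.piFinSuccAbove_symm_apply]
    exact Fin.insertNth_zero' a.1 a.2
  simp only [e]
  exact lintegral_prod _ (hg.comp (continuous_cons_pair m n).measurable).aemeasurable

theorem corner_law_succ {m n j p : ℕ} (hp : p = m + (n + 1) + j) {e : ℝ}
    (he : e = (j + 1) * d F / 2 - 1)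
    (ih : ∃ c : ENNReal, ∀ f : (Fin m → Fin (n + 1) → F) → ENNReal, Measurable f →
      ∫⁻ V : U F p, f (topLeft (by omega) (by omega) (V : Matrix (Fin p) (Fin p) F)) ∂(haarU F p) =
        c * ∫⁻ w, ballIntegrand F m (n + 1) e f w) :
    ∃ c : ENNReal, ∀ f : (Fin (m + 1) → Fin (n + 1) → F) → ENNReal, Measurable f →
      ∫⁻ V : U F (p + 1), f (topLeft (by omega) (by omega)
        (V : Matrix (Fin (p + 1)) (Fin (p + 1)) F)) ∂(haarU F (p + 1)) =
        c * ∫⁻ w, ballIntegrand F (m + 1) (n + 1) e f w := by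
  obtain ⟨c, hc⟩ := ih
  obtain ⟨c', hc'⟩ := exists_row_law (F := F) (n := n + 1) (k := m + 1 + j) (p := p) (by omega)
    (by omega)
  have hm : m ≤ p := by omega
  have hn : n + 1 ≤ p := by omega
  have hm' : m + 1 ≤ p + 1 := by omega
  have hn' : n + 1 ≤ p + 1 := by omega
  refine ⟨c' * c, fun f hf => ?_⟩
  set row : U F (p + 1) → Fin (n + 1) → F := fun V l =>
    (V : Matrix (Fin (p + 1)) (Fin (p + 1)) F) 0 (Fin.castLE hn' l) with hrow
  have hΘ := measurable_ballIntegrand (F := F) (m + 1) (n + 1) e hf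
  set Θ := ballIntegrand F (m + 1) (n + 1) e f with hΘdef
  have hΘc : Measurable fun a : (Fin (n + 1) → F) × (Fin m → Fin (n + 1) → F) =>
      Θ (Fin.cons a.1 a.2) := hΘ.comp (continuous_cons_pair m (n + 1)).measurable
  have hinner : Measurable fun r : Fin (n + 1) → F =>
      ∫⁻ w : Fin m → Fin (n + 1) → F, Θ (Fin.cons r w) := hΘc.lintegral_prod_right'
  set G : (Fin (n + 1) → F) → ENNReal := fun r =>
    ENNReal.ofReal ((1 - sqNorm r) ^ (-e - m * d F / 2)) *
      ∫⁻ w : Fin m → Fin (n + 1) → F, Θ (Fin.cons r w) with hG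
  have hGm : Measurable G :=
    (((measurable_const.sub continuous_sqNorm.measurable).pow_const _).ennreal_ofReal).mul hinner
  have h1 : ∀ V : U F (p + 1), sqNorm (row V) < 1 →
      ∫⁻ h : U F p, f (topLeft hm' hn'
        ((oneOplus h * V : U F (p + 1)) : Matrix (Fin (p + 1)) (Fin (p + 1)) F)) ∂(haarU F p) =
      c * G (row V) := by
    intro V hV
    obtain ⟨C, C', hCC, hC, hdet, hJ⟩ := exists_sqrt_one_sub hV
    obtain ⟨k, hk⟩ := exists_topLeft_oneOplus hm hn V (r := row V) rfl hC hCC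
    have hfC : Measurable fun w : Fin m → Fin (n + 1) → F =>
        f (Fin.cons (row V) (rowMul C w)) :=
      hf.comp ((continuous_cons_pair m (n + 1)).comp (continuous_const.prodMk
        (LinearMap.continuous_of_finiteDimensional (rowMul C)))).measurable
    simp only [hG, hΘdef]
    rw [← lintegral_ballIntegrand_rowMul hf hV hC hCC hdet hJ, ← hc _ hfC,
      ← lintegral_mul_right_eq_self (fun V' : U F p => f (Fin.cons (row V) (rowMul C
        (topLeft hm hn (V' : Matrix (Fin p) (Fin p) F))))) k]
    exact lintegral_congr fun h => congrArg f (hk h)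
  -- The law of the first row is carried by the open unit ball; this excludes the case where C is
  -- not invertible.
  have h2 : ∀ᵐ V ∂(haarU F (p + 1)), sqNorm (row V) < 1 := by
    have hi : Measurable ({x : Fin (n + 1) → F | 1 ≤ sqNorm x}.indicator fun _ => (1 : ENNReal)) :=
      measurable_const.indicator (measurableSet_le measurable_const continuous_sqNorm.measurable)
    have h := hc' _ hi
    have h0 : ∀ x : Fin (n + 1) → F, {x : Fin (n + 1) → F | sqNorm x < 1}.indicator
        (fun x => {x : Fin (n + 1) → F | 1 ≤ sqNorm x}.indicator (fun _ => (1 : ENNReal)) x *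
          ENNReal.ofReal ((1 - sqNorm x) ^ ((((m + 1 + j) * d F : ℕ) : ℝ) / 2 - 1))) x = 0 := by
      intro x
      by_cases hx : sqNorm x < 1
      · have hx' : x ∉ {x : Fin (n + 1) → F | 1 ≤ sqNorm x} := not_le.mpr hx
        simp [indicator_of_notMem hx']
      · exact indicator_of_notMem (s := {x : Fin (n + 1) → F | sqNorm x < 1}) hx _
    simp only [h0, lintegral_zero, mul_zero] at h
    have hrm : Measurable row := by
      refine Continuous.measurable (continuous_pi fun l => ?_)
      exact continuous_subtype_val.matrix_elem _ _
    have h' := (lintegral_eq_zero_iff (hi.comp hrm)).mp h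
    filter_upwards [h'] with V hV
    by_contra hlt
    have hmem : row V ∈ {x : Fin (n + 1) → F | 1 ≤ sqNorm x} := not_lt.mp hlt
    have : {x : Fin (n + 1) → F | 1 ≤ sqNorm x}.indicator (fun _ => (1 : ENNReal)) (row V) = 0 := hV
    rw [indicator_of_mem hmem] at this
    exact one_ne_zero this
  have hswap : Measurable (Function.uncurry fun (V : U F (p + 1)) (h : U F p) => f (topLeft hm' hn'
      ((oneOplus h * V : U F (p + 1)) : Matrix (Fin (p + 1)) (Fin (p + 1)) F))) :=
    hf.comp ((continuous_topLeft hm' hn').comp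
      ((continuous_oneOplus.comp continuous_snd).mul continuous_fst)).measurable
  -- An extra average over h ∈ U(p) is inserted by left invariance under 1 ⊕ h. After exchanging
  -- integrals, the inner one is the corner law for m rows with the first row fixed.
  calc ∫⁻ V : U F (p + 1), f (topLeft hm' hn'
        (V : Matrix (Fin (p + 1)) (Fin (p + 1)) F)) ∂(haarU F (p + 1))
      = ∫⁻ _h : U F p, ∫⁻ V : U F (p + 1), f (topLeft hm' hn'
          (V : Matrix (Fin (p + 1)) (Fin (p + 1)) F)) ∂(haarU F (p + 1)) ∂(haarU F p) := by
        rw [lintegral_const, measure_univ, mul_one]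
    _ = ∫⁻ h : U F p, ∫⁻ V : U F (p + 1), f (topLeft hm' hn' ((oneOplus h * V : U F (p + 1)) :
          Matrix (Fin (p + 1)) (Fin (p + 1)) F)) ∂(haarU F (p + 1)) ∂(haarU F p) :=
        lintegral_congr fun h => (lintegral_mul_left_eq_self (fun V : U F (p + 1) =>
          f (topLeft hm' hn' (V : Matrix (Fin (p + 1)) (Fin (p + 1)) F))) (oneOplus h)).symm
    _ = ∫⁻ V : U F (p + 1), ∫⁻ h : U F p, f (topLeft hm' hn' ((oneOplus h * V : U F (p + 1)) :
          Matrix (Fin (p + 1)) (Fin (p + 1)) F)) ∂(haarU F p) ∂(haarU F (p + 1)) :=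
        (lintegral_lintegral_swap hswap.aemeasurable).symm
    _ = ∫⁻ V : U F (p + 1), c * G (row V) ∂(haarU F (p + 1)) :=
        lintegral_congr_ae (h2.mono fun V hV => h1 V hV)
    _ = c' * ∫⁻ x : Fin (n + 1) → F, c * ∫⁻ w : Fin m → Fin (n + 1) → F, Θ (Fin.cons x w) := by
        rw [hc' (fun x => c * G x) (hGm.const_mul c)]
        congr 1
        refine lintegral_congr fun x => ?_
        by_cases hx : sqNorm x < 1
        · have hpos : 0 < 1 - sqNorm x := by linarith
          rw [indicator_of_mem (show x ∈ {x : Fin (n + 1) → F | sqNorm x < 1} from hx), hG,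
            mul_assoc c, mul_right_comm, ← ENNReal.ofReal_mul (Real.rpow_nonneg hpos.le _),
            ← Real.rpow_add hpos]
          -- The density of the first row cancels the powers from the change of variables exactly.
          have hexp : -e - m * d F / 2 + ((((m + 1 + j) * d F : ℕ) : ℝ) / 2 - 1) = 0 := by
            rw [he]
            push_cast
            ring
          rw [hexp, Real.rpow_zero, ENNReal.ofReal_one, one_mul]
        · rw [indicator_of_notMem (show x ∉ {x : Fin (n + 1) → F | sqNorm x < 1} from hx)]
          have hz : ∀ w : Fin m → Fin (n + 1) → F, Θ (Fin.cons x w) = 0 := fun w =>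
            indicator_of_notMem (fun h => hx (sqNorm_lt_one_of_mem_rectBall h)) _
          simp only [hz, lintegral_zero, mul_zero]
    _ = c' * c * ∫⁻ w, Θ w := by
        rw [lintegral_const_mul c hinner, ← lintegral_cons hΘ, mul_assoc]

/-- With no rows the matrix space is a point of volume 1, and the defect there is det I = 1. -/
theorem corner_law_zero {n j p : ℕ} (hp : p = 0 + (n + 1) + j) {e : ℝ} :
    ∃ c : ENNReal, ∀ f : (Fin 0 → Fin (n + 1) → F) → ENNReal, Measurable f →
      ∫⁻ V : U F p, f (topLeft (by omega) (by omega) (V : Matrix (Fin p) (Fin p) F)) ∂(haarU F p) =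
        c * ∫⁻ w, ballIntegrand F 0 (n + 1) e f w := by
  refine ⟨1, fun f hf => ?_⟩
  have h1 : ∀ w : Fin 0 → Fin (n + 1) → F, f w = f default := fun w => by
    rw [Subsingleton.elim w default]
  have h2 : ∀ w : Fin 0 → Fin (n + 1) → F, ballIntegrand F 0 (n + 1) e f w = f default := by
    intro w
    have hz : (Matrix.of w)ᴴ * Matrix.of w = (0 : Matrix (Fin (n + 1)) (Fin (n + 1)) F) := by
      ext i l
      simp [Matrix.mul_apply]
    have hmem : w ∈ rectBall F 0 (n + 1) := by
      rw [mem_rectBall]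
      intro x hx
      have : sqNorm (Matrix.of w *ᵥ x) = 0 := by simp [sqNorm]
      rw [this]
      exact lt_of_le_of_ne (sqNorm_nonneg x) fun h => hx (sqNorm_eq_zero.mp h.symm)
    rw [ballIntegrand, indicator_of_mem hmem, defect, hz, sub_zero, det_one, h1 w]
    simp
  have hv : (volume : Measure (Fin 0 → Fin (n + 1) → F)) Set.univ = 1 := by
    rw [volume_pi, Measure.pi_of_empty]
    simp
  simp only [h2]
  rw [lintegral_const, hv, one_mul, mul_one]
  simp only [fun V : U F p => h1 (topLeft (by omega) (by omega) (V : Matrix (Fin p) (Fin p) F))]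
  rw [lintegral_const, measure_univ, mul_one]

/-- The distribution of the upper left `m × n` block of a random unitary matrix. -/
theorem corner_law (m n j : ℕ) {p : ℕ} (hp : p = m + (n + 1) + j) :
    ∃ c : ENNReal, ∀ f : (Fin m → Fin (n + 1) → F) → ENNReal, Measurable f →
      ∫⁻ V : U F p, f (topLeft (by omega) (by omega) (V : Matrix (Fin p) (Fin p) F)) ∂(haarU F p) =
        c * ∫⁻ w, ballIntegrand F m (n + 1) ((j + 1) * d F / 2 - 1) f w := by
  induction m generalizing p with
  | zero => exact corner_law_zero hp
  | succ m ih =>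
    obtain ⟨p, rfl⟩ : ∃ p', p = p' + 1 := ⟨p - 1, by omega⟩
    -- The size p drops together with m, so j, and with it the exponent, stays fixed through the
    -- induction.
    exact corner_law_succ (by omega) rfl (ih (by omega))

theorem indicator_mul_indicator_one {α : Type*} (s b : Set α) (g : α → ENNReal) (w : α) :
    b.indicator (fun w => s.indicator (fun _ => 1) w * g w) w = (s ∩ b).indicator g w := by
  by_cases h1 : w ∈ b <;> by_cases h2 : w ∈ s <;> simp [h1, h2]

/-- The measure `m_p` is the distribution of the upper left block of a random unitary matrix. -/
theorem map_corner_haarU {p q : ℕ} (hq : 1 ≤ q) (hpq : 2 * q ≤ p) :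
    (haarU F p).map (fun V : U F p => corner q (V : Matrix (Fin p) (Fin p) F)) =
      ballMeasure F p q := by
  obtain ⟨n, rfl⟩ : ∃ n, q = n + 1 := ⟨q - 1, by omega⟩
  -- With p = 2q + j the exponent pd/2 - γ becomes (j + 1)d/2 - 1.
  obtain ⟨j, rfl⟩ : ∃ j, p = (n + 1) + (n + 1) + j := ⟨p - (n + 1) - (n + 1), by omega⟩
  obtain ⟨c, hc⟩ := corner_law (F := F) (n + 1) n j rfl
  have hball : MeasurableSet (ball F (n + 1)) := (isOpen_rectBall (F := F) (n + 1) (n + 1)).measurableSet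
  have hmeas : Measurable fun V : U F (n + 1 + (n + 1) + j) =>
      corner (n + 1) (V : Matrix (Fin (n + 1 + (n + 1) + j)) (Fin (n + 1 + (n + 1) + j)) F) :=
    (continuous_corner (q := n + 1)).measurable
  set e : ℝ := (j + 1) * d F / 2 - 1 with he
  have hexp : ((n + 1 + (n + 1) + j : ℕ) : ℝ) * d F / 2 - gam F (n + 1) = e := by
    rw [gam, he]
    push_cast
    ring
  have hdens : ballDensity F (n + 1 + (n + 1) + j) (n + 1) =
      fun w : Matrix (Fin (n + 1)) (Fin (n + 1)) F => ENNReal.ofReal (defect w ^ e) := by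
    funext w
    rw [ballDensity, hexp]
    rfl
  have hdm : Measurable (ballDensity F (n + 1 + (n + 1) + j) (n + 1)) := by
    rw [hdens]
    exact ((measurable_defect (F := F) (n + 1) (n + 1)).pow_const e).ennreal_ofReal
  have key : ∀ s : Set (Matrix (Fin (n + 1)) (Fin (n + 1)) F), MeasurableSet s →
      (haarU F (n + 1 + (n + 1) + j)).map (fun V : U F (n + 1 + (n + 1) + j) => corner (n + 1)
        (V : Matrix (Fin (n + 1 + (n + 1) + j)) (Fin (n + 1 + (n + 1) + j)) F)) s =
      c * ((lebesgue F (n + 1)).restrict (ball F (n + 1))).withDensity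
        (ballDensity F (n + 1 + (n + 1) + j) (n + 1)) s := by
    intro s hs
    have h := hc (Set.indicator s fun _ => 1) (measurable_const.indicator hs)
    rw [← lintegral_indicator_one hs, lintegral_map (measurable_one.indicator hs) hmeas]
    have e1 : ∀ V : U F (n + 1 + (n + 1) + j), corner (n + 1)
        (V : Matrix (Fin (n + 1 + (n + 1) + j)) (Fin (n + 1 + (n + 1) + j)) F) =
        topLeft (by omega) (by omega)
          (V : Matrix (Fin (n + 1 + (n + 1) + j)) (Fin (n + 1 + (n + 1) + j)) F) := by
      intro V
      ext i l
      rw [corner, mul_inclusion_apply (by omega), inclusion_mul_apply (by omega)]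
      rfl
    simp only [e1]
    refine h.trans ?_
    rw [withDensity_apply _ hs, Measure.restrict_restrict hs,
      ← lintegral_indicator (hs.inter hball), hdens]
    congr 1
    refine lintegral_congr fun w => ?_
    rw [ballIntegrand]
    have hb : rectBall F (n + 1) (n + 1) = ball F (n + 1) := rfl
    rw [hb]
    exact indicator_mul_indicator_one s _ _ w
  have hone := key Set.univ MeasurableSet.univ
  have hprob : IsProbabilityMeasure ((haarU F (n + 1 + (n + 1) + j)).map fun V : U F (n + 1 + (n + 1) + j) => corner (n + 1)
        (V : Matrix (Fin (n + 1 + (n + 1) + j)) (Fin (n + 1 + (n + 1) + j)) F)) :=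
    Measure.isProbabilityMeasure_map hmeas.aemeasurable
  rw [measure_univ, withDensity_apply _ MeasurableSet.univ, Measure.restrict_univ] at hone
  -- The constant is fixed by total mass 1; in particular κ needs no separate evaluation.
  have hcκ : c = (kappa F (n + 1 + (n + 1) + j) (n + 1))⁻¹ :=
    ENNReal.eq_inv_of_mul_eq_one_left hone.symm
  ext s hs
  rw [key s hs, ballMeasure, Measure.smul_apply, smul_eq_mul, hcκ]

end CornerInduction

/-! ### The integral representation -/

section Representation

variable {F : Type} [NormedDivisionRing F] [NormedAlgebra ℝ F] [StarRing F] [CStarRing F]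
  [FiniteDimensional ℝ F] [MeasureSpace F] [BorelSpace F] [Scalars F]

theorem measurable_gMat [ProperSpace F] [ScalarsLaws F] {q : ℕ} (t : Fin q → ℝ) :
    Measurable fun x : U₀ F q × Matrix (Fin q) (Fin q) F => gMat t x.1 x.2 := by
  have h1 : Continuous fun x : U₀ F q × Matrix (Fin q) (Fin q) F => coshSinh t x.2 :=
    (continuous_coshSinh t).comp continuous_snd
  have h2 : Continuous fun x : U₀ F q × Matrix (Fin q) (Fin q) F => gMat t x.1 x.2 := by
    simp only [gMat_eq]
    fun_prop
  exact h2.measurable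

theorem measurable_gMatTilde [ProperSpace F] [ScalarsLaws F] {q : ℕ} (t : Fin q → ℝ) :
    Measurable fun x : U₀ F q × Matrix (Fin q) (Fin q) F => gMatTilde t x.1 x.2 := by
  have h1 : Continuous fun x : U₀ F q × Matrix (Fin q) (Fin q) F => coshSinh t x.2 :=
    (continuous_coshSinh t).comp continuous_snd
  have h2 : Continuous fun x : U₀ F q × Matrix (Fin q) (Fin q) F => gMatTilde t x.1 x.2 := by
    simp only [gMatTilde_eq]
    fun_prop
  exact h2.measurable

theorem integralRepresentation [ScalarsLaws F] [CompactLaws F] {p q : ℕ} (hq : 1 ≤ q)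
    (hpq : 2 * q ≤ p) (lam : Fin q → ℂ) (t : Fin q → ℝ) : IntegralRepresentation F p lam t := by
  have : ProperSpace F := FiniteDimensional.proper_real F
  have : (volume : Measure F).IsAddHaarMeasure := ScalarsLaws.isAddHaar
  have hqp : q ≤ p := by omega
  set mu : Fin q → ℂ := fun i => spectral F p lam i / 2 with hmu
  have hcm : Measurable fun V : U F p => corner q (V : Matrix (Fin p) (Fin p) F) :=
    (continuous_corner (q := q)).measurable
  set Ψ : U₀ F q × U F p → U₀ F q × Matrix (Fin q) (Fin q) F :=
    Prod.map id fun V : U F p => corner q (V : Matrix (Fin p) (Fin p) F) with hΨ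
  have hΨm : Measurable Ψ := measurable_id.prodMap hcm
  -- By the corner law, every assertion about B_q pulls back to the compact group U_0(q) × U(p),
  -- where the integrands are continuous.
  have hmap : (haarU₀ F q).prod (ballMeasure F p q) =
      ((haarU₀ F q).prod (haarU F p)).map Ψ := by
    rw [← map_corner_haarU hq hpq, hΨ, ← Measure.map_prod_map _ _ measurable_id hcm,
      Measure.map_id]
  have hg : Measurable fun x : U₀ F q × Matrix (Fin q) (Fin q) F =>
      powerFunction mu (gMat t x.1 x.2) :=
    (measurable_powerFunction mu).comp (measurable_gMat t)
  have hg' : Measurable fun x : U₀ F q × Matrix (Fin q) (Fin q) F =>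
      powerFunction mu (gMatTilde t x.1 x.2) :=
    (measurable_powerFunction mu).comp (measurable_gMatTilde t)
  have hint := (continuous_powerFunction_gMat hqp mu t).integrable_of_hasCompactSupport
    (μ := (haarU₀ F q).prod (haarU F p)) (HasCompactSupport.of_compactSpace _)
  have hint' := (continuous_powerFunction_gMatTilde hqp mu t).integrable_of_hasCompactSupport
    (μ := (haarU₀ F q).prod (haarU F p)) (HasCompactSupport.of_compactSpace _)
  have hφ := sphericalFunction_eq_integral_gramPower (F := F) (by omega : q < p) lam t
  have h1 := integral_powerFunction_gMat (F := F) hqp mu t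
  have h2 := integral_powerFunction_gMatTilde (F := F) hqp mu t
  refine ⟨fun k => ?_, integrable_harishChandraIntegrand hqp lam t, ?_, ?_, ?_, ?_⟩
  · obtain ⟨s, hs⟩ := exists_isAbelianPart hqp t k
    refine ⟨s, hs, fun s' hs' => ?_⟩
    rw [blockK_eq] at hs hs'
    exact isAbelianPart_unique hqp hs' hs
  · rw [hmap, integrable_map_measure hg.aestronglyMeasurable hΨm.aemeasurable]
    exact hint
  · rw [hmap, integrable_map_measure hg'.aestronglyMeasurable hΨm.aemeasurable]
    exact hint'
  · rw [hmap, integral_map hΨm.aemeasurable hg.aestronglyMeasurable, hφ]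
    exact h1.symm
  · rw [hmap, integral_map hΨm.aemeasurable hg'.aestronglyMeasurable, hφ]
    exact h1.symm.trans h2.symm

end Representation

/-! ### The determinants over `ℝ`, `ℂ` and `ℍ` -/

section Determinants

instance : ScalarsLaws ℝ where
  isAddHaar := inferInstance
  det_gram_triangular T hT := by
    change ((Matrix.det _ : ℝ) : ℂ) = _
    congr 1
    rw [det_mul, det_conjTranspose, det_of_isUpperTriangular hT, star_trivial,
      ← Finset.prod_mul_distrib]
    exact Finset.prod_congr rfl fun i _ => by rw [Real.norm_eq_abs, sq_abs, sq]
  continuousAt_det _ _ _ :=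
    (Complex.continuous_ofReal.comp continuous_id.matrix_det).continuousAt
  measurable_det {_} _ _ := (Complex.continuous_ofReal.comp continuous_id.matrix_det).measurable
  det_congr C X := by
    change ((Matrix.det _ : ℝ) : ℂ) = ((Matrix.det _ : ℝ) : ℂ) * ((Matrix.det _ : ℝ) : ℂ)
    rw [← Complex.ofReal_mul]
    simp only [det_mul]
    congr 1
    ring

instance : ScalarsLaws ℂ where
  isAddHaar := inferInstance
  det_gram_triangular T hT := by
    change Matrix.det _ = _
    rw [det_mul, det_conjTranspose, det_of_isUpperTriangular hT, Complex.ofReal_prod, star_prod,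
      ← Finset.prod_mul_distrib]
    exact Finset.prod_congr rfl fun i _ => by
      rw [Complex.star_def, Complex.conj_mul', Complex.ofReal_pow]
  continuousAt_det _ _ _ := continuous_id.matrix_det.continuousAt
  measurable_det {_} _ _ := continuous_id.matrix_det.measurable
  det_congr C X := by
    change Matrix.det _ = Matrix.det _ * Matrix.det _
    simp only [det_mul]
    ring

variable {n : Type}

theorem toComplexMatrix_mul [Fintype n] (A B : Matrix n n ℍ[ℝ]) :
    toComplexMatrix (A * B) = toComplexMatrix A * toComplexMatrix B := by
  have hre : ∀ f : n → ℍ[ℝ], (∑ k, f k).re = ∑ k, (f k).re := fun f =>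
    map_sum (QuaternionAlgebra.reₗ (-1 : ℝ) 0 (-1)) f _
  have hi : ∀ f : n → ℍ[ℝ], (∑ k, f k).imI = ∑ k, (f k).imI := fun f =>
    map_sum (QuaternionAlgebra.imIₗ (-1 : ℝ) 0 (-1)) f _
  have hj : ∀ f : n → ℍ[ℝ], (∑ k, f k).imJ = ∑ k, (f k).imJ := fun f =>
    map_sum (QuaternionAlgebra.imJₗ (-1 : ℝ) 0 (-1)) f _
  have hk : ∀ f : n → ℍ[ℝ], (∑ k, f k).imK = ∑ k, (f k).imK := fun f =>
    map_sum (QuaternionAlgebra.imKₗ (-1 : ℝ) 0 (-1)) f _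
  rw [toComplexMatrix, toComplexMatrix, toComplexMatrix, fromBlocks_multiply]
  congr 1 <;> ext i j <;> apply Complex.ext <;>
    simp only [of_apply, Matrix.mul_apply, Matrix.add_apply, hre, hi, hj, hk, Complex.add_re,
      Complex.add_im, Complex.re_sum, Complex.im_sum, Complex.mul_re, Complex.mul_im,
      ← Finset.sum_add_distrib, ← Finset.sum_neg_distrib, Quaternion.re_mul, Quaternion.imI_mul,
      Quaternion.imJ_mul, Quaternion.imK_mul] <;>
    exact Finset.sum_congr rfl fun k _ => by ring

theorem toComplexMatrix_conjTranspose (A : Matrix n n ℍ[ℝ]) :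
    toComplexMatrix Aᴴ = (toComplexMatrix A)ᴴ := by
  rw [toComplexMatrix, toComplexMatrix, fromBlocks_conjTranspose]
  congr 1 <;> ext i j <;> apply Complex.ext <;> simp

theorem continuous_toComplexMatrix :
    Continuous (toComplexMatrix : Matrix n n ℍ[ℝ] → Matrix (n ⊕ n) (n ⊕ n) ℂ) := by
  have h : Continuous fun x : ℝ × ℝ => (⟨x.1, x.2⟩ : ℂ) :=
    Complex.equivRealProdCLM.symm.continuous
  have hre (i j : n) : Continuous fun A : Matrix n n ℍ[ℝ] => (A i j).re :=
    Quaternion.continuous_re.comp (continuous_id.matrix_elem i j)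
  have hi (i j : n) : Continuous fun A : Matrix n n ℍ[ℝ] => (A i j).imI :=
    Quaternion.continuous_imI.comp (continuous_id.matrix_elem i j)
  have hj (i j : n) : Continuous fun A : Matrix n n ℍ[ℝ] => (A i j).imJ :=
    Quaternion.continuous_imJ.comp (continuous_id.matrix_elem i j)
  have hk (i j : n) : Continuous fun A : Matrix n n ℍ[ℝ] => (A i j).imK :=
    Quaternion.continuous_imK.comp (continuous_id.matrix_elem i j)
  refine Continuous.matrix_fromBlocks ?_ ?_ ?_ ?_ <;> refine continuous_matrix fun i j => ?_
  · exact h.comp ((hre i j).prodMk (hi i j))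
  · exact h.comp ((hj i j).prodMk (hk i j))
  · exact h.comp ((hj i j).neg.prodMk (hk i j))
  · exact h.comp ((hre i j).prodMk (hi i j).neg)

/-- Ordering the coordinates by pairs makes the complex matrix block triangular, with 2 × 2 diagonal
blocks of determinant ‖T k k‖². -/
theorem det_toComplexMatrix_triangular [Fintype n] [DecidableEq n] [LinearOrder n]
    {T : Matrix n n ℍ[ℝ]} (hT : T.BlockTriangular id) :
    (toComplexMatrix T).det = ((∏ i, ‖T i i‖ ^ 2 : ℝ) : ℂ) := by
  have hb : (toComplexMatrix T).BlockTriangular (Sum.elim id id : n ⊕ n → n) := by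
    rintro (i | i) (j | j) hij <;>
    · have h0 : T i j = 0 := hT hij
      apply Complex.ext <;> simp [toComplexMatrix, h0]
  rw [hb.det_fintype, Complex.ofReal_prod]
  refine Finset.prod_congr rfl fun k _ => ?_
  let e : Fin 2 ≃ {a : n ⊕ n // Sum.elim id id a = k} :=
    { toFun := ![⟨Sum.inl k, rfl⟩, ⟨Sum.inr k, rfl⟩]
      invFun := fun a => Sum.elim (fun _ => 0) (fun _ => 1) a.1
      left_inv := by intro i; fin_cases i <;> rfl
      right_inv := by rintro ⟨a | a, rfl⟩ <;> rfl }
  rw [← det_submatrix_equiv_self e, det_fin_two]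
  have h1 : ‖T k k‖ ^ 2 = (T k k).re ^ 2 + (T k k).imI ^ 2 + (T k k).imJ ^ 2 + (T k k).imK ^ 2 := by
    rw [sq, ← Quaternion.normSq_eq_norm_mul_self, Quaternion.normSq_def']
  rw [h1]
  apply Complex.ext <;>
    simp [e, toComplexMatrix, toSquareBlock, toSquareBlockProp, -Complex.ofReal_pow,
      -Complex.ofReal_add] <;> ring

/-- A nonnegative real factor does not change the argument, so no branch problem arises; s ≠ 0 is
needed when a factor vanishes. -/
theorem ofReal_mul_cpow {a : ℝ} (ha : 0 ≤ a) (z s : ℂ) (hs : s ≠ 0) :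
    ((a : ℂ) * z) ^ s = (a : ℂ) ^ s * z ^ s := by
  rcases ha.eq_or_lt with rfl | ha
  · simp [Complex.zero_cpow hs]
  by_cases hz : z = 0
  · simp [hz, Complex.zero_cpow hs]
  have ha' : (a : ℂ) ≠ 0 := by exact_mod_cast ha.ne'
  rw [Complex.cpow_def_of_ne_zero (mul_ne_zero ha' hz), Complex.cpow_def_of_ne_zero ha',
    Complex.cpow_def_of_ne_zero hz, Complex.log_ofReal_mul ha hz, ← Complex.exp_add, add_mul,
    Complex.ofReal_log ha.le]

theorem det_toComplexMatrix_gram [Fintype n] [DecidableEq n] (A : Matrix n n ℍ[ℝ]) :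
    (toComplexMatrix (Aᴴ * A)).det = ((‖(toComplexMatrix A).det‖ ^ 2 : ℝ) : ℂ) := by
  rw [toComplexMatrix_mul, toComplexMatrix_conjTranspose, det_mul, det_conjTranspose,
    Complex.star_def, Complex.conj_mul', Complex.ofReal_pow]

instance : ScalarsLaws ℍ[ℝ] where
  isAddHaar := inferInstance
  det_gram_triangular T hT := by
    change (toComplexMatrix _).det ^ (1 / 2 : ℂ) = _
    have h : 0 ≤ ∏ i, ‖T i i‖ ^ 2 := Finset.prod_nonneg fun i _ => sq_nonneg _
    rw [det_toComplexMatrix_gram, det_toComplexMatrix_triangular hT, Complex.norm_real,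
      Real.norm_of_nonneg h, show (1 / 2 : ℂ) = ((1 / 2 : ℝ) : ℂ) by norm_num,
      ← Complex.ofReal_cpow (sq_nonneg _), ← Real.sqrt_eq_rpow, Real.sqrt_sq h]
  -- The square root is discontinuous on the negative axis; at the Gram matrix of an invertible
  -- triangular matrix the complex determinant is positive.
  continuousAt_det T hT h0 := by
    refine ContinuousAt.cpow (continuous_toComplexMatrix.matrix_det).continuousAt
      continuousAt_const ?_
    rw [det_toComplexMatrix_gram, det_toComplexMatrix_triangular hT, Complex.norm_real]
    refine Complex.ofReal_mem_slitPlane.mpr (pow_pos (norm_pos_iff.mpr ?_) 2)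
    exact Finset.prod_ne_zero_iff.mpr fun i _ => pow_ne_zero 2 (norm_ne_zero_iff.mpr (h0 i))
  measurable_det {_} _ _ := (continuous_toComplexMatrix.matrix_det).measurable.pow_const (1 / 2 : ℂ)
  det_congr C X := by
    change (toComplexMatrix _).det ^ (1 / 2 : ℂ) =
      (toComplexMatrix _).det ^ (1 / 2 : ℂ) * (toComplexMatrix _).det ^ (1 / 2 : ℂ)
    rw [det_toComplexMatrix_gram, ← ofReal_mul_cpow (sq_nonneg _) _ _ (by norm_num),
      ← det_toComplexMatrix_gram]
    simp only [toComplexMatrix_mul, det_mul]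
    congr 1
    ring

end Determinants

/-! ### The maximal compact subgroups over `ℝ`, `ℂ` and `ℍ` -/

section Contraction

variable {F : Type} [NormedDivisionRing F] [NormedAlgebra ℝ F] [StarRing F] [CStarRing F]
  [FiniteDimensional ℝ F] [MeasureSpace F] [BorelSpace F] [Scalars F] {p q : ℕ}

/-- The bracket relation reads HX = X(H + c), and exponentials intertwine. -/
theorem aMat_mul_rootSpace {α : Fin q → ℝ} {X : BigMat F p q} (hX : X ∈ rootSpace F p q α)
    (t : Fin q → ℝ) :
    aMat F p t * X = Real.exp (∑ i, α i * t i) • (X * aMat F p t) := by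
  set c := ∑ i, α i * t i with hc
  have h1 : Hmat F p t * X = X * (Hmat F p t + diagonal fun _ => algebraMap ℝ F c) := by
    have h2 : X * (diagonal fun _ => algebraMap ℝ F c) = c • X := by
      ext i j
      rw [mul_diagonal, Matrix.smul_apply, Algebra.smul_def, Algebra.commutes]
    rw [Matrix.mul_add, h2, ← hX.2 t]
    abel
  have hs : ∀ (Y : BigMat F p q) (a : ℝ), Y * (diagonal fun _ => algebraMap ℝ F a) = a • Y := by
    intro Y a
    ext i j
    rw [mul_diagonal, Matrix.smul_apply, Algebra.smul_def, Algebra.commutes]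
  have hs' : ∀ (Y : BigMat F p q) (a : ℝ), (diagonal fun _ => algebraMap ℝ F a) * Y = a • Y := by
    intro Y a
    ext i j
    rw [diagonal_mul, Matrix.smul_apply, Algebra.smul_def]
  have hexp : NormedSpace.exp (diagonal fun _ => algebraMap ℝ F c : BigMat F p q) =
      diagonal fun _ => algebraMap ℝ F (Real.exp c) := by
    have : CompleteSpace F := FiniteDimensional.complete ℝ F
    let : NormedAlgebra ℚ F := .restrictScalars ℚ ℝ F
    rw [Matrix.exp_diagonal]
    congr 1
    ext i
    rw [Pi.coe_exp, Real.exp_eq_exp_ℝ, NormedSpace.algebraMap_exp_comm (𝕂 := ℝ)]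
  rw [aMat, matrix_exp_intertwine h1,
    matrix_exp_add (show Commute _ _ from (hs _ _).trans (hs' _ _).symm), hexp, hs, Matrix.mul_smul]

section

attribute [local instance] Matrix.linftyOpNormedRing Matrix.linftyOpNormedAlgebra

theorem continuous_matrix_exp {n : Type} [Fintype n] [DecidableEq n] :
    Continuous (NormedSpace.exp : Matrix n n F → Matrix n n F) := by
  have : CompleteSpace F := FiniteDimensional.complete ℝ F
  let : NormedAlgebra ℚ F := .restrictScalars ℚ ℝ F
  exact NormedSpace.exp_continuous

end

theorem aMat_mul_neg (t : Fin q → ℝ) : aMat F p t * aMat F p (-t) = 1 := by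
  simpa using aMat_neg_mul (F := F) (p := p) (-t)

theorem Hmat_neg (t : Fin q → ℝ) : Hmat F p (-t) = -Hmat F p t := by
  rw [Hmat, Hmat, rectDiag_eq, rectDiag_eq, realDiag_neg, fromBlocks_neg]
  simp

theorem aMat_add_self (t : Fin q → ℝ) : aMat F p (t + t) = aMat F p t * aMat F p t := by
  have h : Hmat F p (t + t) = Hmat F p t + Hmat F p t := by
    rw [Hmat, Hmat, rectDiag_eq, rectDiag_eq, ← realDiag_add, Matrix.add_mul, conjTranspose_add,
      fromBlocks_add, add_zero, add_zero]
  rw [aMat, h, matrix_exp_add (Commute.refl _), aMat]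

theorem aMat_mul_formJ (t : Fin q → ℝ) :
    aMat F p t * formJ F p q = formJ F p q * aMat F p (-t) := by
  rw [aMat, aMat, Hmat_neg, matrix_exp_intertwine (Hmat_mul_formJ t)]

/-- Conjugation by `a_{-st}`, with `t` in the positive chamber and `s → ∞`, contracts `N` to `1`. -/
theorem exists_tendsto_conj_groupN {n : BigMat F p q} (hn : n ∈ groupN F p q) :
    ∃ t : ℝ → Fin q → ℝ, Filter.Tendsto (fun s => aMat F p (-t s) * n * aMat F p (t s))
      Filter.atTop (nhds 1) := by
  obtain ⟨X, hX, rfl⟩ := hn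
  set t : ℝ → Fin q → ℝ := fun s i => s * ((q : ℝ) - (i : ℕ)) with ht
  have key : Filter.Tendsto (fun s => aMat F p (-t s) * X * aMat F p (t s))
      Filter.atTop (nhds 0) := by
    induction hX using Submodule.iSup_induction' with
    | mem α x hx =>
      by_cases hα : α ∈ positiveRoots q
      · simp only [hα, iSup_pos] at hx
        have h1 : ∀ s, aMat F p (-t s) * x * aMat F p (t s) =
            Real.exp (-(s * ∑ i, α i * ((q : ℝ) - (i : ℕ)))) • x := by
          intro s
          have e : ∑ i, α i * (-t s) i = -(s * ∑ i, α i * ((q : ℝ) - (i : ℕ))) := by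
            rw [Finset.mul_sum, ← Finset.sum_neg_distrib]
            refine Finset.sum_congr rfl fun i _ => ?_
            simp only [ht, Pi.neg_apply]
            ring
          rw [aMat_mul_rootSpace hx, e, Matrix.smul_mul, Matrix.mul_assoc, aMat_neg_mul,
            Matrix.mul_one]
        simp only [h1]
        have h2 : Filter.Tendsto (fun s : ℝ => Real.exp (-(s * ∑ i, α i * ((q : ℝ) - (i : ℕ)))))
            Filter.atTop (nhds 0) :=
          Real.tendsto_exp_neg_atTop_nhds_zero.comp
            (Filter.tendsto_id.atTop_mul_const (positiveRoots_pos hα))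
        simpa using h2.smul_const x
      · simp only [hα, not_false_eq_true, iSup_neg, Submodule.mem_bot] at hx
        simp [hx]
    | zero => simp
    | add x y _ _ h1 h2 =>
      simpa [Matrix.mul_add, Matrix.add_mul] using h1.add h2
  refine ⟨t, ?_⟩
  have h3 : ∀ s, aMat F p (-t s) * NormedSpace.exp X * aMat F p (t s) =
      NormedSpace.exp (aMat F p (-t s) * X * aMat F p (t s)) := by
    intro s
    have h : X * aMat F p (t s) = aMat F p (t s) * (aMat F p (-t s) * X * aMat F p (t s)) := by
      rw [← Matrix.mul_assoc, ← Matrix.mul_assoc, aMat_mul_neg, Matrix.one_mul]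
    rw [Matrix.mul_assoc, matrix_exp_intertwine h, ← Matrix.mul_assoc, aMat_neg_mul,
      Matrix.one_mul]
  simp only [h3]
  have h4 := (continuous_matrix_exp (F := F) (n := Fin q ⊕ Fin p)).tendsto 0
  rw [NormedSpace.exp_zero] at h4
  exact h4.comp key

end Contraction

/-! ### Determinants of the Iwasawa factors over commutative scalars -/

section Commutative

variable {F : Type} [NormedField F] [NormedAlgebra ℝ F] [StarRing F] [CStarRing F]
  [FiniteDimensional ℝ F] [MeasureSpace F] [BorelSpace F] [Scalars F] {p q : ℕ}

theorem norm_det_unitary {n : ℕ} (u : U F n) : ‖(u : Matrix (Fin n) (Fin n) F).det‖ = 1 := by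
  have h := congrArg Matrix.det (unitary_conjTranspose_mul u)
  rw [det_mul, det_conjTranspose, Matrix.det_one] at h
  have h2 := CStarRing.norm_star_mul_self (x := (u : Matrix (Fin n) (Fin n) F).det)
  rw [h, norm_one] at h2
  nlinarith [norm_nonneg (u : Matrix (Fin n) (Fin n) F).det]

/-- J conjugates a_t to its inverse, so the determinant squares to 1; and a_t is itself the square
of a_{t/2}. -/
theorem det_aMat (t : Fin q → ℝ) : (aMat F p t).det = 1 := by
  have hJ : (formJ F p q).det * (formJ F p q).det = 1 := by
    rw [← det_mul, formJ_mul_formJ, Matrix.det_one]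
  have h1 : ∀ s : Fin q → ℝ, (aMat F p s).det * (aMat F p s).det = 1 := by
    intro s
    have h3 := congrArg Matrix.det (aMat_mul_formJ (F := F) (p := p) s)
    rw [det_mul, det_mul, mul_comm] at h3
    have h4 : (aMat F p s).det = (aMat F p (-s)).det :=
      mul_left_cancel₀ (left_ne_zero_of_mul_eq_one hJ) h3
    have h5 := congrArg Matrix.det (aMat_neg_mul (F := F) (p := p) s)
    rwa [det_mul, Matrix.det_one, ← h4] at h5
  have h6 : t = (fun i => t i / 2) + fun i => t i / 2 := by
    ext i
    simp
  rw [h6, aMat_add_self, det_mul, h1]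

/-- Conjugation by elements of A contracts n to 1 without changing its determinant. -/
theorem det_groupN {n : BigMat F p q} (hn : n ∈ groupN F p q) : n.det = 1 := by
  obtain ⟨t, ht⟩ := exists_tendsto_conj_groupN hn
  have h1 := ((continuous_id (X := BigMat F p q)).matrix_det.tendsto 1).comp ht
  have h2 : (Matrix.det ∘ fun s => aMat F p (-t s) * n * aMat F p (t s)) = fun _ => n.det := by
    ext s
    simp [det_aMat]
  have h3 : Filter.Tendsto (fun _ : ℝ => n.det) Filter.atTop (nhds 1) := by
    rw [← h2]
    simpa using h1
  exact tendsto_nhds_unique tendsto_const_nhds h3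

theorem det_blockU (u : U F q) (v : U F p) : (blockU u v).det =
    (u : Matrix (Fin q) (Fin q) F).det * (v : Matrix (Fin p) (Fin p) F).det := by
  rw [blockU, det_fromBlocks_zero₂₁]

theorem det_mul_det_of_aMat_mul {t s : Fin q → ℝ} {u k₁ : U F q} {v k₂ : U F p}
    {n : BigMat F p q} (hn : n ∈ groupN F p q)
    (h : aMat F p t * blockU u v = blockU k₁ k₂ * aMat F p s * n) :
    (u : Matrix (Fin q) (Fin q) F).det * (v : Matrix (Fin p) (Fin p) F).det =
      (k₁ : Matrix (Fin q) (Fin q) F).det * (k₂ : Matrix (Fin p) (Fin p) F).det := by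
  have := congrArg Matrix.det h
  simpa [det_aMat, det_groupN hn, det_blockU] using this

/-- Both determinants are corrected by diagonal matrices that agree on the first q coordinates. -/
theorem exists_det_one_mul (hqp : q < p) (u : U F q) (v : U F p) :
    ∃ (k : U F q × U F p) (d : Fin q → F) (hd : ∀ i, ‖d i‖ = 1) (w : U F p),
      (k.1 : Matrix (Fin q) (Fin q) F).det = 1 ∧ (k.2 : Matrix (Fin p) (Fin p) F).det = 1 ∧
      (w : Matrix (Fin p) (Fin p) F) * inclusion F p q = inclusion F p q * diagonal d ∧
      u = k.1 * unitaryDiagonal d hd ∧ v = k.2 * w := by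
  set a := (u : Matrix (Fin q) (Fin q) F).det with ha
  set b := (v : Matrix (Fin p) (Fin p) F).det with hb
  have ha1 : ‖a‖ = 1 := norm_det_unitary u
  have hb1 : ‖b‖ = 1 := norm_det_unitary v
  have ha0 : a ≠ 0 := norm_ne_zero_iff.mp (by rw [ha1]; exact one_ne_zero)
  have hb0 : b ≠ 0 := norm_ne_zero_iff.mp (by rw [hb1]; exact one_ne_zero)
  let c : ℕ → F := fun i => if i = 0 then a else 1
  have hc : ∀ i, ‖c i‖ = 1 := fun i => by
    simp only [c]
    split
    · exact ha1
    · exact norm_one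
  -- The free coordinate q < p carries a⁻¹b, so that the product of the first q + 1 entries is b.
  let e : ℕ → F := fun i => if i < q then c i else if i = q then a⁻¹ * b else 1
  have he : ∀ i, ‖e i‖ = 1 := fun i => by
    simp only [e]
    split
    · exact hc i
    · split
      · rw [norm_mul, norm_inv, ha1, hb1, inv_one, one_mul]
      · exact norm_one
  have hcq : ∏ i : Fin q, c i = a := by
    rcases Nat.eq_zero_or_pos q with rfl | hq
    · simp [ha]
    · rw [Fintype.prod_eq_single ⟨0, hq⟩ (fun i hi => ?_)]
      · simp [c]
      · have : (i : ℕ) ≠ 0 := fun h => hi (Fin.ext h)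
        simp [c, this]
  have hep : ∏ i : Fin p, e i = b := by
    have h1 : ∏ i ∈ Finset.range q, e i = a := by
      rw [← hcq, ← Fin.prod_univ_eq_prod_range]
      exact Finset.prod_congr rfl fun i _ => by simp [e]
    have h2 : ∏ i ∈ Finset.range (q + 1), e i = b := by
      rw [Finset.prod_range_succ, h1]
      simp [e, ha0]
    rw [Fin.prod_univ_eq_prod_range, ← h2]
    symm
    refine Finset.prod_subset (Finset.range_subset_range.mpr hqp) fun i _ hi => ?_
    have : ¬ i < q + 1 := by simpa using hi
    have h3 : ¬ i < q := by omega
    have h4 : i ≠ q := by omega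
    simp [e, h3, h4]
  refine ⟨(u * (unitaryDiagonal (fun i : Fin q => c i) fun i => hc i)⁻¹,
    v * (unitaryDiagonal (fun i : Fin p => e i) fun i => he i)⁻¹), fun i => c i, fun i => hc i,
    unitaryDiagonal (fun i : Fin p => e i) fun i => he i, ?_, ?_, ?_, by simp, by simp⟩
  · have h := congrArg (fun x : U F q => (x : Matrix (Fin q) (Fin q) F).det)
      (inv_mul_cancel_right u (unitaryDiagonal (fun i : Fin q => c i) fun i => hc i))
    simp only [Submonoid.coe_mul, det_mul, coe_unitaryDiagonal, det_diagonal, hcq] at h ⊢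
    exact mul_right_cancel₀ ha0 (h.trans (one_mul _).symm)
  · have h := congrArg (fun x : U F p => (x : Matrix (Fin p) (Fin p) F).det)
      (inv_mul_cancel_right v (unitaryDiagonal (fun i : Fin p => e i) fun i => he i))
    simp only [Submonoid.coe_mul, det_mul, coe_unitaryDiagonal, det_diagonal, hep] at h ⊢
    exact mul_right_cancel₀ hb0 (h.trans (one_mul _).symm)
  · ext i j
    rw [coe_unitaryDiagonal, diagonal_mul, mul_diagonal, inclusion_apply]
    by_cases hij : (i : ℕ) = j
    · simp [hij, e]
    · simp [hij]

end Commutative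

/-! ### Membership of the unitary Iwasawa factor in K -/

section Instances

/-- Replace t by τt: the upper rows stay invertible, so their determinant keeps its sign from τ = 0,
where it is det u = 1. As det T > 0, also det k > 0. -/
theorem det_eq_one_of_topRows {p q : ℕ} (hqp : q ≤ p) {t s : Fin q → ℝ} {u k : U ℝ q} {v : U ℝ p}
    {T : Matrix (Fin q) (Fin q) ℝ} (hu : (u : Matrix (Fin q) (Fin q) ℝ).det = 1)
    (hT : T.BlockTriangular id) (hs : ∀ i, T i i = Real.exp (s i))
    (h : topRows t (u : Matrix (Fin q) (Fin q) ℝ) (v : Matrix (Fin p) (Fin p) ℝ) =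
      (k : Matrix (Fin q) (Fin q) ℝ) * T) :
    (k : Matrix (Fin q) (Fin q) ℝ).det = 1 := by
  let f : ℝ → ℝ := fun τ => (topRows (fun i => τ * t i) (u : Matrix (Fin q) (Fin q) ℝ)
    (v : Matrix (Fin p) (Fin p) ℝ)).det
  have hf : Continuous f := by
    refine Continuous.matrix_det ?_
    unfold topRows realDiag
    have := Real.continuous_cosh
    have := Real.continuous_sinh
    refine Continuous.add ?_ ?_ <;> refine Continuous.matrix_mul ?_ continuous_const <;>
      refine Continuous.matrix_diagonal (continuous_pi fun i => ?_)
    · exact Real.continuous_cosh.comp (continuous_mul_const _)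
    · exact Real.continuous_sinh.comp (continuous_mul_const _)
  have h0 : ∀ τ, f τ ≠ 0 := by
    intro τ hτ
    obtain ⟨x, hx, hx0⟩ := Matrix.exists_mulVec_eq_zero_iff.mpr hτ
    exact hx (topRows_injective hqp _ u v x hx0)
  have hf0 : f 0 = 1 := by
    simp [f, topRows, realDiag, hu]
  have hf1 : 0 < f 1 := by
    by_contra hneg
    obtain ⟨τ, -, hτ⟩ := intermediate_value_Icc' zero_le_one hf.continuousOn
      ⟨not_lt.mp hneg, hf0.symm ▸ zero_le_one⟩
    exact h0 τ hτ
  have hf1' : f 1 = (k : Matrix (Fin q) (Fin q) ℝ).det * T.det := by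
    rw [← det_mul, ← h]
    simp [f]
  have hTpos : 0 < T.det := by
    rw [det_of_isUpperTriangular hT]
    exact Finset.prod_pos fun i _ => by rw [hs]; exact Real.exp_pos _
  have hk : 0 < (k : Matrix (Fin q) (Fin q) ℝ).det := by
    rw [hf1'] at hf1
    exact pos_of_mul_pos_left hf1 hTpos.le
  have := norm_det_unitary k
  rwa [Real.norm_of_nonneg hk.le] at this

instance : CompactLaws ℝ where
  exists_mul hqp u v := by
    obtain ⟨k, d, hd, w, h1, h2, h⟩ := exists_det_one_mul hqp u v
    exact ⟨k, ⟨h1, h2⟩, d, hd, w, h⟩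
  mem_K hqp t s u k₁ v k₂ T n hK hT hs hk hn h := by
    have h1 := det_eq_one_of_topRows hqp hK.1 hT hs hk
    have h2 := det_mul_det_of_aMat_mul hn h
    rw [hK.1, hK.2, h1, one_mul, one_mul] at h2
    exact ⟨h1, h2.symm⟩

instance : CompactLaws ℂ where
  exists_mul hqp u v := by
    obtain ⟨k, d, hd, w, h1, h2, h⟩ := exists_det_one_mul hqp u v
    exact ⟨k, show _ * _ = (1 : ℂ) by rw [h1, h2, one_mul], d, hd, w, h⟩
  mem_K _ _ _ _ _ _ _ _ _ hK _ _ _ hn h := (det_mul_det_of_aMat_mul hn h).symm.trans hK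

instance : CompactLaws ℍ[ℝ] where
  exists_mul {p q} _ u v :=
    ⟨(u, v), trivial, 1, fun _ => norm_one, 1, by simp, by
      have : unitaryDiagonal (1 : Fin q → ℍ[ℝ]) (fun _ => norm_one) = 1 :=
        Subtype.ext diagonal_one
      simp [this], by simp⟩
  mem_K _ _ _ _ _ _ _ _ _ _ _ _ _ _ _ := trivial

end Instances

end Grassmann

end

theorem corollary2p2 (p q : ℕ) (hq : 1 ≤ q) (hpq : 2 * q ≤ p)
    (lam : Fin q → ℂ) (t : Fin q → ℝ) :
    Grassmann.IntegralRepresentation ℝ p lam t ∧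
    Grassmann.IntegralRepresentation ℂ p lam t ∧
    Grassmann.IntegralRepresentation ℍ[ℝ] p lam t :=
  ⟨Grassmann.integralRepresentation hq hpq lam t, Grassmann.integralRepresentation hq hpq lam t,
    Grassmann.integralRepresentation hq hpq lam t⟩
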